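/- Let $d\ge 1$, $p\ge 0$, $k\ge 1$ be integers, $\sigma,\gamma>0$, $A_*\in\mathbb{R}^{d\times d}$ with spectral radius $\rho(A_*)<1$, $B_*\in\mathbb{R}^{d\times p}$ known, and $x_0\in\mathbb{R}^d$ a fixed initial state. For a matrix $A\in\mathbb{R}^{d\times d}$ consider the system $$x_{t+1}=Ax_t+B_*u_t+\eta_t,\qquad t=0,1,2,\dots,\qquad \eta_t\ \text{i.i.d.}\ \sim\mathcal{N}(0,\sigma^2 I).$$ An algorithm chooses each input $u_t\in\mathbb{R}^p$ and each estimate $\hat A_t\in\mathbb{R}^{d\times d}$ as measurable functions (not depending on $A$) of $x_0,\dots,x_t$ and of an internal random seed that is independent of the noise. $\mathbb{P}_{A}$ denotes the law of the resulting closed loop when the true matrix is $A$, and $\|\cdot\|_2$ is the spectral norm for matrices and the Euclidean norm for vectors. For $\epsilon>0$ and $\delta\in(0,1)$ an algorithm is $(\epsilon,\delta)$-locally-stable in $A_*$ if there is a finite time $\tau$ such that $$\mathbb{P}_{A'}\big(\|\hat A_t-A'\|_2\le\epsilon\big)\ge 1-\delta\quad\text{for all } t\ge\tau \text{ and all } A'\in\mathbb{R}^{d\times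 d}\text{ with }\|A_*-A'\|_2\le 3\epsilon ;$$ its sample complexity $\tau_{\epsilon\delta}$ is the infimum of all such $\tau$. For $n\ge 1$ put $\Gamma_n=\sum_{s=0}^{n-1}A_*^s(A_*^s)^\top$, let $\mathcal{U}_{\gamma^2}$ (for period $n$) be the set of signals $u=(u_0,\dots,u_{n-1})$ in $\mathbb{R}^p$ with $\frac1n\sum_t u_t^\top u_t\le\gamma^2$, and let $$\Gamma_n^u=\frac{1}{\gamma^2n^2}\sum_{\ell=0}^{n-1}\big(e^{2\pi i\ell/n}I-A_*\big)^{-1}B_*U_\ell U_\ell^{H}B_*^{\top}\big(e^{2\pi i\ell/n}I-A_*\big)^{-H},\qquad U_\ell=\sum_{t=0}^{n-1}u_te^{-2\pi i\ell t/n},$$ be the normalized steady-state covariates of the $n$-periodic input $u$. Define $$\max_{u\in\mathcal{U}_{\gamma^2}}\lambda_{\min}(\sigma^2\Gamma_\infty+\gamma^2\Gamma^u_\infty):=\lim_{i\to\infty}\ \max_{u\in\mathcal{U}_{\gamma^2}}\lambda_{\min}\big(\sigma^2\Gamma_{2^i}+\gamma^2\Gamma^u_{2^i}\big).$$ Then all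 the maxima on the right are attained, the limit exists and is finite and positive, and there exist $\epsilon_0,\delta_0>0$, depending only on $d,p,A_*,B_*,x_0,\sigma,\gamma,k$ (and not on the algorithm), such that for all $0<\epsilon<\epsilon_0$ and $0<\delta<\delta_0$: every algorithm that is $(\epsilon,\delta)$-locally-stable in $A_*$ and whose inputs satisfy, $\mathbb{P}_{A_*}$-almost surely, $$\frac1k\sum_{t=0}^{k-1}u_{s+t}^\top u_{s+t}\le\gamma^2\quad\text{for every } s\ge 0$$ has sample complexity $$\tau_{\epsilon\delta}\ \ge\ \frac{\sigma^2\epsilon^{-2}/8}{\max_{u\in\mathcal{U}_{\gamma^2}}\lambda_{\min}(\sigma^2\Gamma_\infty+\gamma^2\Gamma^u_\infty)}\ \log\frac{1}{2.4\,\delta}.$$ -/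

import Mathlib

open MeasureTheory ProbabilityTheory Filter Topology
open scoped Matrix.Norms.L2Operator

universe w

noncomputable section

namespace ActiveLDS

/-! ### Sequential identification algorithms and the law of the closed loop -/

/-- A (possibly randomized) active identification algorithm for a system with state space `ℝ^d`
and input space `ℝ^p`. Its internal randomness is one seed, drawn independently of the process
noise. At time `t` it has seen the states `x_0, …, x_t` (its past inputs are functions of the seed
and of the earlier states); from them it computes the next input `u_t` and its current estimate
`Â_t`, the estimate after `t` observed transitions. The algorithm does not see the true matrix. -/
structure Algorithm (d p : ℕ) where
  Seed : Type w
  [seedMeasurableSpace : MeasurableSpace Seed]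
  seedLaw : Measure Seed
  [seedLaw_isProbabilityMeasure : IsProbabilityMeasure seedLaw]
  input : (t : ℕ) → Seed × (Fin (t + 1) → EuclideanSpace ℝ (Fin d)) → EuclideanSpace ℝ (Fin p)
  measurable_input : ∀ t, Measurable (input t)
  estimate : (t : ℕ) → Seed × (Fin (t + 1) → EuclideanSpace ℝ (Fin d)) →
    Matrix (Fin d) (Fin d) ℝ
  measurable_estimate : ∀ t i j, Measurable (fun h => estimate t h i j)

attribute [instance] Algorithm.seedMeasurableSpace Algorithm.seedLaw_isProbabilityMeasure

variable {d p : ℕ}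

/-- The sample space: the seed of the algorithm and the noise sequence `η_0, η_1, …`. -/
abbrev Algorithm.Sample (alg : Algorithm.{w} d p) : Type w :=
  alg.Seed × (ℕ → EuclideanSpace ℝ (Fin d))

/-- The seed is independent of the noise, and the noise is i.i.d. `N(0, σ² I)`. -/
def Algorithm.law (alg : Algorithm.{w} d p) (σ : ℝ) : Measure alg.Sample :=
  alg.seedLaw.prod
    (Measure.infinitePi fun _ : ℕ => multivariateGaussian 0 (σ ^ 2 • (1 : Matrix (Fin d) (Fin d) ℝ)))

/-- The observed states `x_0, …, x_t` when `alg` runs on `x_{t+1} = A x_t + B u_t + η_t` from the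
initial state `x₀`. -/
def Algorithm.history (alg : Algorithm.{w} d p) (A : Matrix (Fin d) (Fin d) ℝ)
    (B : Matrix (Fin d) (Fin p) ℝ) (x₀ : EuclideanSpace ℝ (Fin d)) (ω : alg.Sample) :
    (t : ℕ) → Fin (t + 1) → EuclideanSpace ℝ (Fin d)
  | 0 => fun _ => x₀
  | t + 1 =>
    Fin.snoc (α := fun _ => EuclideanSpace ℝ (Fin d)) (alg.history A B x₀ ω t)
      (Matrix.toEuclideanLin A (alg.history A B x₀ ω t (Fin.last t))
        + Matrix.toEuclideanLin B (alg.input t (ω.1, alg.history A B x₀ ω t))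
        + ω.2 t)

/-- The input `u_t` played at time `t` when the true matrix is `A`. -/
def Algorithm.playedInput (alg : Algorithm.{w} d p) (A : Matrix (Fin d) (Fin d) ℝ)
    (B : Matrix (Fin d) (Fin p) ℝ) (x₀ : EuclideanSpace ℝ (Fin d)) (t : ℕ) (ω : alg.Sample) :
    EuclideanSpace ℝ (Fin p) :=
  alg.input t (ω.1, alg.history A B x₀ ω t)

/-- The estimate `Â_t` when the true matrix is `A`. -/
def Algorithm.estimator (alg : Algorithm.{w} d p) (A : Matrix (Fin d) (Fin d) ℝ)
    (B : Matrix (Fin d) (Fin p) ℝ) (x₀ : EuclideanSpace ℝ (Fin d)) (t : ℕ) (ω : alg.Sample) :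
    Matrix (Fin d) (Fin d) ℝ :=
  alg.estimate t (ω.1, alg.history A B x₀ ω t)

/-- Almost surely, the input energy averaged over every window of length `k` is at most `γ²`
(true matrix `A`). -/
def Algorithm.BoundedWindowPower (alg : Algorithm.{w} d p) (A : Matrix (Fin d) (Fin d) ℝ)
    (B : Matrix (Fin d) (Fin p) ℝ) (x₀ : EuclideanSpace ℝ (Fin d)) (σ γ : ℝ) (k : ℕ) : Prop :=
  ∀ᵐ ω ∂(alg.law σ), ∀ s : ℕ,
    (1 / (k : ℝ)) * ∑ t ∈ Finset.range k, ‖alg.playedInput A B x₀ (s + t) ω‖ ^ 2 ≤ γ ^ 2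

/-- For all `t ≥ τ` and all `A'` with `‖A - A'‖₂ ≤ 3ε`, the estimate `Â_t` is `ε`-accurate in
spectral norm with probability at least `1 - δ` when the true matrix is `A'`. -/
def Algorithm.StableFrom (alg : Algorithm.{w} d p) (A : Matrix (Fin d) (Fin d) ℝ)
    (B : Matrix (Fin d) (Fin p) ℝ) (x₀ : EuclideanSpace ℝ (Fin d)) (σ ε δ : ℝ) (τ : ℕ) : Prop :=
  ∀ t, τ ≤ t → ∀ A' : Matrix (Fin d) (Fin d) ℝ, ‖A - A'‖ ≤ 3 * ε →
    1 - δ ≤ (alg.law σ).real {ω | ‖alg.estimator A' B x₀ t ω - A'‖ ≤ ε}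

/-- `(ε, δ)`-local stability in `A`. -/
def Algorithm.LocallyStable (alg : Algorithm.{w} d p) (A : Matrix (Fin d) (Fin d) ℝ)
    (B : Matrix (Fin d) (Fin p) ℝ) (x₀ : EuclideanSpace ℝ (Fin d)) (σ ε δ : ℝ) : Prop :=
  ∃ τ : ℕ, alg.StableFrom A B x₀ σ ε δ τ

/-- The sample complexity `τ_{εδ}`: the infimum of the times in the definition of local
stability (a nonempty set for a locally stable algorithm). -/
def Algorithm.sampleComplexity (alg : Algorithm.{w} d p) (A : Matrix (Fin d) (Fin d) ℝ)
    (B : Matrix (Fin d) (Fin p) ℝ) (x₀ : EuclideanSpace ℝ (Fin d)) (σ ε δ : ℝ) : ℕ :=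
  sInf {τ : ℕ | alg.StableFrom A B x₀ σ ε δ τ}

/-! ### Covariates and the optimal excitation -/

/-- Entrywise complexification of a real matrix. -/
def toComplex {m n : ℕ} (M : Matrix (Fin m) (Fin n) ℝ) : Matrix (Fin m) (Fin n) ℂ :=
  M.map fun r : ℝ => (r : ℂ)

/-- Minimum eigenvalue (of a Hermitian matrix). -/
def lambdaMin (M : Matrix (Fin d) (Fin d) ℂ) : ℝ :=
  sInf (spectrum ℝ M)

/-- `Γ_t(A) = ∑_{s<t} A^s (A^s)ᵀ`. -/
def noiseCov (A : Matrix (Fin d) (Fin d) ℝ) (t : ℕ) : Matrix (Fin d) (Fin d) ℝ :=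
  ∑ s ∈ Finset.range t, A ^ s * (A ^ s).transpose

/-- The discrete Fourier transform `U_ℓ` of `u_0, …, u_{k-1} ∈ ℝ^p`. -/
def dft {k : ℕ} (u : Fin k → EuclideanSpace ℝ (Fin p)) (ℓ : Fin k) : Fin p → ℂ :=
  fun i => ∑ t : Fin k,
    Complex.exp (-(2 * Real.pi * ((ℓ : ℕ) : ℂ) * ((t : ℕ) : ℂ) / (k : ℂ)) * Complex.I) * (u t i : ℂ)

/-- The transfer matrix `(e^{2πiℓ/k} I - A)⁻¹ B`. -/
def transfer (A : Matrix (Fin d) (Fin d) ℝ) (B : Matrix (Fin d) (Fin p) ℝ) (k ℓ : ℕ) :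
    Matrix (Fin d) (Fin p) ℂ :=
  (Complex.exp (2 * Real.pi * (ℓ : ℂ) / (k : ℂ) * Complex.I) • (1 : Matrix (Fin d) (Fin d) ℂ)
    - toComplex A)⁻¹ * toComplex B

/-- The normalized steady-state covariates of the `k`-periodic input `u`,
`Γ_k^u(A,B) = (γ² k²)⁻¹ ∑_ℓ (e^{2πiℓ/k} I - A)⁻¹ B U_ℓ U_ℓᴴ Bᴴ (e^{2πiℓ/k} I - A)⁻ᴴ`. -/
def inputCov (A : Matrix (Fin d) (Fin d) ℝ) (B : Matrix (Fin d) (Fin p) ℝ) (γ : ℝ) {k : ℕ}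
    (u : Fin k → EuclideanSpace ℝ (Fin p)) : Matrix (Fin d) (Fin d) ℂ :=
  (1 / (γ ^ 2 * (k : ℝ) ^ 2)) • ∑ ℓ : Fin k,
    transfer A B k ℓ * Matrix.vecMulVec (dft u ℓ) (star (dft u ℓ)) *
      (transfer A B k ℓ).conjTranspose

/-- `𝒰_{γ²}`: the signals of length `k` with average power at most `γ²`. -/
def powerBounded (p : ℕ) (γ : ℝ) (k : ℕ) : Set (Fin k → EuclideanSpace ℝ (Fin p)) :=
  {u | (1 / (k : ℝ)) * ∑ t, ‖u t‖ ^ 2 ≤ γ ^ 2}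

/-- The values `λ_min(σ² Γ_k + γ² Γ_k^u)` over `u ∈ 𝒰_{γ²}`. -/
def excitationValues (A : Matrix (Fin d) (Fin d) ℝ) (B : Matrix (Fin d) (Fin p) ℝ) (σ γ : ℝ)
    (k : ℕ) : Set ℝ :=
  (fun u => lambdaMin (σ ^ 2 • toComplex (noiseCov A k) + γ ^ 2 • inputCov A B γ u)) ''
    powerBounded p γ k

/-- `max_{u ∈ 𝒰_{γ²}} λ_min(σ² Γ_k + γ² Γ_k^u)`. -/
def maxExcitation (A : Matrix (Fin d) (Fin d) ℝ) (B : Matrix (Fin d) (Fin p) ℝ) (σ γ : ℝ)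
    (k : ℕ) : ℝ :=
  sSup (excitationValues A B σ γ k)

/-- `max_{u ∈ 𝒰_{γ²}} λ_min(σ² Γ_∞ + γ² Γ_∞^u)`, by definition the limit of the maxima along
the periods `2^i`. -/
def maxExcitationLimit (A : Matrix (Fin d) (Fin d) ℝ) (B : Matrix (Fin d) (Fin p) ℝ)
    (σ γ : ℝ) : ℝ :=
  limUnder atTop fun i : ℕ => maxExcitation A B σ γ (2 ^ i)

end ActiveLDS

end

/-! The lower bound is a two-point argument. For a unit vector `w`, let A' = A + r w wᵀ with r
slightly above 2ε. An ε-accurate estimate separates A from A' with error at most δ on either side,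
so the Bretagnolle–Huber inequality (`log_le_neg_integral`) forces the relative entropy of the two
closed loops to be at least log(1/(4δ)). The inputs are the same functions of the history in both
loops, so only Gaussian shifts of the noise differ (`Algorithm.lintegral_history`), and the entropy
equals r²/(2σ²) ∑_{t<τ} E⟨w, x_t⟩² with expectations under A alone. It remains to find one `w`,
depending on the algorithm, along which this sum is at most about τ times Λ, the limiting maximal
excitation.

The state is a drift, caused by the inputs and x₀, plus the response to the noise. The two may be
correlated, so ⟨w, x_t⟩² is bounded by twice the sum of the squares. The noise part is governed by
σ²Γ_τ. Each path of the drift is the response to an admissible signal, but the mean of the resulting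
quadratic forms need not come from a single signal. The central object is therefore the set
`achievable` of forms that deterministic inputs produce asymptotically. It is closed, and it is
convex by time sharing, because stability keeps every transient bounded
(`IsLyapunov.convex_achievable`); it contains the path forms up to a small loss
(`IsLyapunov.block_mem_achievable`), hence also their mean. An achievable form is nearly the
steady-state form of an admissible signal of period 2^i, which by Parseval is the frequency-domain
covariate matrix (`inputCov_eq`). So some direction has excitation at most Λ up to a small error
(`exists_noiseForm_add_le_of_achievable`).

The constants are 2.1²/2 from the entropy, 2 from the split of the state and 3/2 from the asymptotic
errors. Their product 6.615 is below 8, and the gap pays for replacing 4δ by 2.4δ when δ is small.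
Horizons too short for the asymptotics have uniformly bounded excitation and are excluded by taking
ε small. -/

namespace ActiveLDS

/-! ### Stable linear recursions: decay, energy bounds and periodic orbits. -/

section Response

variable {E : Type*} [NormedAddCommGroup E] [InnerProductSpace ℝ E]

/-- A norm-like function, equivalent to the norm, that `T` contracts by the factor `ρ < 1`. -/
structure IsLyapunov (T : E →L[ℝ] E) (N : E → ℝ) (ρ K : ℝ) : Prop where
  pos : 0 < ρ
  lt_one : ρ < 1
  one_le : 1 ≤ K
  add_le : ∀ x y, N (x + y) ≤ N x + N y
  norm_le : ∀ x, ‖x‖ ≤ N x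
  le_norm : ∀ x, N x ≤ K * ‖x‖
  map_le : ∀ x, N (T x) ≤ ρ * N x

/-- The weighted orbit sum ∑_{s<m} c^s ‖T^s x‖ works for any c > 1 with c^m/2 < 1. Applying `T`
shifts the sum and gains a factor 1/c, while the new last term c^m ‖T^m x‖ is at most the dropped
first term ‖x‖. -/
theorem exists_isLyapunov (T : E →L[ℝ] E) (m : ℕ) (hm : 1 ≤ m)
    (hT : ∀ x, ‖(T ^ m) x‖ ≤ 1 / 2 * ‖x‖) :
    ∃ (N : E → ℝ) (ρ K : ℝ), IsLyapunov T N ρ K := by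
  have hc : ∃ c : ℝ, 1 < c ∧ c ^ m * (1 / 2) < 1 := by
    have h1 : ContinuousAt (fun c : ℝ => c ^ m * (1 / 2)) 1 := by fun_prop
    have h2 : ∀ᶠ c in 𝓝 (1 : ℝ), c ^ m * (1 / 2) < 1 :=
      h1.eventually_lt continuousAt_const (by norm_num)
    have h3 := (h2.filter_mono nhdsWithin_le_nhds : ∀ᶠ c in 𝓝[>] (1 : ℝ), c ^ m * (1 / 2) < 1)
    obtain ⟨c, hc1, hc2⟩ := (h3.and self_mem_nhdsWithin).exists
    exact ⟨c, hc2, hc1⟩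
  obtain ⟨c, hc1, hcm⟩ := hc
  have hc0 : 0 < c := by linarith
  refine ⟨fun x => ∑ s ∈ Finset.range m, c ^ s * ‖(T ^ s) x‖, c⁻¹,
    ∑ s ∈ Finset.range m, c ^ s * ‖T ^ s‖ + 1, inv_pos.2 hc0, inv_lt_one_of_one_lt₀ hc1, ?_, ?_, ?_,
    ?_, ?_⟩
  · have : 0 ≤ ∑ s ∈ Finset.range m, c ^ s * ‖T ^ s‖ := Finset.sum_nonneg fun _ _ => by positivity
    linarith
  · intro x y
    rw [← Finset.sum_add_distrib]
    refine Finset.sum_le_sum fun s _ => ?_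
    rw [map_add, ← mul_add]
    gcongr
    exact norm_add_le _ _
  · intro x
    have := Finset.single_le_sum (f := fun s => c ^ s * ‖(T ^ s) x‖)
      (fun _ _ => by positivity) (Finset.mem_range.2 (by omega : 0 < m))
    simpa using this
  · intro x
    rw [add_mul, Finset.sum_mul, one_mul]
    have : ∑ s ∈ Finset.range m, c ^ s * ‖(T ^ s) x‖
        ≤ ∑ s ∈ Finset.range m, c ^ s * ‖T ^ s‖ * ‖x‖ := by
      refine Finset.sum_le_sum fun s _ => ?_
      rw [mul_assoc]
      gcongr
      exact (T ^ s).le_opNorm x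
    linarith [norm_nonneg x]
  · intro x
    rw [inv_mul_eq_div, le_div_iff₀ hc0, Finset.sum_mul]
    have h1 : ∑ s ∈ Finset.range m, c ^ s * ‖(T ^ s) (T x)‖ * c
        = ∑ s ∈ Finset.range m, c ^ (s + 1) * ‖(T ^ (s + 1)) x‖ := by
      refine Finset.sum_congr rfl fun s _ => ?_
      rw [pow_succ T s, mul_apply_eq_comp]; ring
    have h2 := Finset.sum_range_succ' (fun s => c ^ s * ‖(T ^ s) x‖) m
    rw [Finset.sum_range_succ] at h2
    have h3 : c ^ m * ‖(T ^ m) x‖ ≤ ‖x‖ := by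
      calc c ^ m * ‖(T ^ m) x‖ ≤ c ^ m * (1 / 2 * ‖x‖) := by gcongr; exact hT x
        _ = c ^ m * (1 / 2) * ‖x‖ := by ring
        _ ≤ 1 * ‖x‖ := by gcongr
        _ = ‖x‖ := one_mul _
    simp only [pow_zero, one_mul, one_apply_eq_self] at h2
    rw [h1]
    linarith

/-- The state sequence of `x_{t+1} = T x_t + b_t`, started at `x`. -/
noncomputable def resp (T : E →L[ℝ] E) (b : ℕ → E) (x : E) : ℕ → E
  | 0 => x
  | t + 1 => T (resp T b x t) + b t

variable {T : E →L[ℝ] E} {N : E → ℝ} {ρ K : ℝ}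

theorem resp_add_init (b : ℕ → E) (x r : E) (t : ℕ) :
    resp T b (x + r) t = resp T b x t + (T ^ t) r := by
  induction t with
  | zero => simp [resp]
  | succ t ih =>
    simp only [resp, ih, map_add, pow_succ' T t, mul_apply_eq_comp]
    abel

theorem resp_sub_init (b : ℕ → E) (x y : E) (t : ℕ) :
    resp T b y t = resp T b x t + (T ^ t) (y - x) := by
  rw [← resp_add_init, add_sub_cancel]

theorem resp_add_time (b : ℕ → E) (x : E) (m t : ℕ) :
    resp T b x (m + t) = resp T (fun s => b (m + s)) (resp T b x m) t := by
  induction t with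
  | zero => simp [resp]
  | succ t ih => rw [← add_assoc]; simp only [resp, ih]

theorem resp_congr {b b' : ℕ → E} (x : E) {t : ℕ} (h : ∀ s < t, b s = b' s) :
    resp T b x t = resp T b' x t := by
  induction t with
  | zero => simp [resp]
  | succ t ih =>
    simp only [resp]
    rw [ih fun s hs => h s (by omega), h t (by omega)]

theorem resp_periodic {b : ℕ → E} {L : ℕ} (hb : Function.Periodic b L) {x : E}
    (hx : resp T b x L = x) : Function.Periodic (resp T b x) L := by
  intro t
  rw [add_comm, resp_add_time, hx]
  refine resp_congr _ fun s _ => ?_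
  rw [add_comm, hb]

namespace IsLyapunov

theorem nonneg (h : IsLyapunov T N ρ K) (x : E) : 0 ≤ N x := (norm_nonneg x).trans (h.norm_le x)

theorem pow_le (h : IsLyapunov T N ρ K) (t : ℕ) (x : E) : N ((T ^ t) x) ≤ ρ ^ t * N x := by
  induction t with
  | zero => simp
  | succ t ih =>
    rw [pow_succ' T t, mul_apply_eq_comp]
    calc _ ≤ ρ * N ((T ^ t) x) := h.map_le _
      _ ≤ ρ * (ρ ^ t * N x) := by have := h.pos; gcongr
      _ = _ := by ring

theorem geom_le (h : IsLyapunov T N ρ K) (n : ℕ) : ∑ t ∈ Finset.range n, ρ ^ t ≤ 1 / (1 - ρ) := by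
  have h1 : 0 < 1 - ρ := sub_pos.2 h.lt_one
  rw [le_div_iff₀ h1, geom_sum_mul_neg]
  have := pow_pos h.pos n
  linarith

theorem sum_norm_pow_le (h : IsLyapunov T N ρ K) (r : E) (n : ℕ) :
    ∑ t ∈ Finset.range n, ‖(T ^ t) r‖ ≤ N r / (1 - ρ) := by
  calc _ ≤ ∑ t ∈ Finset.range n, ρ ^ t * N r :=
        Finset.sum_le_sum fun t _ => (h.norm_le _).trans (h.pow_le t r)
    _ = (∑ t ∈ Finset.range n, ρ ^ t) * N r := by rw [Finset.sum_mul]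
    _ ≤ 1 / (1 - ρ) * N r := by have := h.nonneg r; have := h.geom_le n; gcongr
    _ = _ := by ring

theorem sum_sq_norm_pow_le (h : IsLyapunov T N ρ K) (r : E) (n : ℕ) :
    ∑ t ∈ Finset.range n, ‖(T ^ t) r‖ ^ 2 ≤ N r ^ 2 / (1 - ρ) := by
  have h0 := h.nonneg r
  have h1 := h.pos
  calc _ ≤ ∑ t ∈ Finset.range n, ρ ^ t * N r ^ 2 := by
        refine Finset.sum_le_sum fun t _ => ?_
        have h2 : ρ ^ t ≤ 1 := pow_le_one₀ h.pos.le h.lt_one.le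
        calc ‖(T ^ t) r‖ ^ 2 ≤ (ρ ^ t * N r) ^ 2 := by
              gcongr; exact (h.norm_le _).trans (h.pow_le t r)
          _ = ρ ^ t * (ρ ^ t * N r ^ 2) := by ring
          _ ≤ ρ ^ t * (1 * N r ^ 2) := by gcongr
          _ = _ := by ring
    _ = (∑ t ∈ Finset.range n, ρ ^ t) * N r ^ 2 := by rw [Finset.sum_mul]
    _ ≤ 1 / (1 - ρ) * N r ^ 2 := by have := h.geom_le n; gcongr
    _ = _ := by ring

theorem resp_succ_le (h : IsLyapunov T N ρ K) (b : ℕ → E) (x : E) (t : ℕ) :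
    N (resp T b x (t + 1)) ≤ ρ * N (resp T b x t) + K * ‖b t‖ := by
  simp only [resp]
  exact (h.add_le _ _).trans (add_le_add (h.map_le _) (h.le_norm _))

theorem resp_le (h : IsLyapunov T N ρ K) {b : ℕ → E} {C : ℝ} (hC : 0 ≤ C) {n : ℕ}
    (hb : ∀ t < n, ‖b t‖ ≤ C) (x : E) : ∀ t ≤ n, N (resp T b x t) ≤ ρ ^ t * N x + K * C / (1 - ρ) := by
  have h1 : 0 < 1 - ρ := sub_pos.2 h.lt_one
  have hK := h.one_le
  intro t
  induction t with
  | zero =>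
    intro _
    simp only [resp, pow_zero, one_mul, le_add_iff_nonneg_right]
    positivity
  | succ t ih =>
    intro ht
    have h2 := h.resp_succ_le b x t
    have h3 := ih (by omega)
    have h4 := hb t (by omega)
    have h5 : K * ‖b t‖ ≤ K * C := by gcongr
    have h6 : ρ * N (resp T b x t) ≤ ρ * (ρ ^ t * N x + K * C / (1 - ρ)) := by
      have := h.pos; gcongr
    have h7 : ρ * (K * C / (1 - ρ)) + K * C = K * C / (1 - ρ) := by field_simp; ring
    calc _ ≤ ρ * (ρ ^ t * N x + K * C / (1 - ρ)) + K * C := by linarith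
      _ = ρ ^ (t + 1) * N x + (ρ * (K * C / (1 - ρ)) + K * C) := by ring
      _ = _ := by rw [h7]

/-- Squaring the one-step bound by weighted Cauchy–Schwarz keeps the contraction factor ρ < 1; the
defect is the perfect square in `h4`. -/
theorem sq_resp_succ_le (h : IsLyapunov T N ρ K) (b : ℕ → E) (x : E) (t : ℕ) :
    N (resp T b x (t + 1)) ^ 2 ≤ ρ * N (resp T b x t) ^ 2 + K ^ 2 / (1 - ρ) * ‖b t‖ ^ 2 := by
  have h1 : 0 < 1 - ρ := sub_pos.2 h.lt_one
  have h2 := h.resp_succ_le b x t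
  set p := N (resp T b x t)
  set q := ‖b t‖
  have h3 : N (resp T b x (t + 1)) ^ 2 ≤ (ρ * p + K * q) ^ 2 := by
    have := h.nonneg (resp T b x (t + 1)); gcongr
  have h4 : ρ * p ^ 2 + K ^ 2 / (1 - ρ) * q ^ 2 - (ρ * p + K * q) ^ 2
      = ρ / (1 - ρ) * ((1 - ρ) * p - K * q) ^ 2 := by field_simp; ring
  have h5 : 0 ≤ ρ / (1 - ρ) * ((1 - ρ) * p - K * q) ^ 2 := by have := h.pos; positivity
  linarith

theorem sq_resp_le (h : IsLyapunov T N ρ K) (b : ℕ → E) (x : E) (t : ℕ) :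
    N (resp T b x t) ^ 2 ≤ N x ^ 2 + K ^ 2 / (1 - ρ) * ∑ s ∈ Finset.range t, ‖b s‖ ^ 2 := by
  induction t with
  | zero => simp [resp]
  | succ t ih =>
    have h1 := h.sq_resp_succ_le b x t
    have h2 : ρ * N (resp T b x t) ^ 2 ≤ 1 * N (resp T b x t) ^ 2 := by
      have := h.lt_one; gcongr
    rw [Finset.sum_range_succ, mul_add]
    linarith

/-- Over a full period the sum of the energies is invariant under a shift in time, so the summed
one-step bounds leave a factor 1 - ρ on the left, and no term for the initial state appears. -/
theorem sum_sq_resp_le_of_periodic (h : IsLyapunov T N ρ K) (b : ℕ → E) {x : E} {L : ℕ}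
    (hx : resp T b x L = x) :
    ∑ t ∈ Finset.range L, N (resp T b x t) ^ 2
      ≤ K ^ 2 / (1 - ρ) ^ 2 * ∑ t ∈ Finset.range L, ‖b t‖ ^ 2 := by
  have h1 : 0 < 1 - ρ := sub_pos.2 h.lt_one
  have h2 : ∑ t ∈ Finset.range L, N (resp T b x (t + 1)) ^ 2
      = ∑ t ∈ Finset.range L, N (resp T b x t) ^ 2 := by
    have h3 := Finset.sum_range_succ' (fun t => N (resp T b x t) ^ 2) L
    rw [Finset.sum_range_succ, hx] at h3
    simp only [resp] at h3 ⊢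
    linarith
  have h3 := Finset.sum_le_sum fun t (_ : t ∈ Finset.range L) => h.sq_resp_succ_le b x t
  rw [h2, Finset.sum_add_distrib, ← Finset.mul_sum, ← Finset.mul_sum] at h3
  set S := ∑ t ∈ Finset.range L, N (resp T b x t) ^ 2
  set R := ∑ t ∈ Finset.range L, ‖b t‖ ^ 2
  have h4 : (1 - ρ) * S ≤ K ^ 2 / (1 - ρ) * R := by linarith
  calc S = (1 - ρ) * S / (1 - ρ) := by field_simp
    _ ≤ K ^ 2 / (1 - ρ) * R / (1 - ρ) := by gcongr
    _ = _ := by field_simp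

/-- The effect of a change of the initial state on the excitation is bounded in time. -/
theorem sum_inner_sq_ge (h : IsLyapunov T N ρ K) {v : ℕ → E} {C : ℝ} (hC : 0 ≤ C) {n : ℕ}
    (hv : ∀ t < n, ‖v t‖ ≤ C) (r w : E) :
    ∑ t ∈ Finset.range n, (inner ℝ w (v t)) ^ 2 - 2 * C * (N r / (1 - ρ)) * ‖w‖ ^ 2
      ≤ ∑ t ∈ Finset.range n, (inner ℝ w (v t + (T ^ t) r)) ^ 2 := by
  have h1 : ∀ t ∈ Finset.range n, (inner ℝ w (v t)) ^ 2 - 2 * C * ‖w‖ ^ 2 * ‖(T ^ t) r‖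
      ≤ (inner ℝ w (v t + (T ^ t) r)) ^ 2 := by
    intro t ht
    rw [inner_add_right]
    have h2 : |inner ℝ w (v t)| ≤ ‖w‖ * C :=
      (abs_real_inner_le_norm _ _).trans (by gcongr; exact hv t (Finset.mem_range.1 ht))
    have h3 : |inner ℝ w ((T ^ t) r)| ≤ ‖w‖ * ‖(T ^ t) r‖ := abs_real_inner_le_norm _ _
    have h4 : |inner ℝ w (v t) * inner ℝ w ((T ^ t) r)| ≤ (‖w‖ * C) * (‖w‖ * ‖(T ^ t) r‖) := by
      rw [abs_mul]; gcongr
    have h5 := (abs_le.1 h4).1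
    nlinarith [sq_nonneg (inner ℝ w ((T ^ t) r))]
  have h2 := Finset.sum_le_sum h1
  rw [Finset.sum_sub_distrib, ← Finset.mul_sum] at h2
  have h3 : 2 * C * ‖w‖ ^ 2 * ∑ t ∈ Finset.range n, ‖(T ^ t) r‖
      ≤ 2 * C * ‖w‖ ^ 2 * (N r / (1 - ρ)) := by gcongr; exact h.sum_norm_pow_le r n
  linarith

/-- A fixed point of `T ^ L` vanishes because `N` contracts, so `1 - T ^ L` is injective, hence
surjective in finite dimension. -/
theorem exists_periodic_init [FiniteDimensional ℝ E] (h : IsLyapunov T N ρ K) (b : ℕ → E) {L : ℕ}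
    (hL : 1 ≤ L) : ∃ x, resp T b x L = x := by
  have hinj : Function.Injective ((1 - T ^ L : E →L[ℝ] E) : E →ₗ[ℝ] E) := by
    rw [← LinearMap.ker_eq_bot, LinearMap.ker_eq_bot']
    intro x hx
    have hx' : (T ^ L) x = x := by
      have : x - (T ^ L) x = 0 := hx
      rw [sub_eq_zero] at this; exact this.symm
    have h1 := h.pow_le L x
    rw [hx'] at h1
    have h2 : ρ ^ L < 1 := pow_lt_one₀ h.pos.le h.lt_one (by omega)
    have h3 := h.norm_le x
    have h4 := h.nonneg x
    have : N x = 0 := by nlinarith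
    exact norm_le_zero_iff.1 (by linarith)
  obtain ⟨x, hx⟩ := (LinearMap.injective_iff_surjective.1 hinj) (resp T b 0 L)
  refine ⟨x, ?_⟩
  rw [resp_sub_init b 0 x, sub_zero, ← hx]
  exact sub_add_cancel x ((T ^ L) x)

end IsLyapunov

end Response

/-! ### The closed convex set of asymptotically achievable excitation forms. -/

section Achievable

variable {E : Type*} [NormedAddCommGroup E] [InnerProductSpace ℝ E]
  {U : Type*} [NormedAddCommGroup U] [NormedSpace ℝ U]

/-- The quadratic forms that bounded inputs of average power at most `γ²` excite, up to an
arbitrarily small error, over every sufficiently long horizon. -/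
def achievable (T : E →L[ℝ] E) (B : U →L[ℝ] E) (γ : ℝ) : Set (E →L[ℝ] E) :=
  {Q | ∀ θ > (0 : ℝ), ∃ C ≥ (0 : ℝ), ∃ n₀ : ℕ, ∀ n ≥ n₀, ∃ u : ℕ → U, (∀ t, ‖u t‖ ≤ C) ∧
    ∑ t ∈ Finset.range n, ‖u t‖ ^ 2 ≤ γ ^ 2 * n ∧
    ∀ w, n * (inner ℝ (Q w) w - θ * ‖w‖ ^ 2)
      ≤ ∑ t ∈ Finset.range n, (inner ℝ w (resp T (fun s => B (u s)) 0 t)) ^ 2}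

theorem abs_inner_apply_le (Q : E →L[ℝ] E) (w : E) : |inner ℝ (Q w) w| ≤ ‖Q‖ * ‖w‖ ^ 2 := by
  calc _ ≤ ‖Q w‖ * ‖w‖ := abs_real_inner_le_norm _ _
    _ ≤ ‖Q‖ * ‖w‖ * ‖w‖ := by gcongr; exact Q.le_opNorm w
    _ = _ := by ring

variable {T : E →L[ℝ] E} {N : E → ℝ} {ρ K : ℝ} {B : U →L[ℝ] E} {γ : ℝ}

theorem isClosed_achievable (T : E →L[ℝ] E) (B : U →L[ℝ] E) (γ : ℝ) :
    IsClosed (achievable T B γ) := by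
  refine isClosed_of_closure_subset fun Q hQ θ hθ => ?_
  obtain ⟨Q', hQ', hd⟩ := Metric.mem_closure_iff.1 hQ (θ / 2) (by positivity)
  obtain ⟨C, hC, n₀, H⟩ := hQ' (θ / 2) (by positivity)
  refine ⟨C, hC, n₀, fun n hn => ?_⟩
  obtain ⟨u, h1, h2, h3⟩ := H n hn
  refine ⟨u, h1, h2, fun w => le_trans ?_ (h3 w)⟩
  have h4 := abs_inner_apply_le (Q - Q') w
  rw [dist_eq_norm] at hd
  have h5 : ‖Q - Q'‖ * ‖w‖ ^ 2 ≤ θ / 2 * ‖w‖ ^ 2 := by gcongr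
  have h6 := (abs_le.1 h4).2
  rw [sub_apply, inner_sub_left] at h6
  exact mul_le_mul_of_nonneg_left (by linarith) n.cast_nonneg

/-- Time sharing: play a signal for the first form during a fraction `a` of the horizon, then one
for the second. The second block starts from a nonzero state, but the amplitude bounds limit the
resulting loss independently of the horizon. This is why achievability asks for bounded inputs and
for every long horizon. -/
theorem IsLyapunov.convex_achievable (h : IsLyapunov T N ρ K) (B : U →L[ℝ] E) (γ : ℝ) :
    Convex ℝ (achievable T B γ) := by
  intro Q₁ hQ₁ Q₂ hQ₂ a b ha hb hab θ hθ
  rcases ha.eq_or_lt with rfl | ha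
  · obtain rfl : b = 1 := by linarith
    simpa using hQ₂ θ hθ
  rcases hb.eq_or_lt with rfl | hb
  · obtain rfl : a = 1 := by linarith
    simpa using hQ₁ θ hθ
  obtain ⟨C₁, hC₁, m₁, H₁⟩ := hQ₁ (θ / 2) (by positivity)
  obtain ⟨C₂, hC₂, m₂, H₂⟩ := hQ₂ (θ / 2) (by positivity)
  have h1ρ : 0 < 1 - ρ := sub_pos.2 h.lt_one
  have hK := h.one_le
  set D₁ := K * (‖B‖ * C₁) / (1 - ρ) with hD₁
  set D₂ := K * (‖B‖ * C₂) / (1 - ρ) with hD₂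
  have hD₁0 : 0 ≤ D₁ := by positivity
  have hD₂0 : 0 ≤ D₂ := by positivity
  set R := 2 * D₂ * (D₁ / (1 - ρ)) with hR
  -- The first two ceilings make both blocks long enough after rounding a·n down. The third lets
  -- n·θ/2 absorb the transient `R` at the switch and the rounding error, which is at most one time
  -- step and costs ‖Q₁‖ + ‖Q₂‖.
  refine ⟨max C₁ C₂, le_max_of_le_left hC₁, ⌈(m₁ + 1) / a⌉₊ + ⌈m₂ / b⌉₊
    + ⌈(R + ‖Q₁‖ + ‖Q₂‖) * 2 / θ⌉₊, fun n hn => ?_⟩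
  have e1 : (m₁ + 1) / a ≤ (n : ℝ) := Nat.ceil_le.1 (by omega)
  have e2 : m₂ / b ≤ (n : ℝ) := Nat.ceil_le.1 (by omega)
  have e3 : (R + ‖Q₁‖ + ‖Q₂‖) * 2 / θ ≤ (n : ℝ) := Nat.ceil_le.1 (by omega)
  rw [div_le_iff₀ (by assumption)] at e1 e2 e3
  have hn1 : (⌊a * n⌋₊ : ℝ) ≤ a * n := Nat.floor_le (by positivity)
  have hn1' : a * n < ⌊a * n⌋₊ + 1 := Nat.lt_floor_add_one _
  generalize ⌊a * n⌋₊ = n₁ at hn1 hn1'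
  have hn0 : (0 : ℝ) ≤ n := n.cast_nonneg
  have hle : n₁ ≤ n := by
    have : (n₁ : ℝ) ≤ n := by nlinarith
    exact_mod_cast this
  obtain ⟨n₂, rfl⟩ := Nat.exists_eq_add_of_le hle
  push_cast at *
  have hb' : b = 1 - a := by linarith
  have g1 : m₁ ≤ n₁ := by
    have : (m₁ : ℝ) ≤ n₁ := by linarith
    exact_mod_cast this
  have g2 : m₂ ≤ n₂ := by
    have : (m₂ : ℝ) ≤ n₂ := by rw [hb'] at e2; linarith
    exact_mod_cast this
  obtain ⟨u₁, hu₁, hp₁, hq₁⟩ := H₁ n₁ g1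
  obtain ⟨u₂, hu₂, hp₂, hq₂⟩ := H₂ n₂ g2
  set u : ℕ → U := fun t => if t < n₁ then u₁ t else u₂ (t - n₁) with hu
  have hul : ∀ t < n₁, u t = u₁ t := fun t ht => by simp [hu, ht]
  have hur : ∀ t, u (n₁ + t) = u₂ t := fun t => by simp [hu]
  refine ⟨u, fun t => ?_, ?_, fun w => ?_⟩
  · simp only [hu]
    split_ifs
    · exact (hu₁ _).trans (le_max_left _ _)
    · exact (hu₂ _).trans (le_max_right _ _)
  · rw [Finset.sum_range_add, Finset.sum_congr rfl fun t ht => by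
      rw [hul t (Finset.mem_range.1 ht)]]
    simp only [hur]
    rw [mul_add]
    exact add_le_add hp₁ hp₂
  · have hbd : ∀ (v : ℕ → U) (C : ℝ), (∀ t, ‖v t‖ ≤ C) → ∀ t, ‖B (v t)‖ ≤ ‖B‖ * C :=
      fun v C hv t => (B.le_opNorm _).trans (by gcongr; exact hv t)
    set r := resp T (fun s => B (u₁ s)) 0 n₁ with hr
    have hN0 : N 0 = 0 := le_antisymm (by simpa using h.le_norm 0) (h.nonneg 0)
    have hNr : N r ≤ D₁ := by
      have := h.resp_le (mul_nonneg (norm_nonneg B) hC₁) (n := n₁)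
        (fun t _ => hbd u₁ C₁ hu₁ t) 0 n₁ le_rfl
      rwa [hN0, mul_zero, zero_add] at this
    have hv₂ : ∀ t < n₂, ‖resp T (fun s => B (u₂ s)) 0 t‖ ≤ D₂ := fun t ht => by
      have := h.resp_le (mul_nonneg (norm_nonneg B) hC₂) (n := n₂)
        (fun t _ => hbd u₂ C₂ hu₂ t) 0 t ht.le
      rw [hN0, mul_zero, zero_add] at this
      exact (h.norm_le _).trans this
    have hs₁ : ∀ t ∈ Finset.range n₁, (inner ℝ w (resp T (fun s => B (u s)) 0 t)) ^ 2
        = (inner ℝ w (resp T (fun s => B (u₁ s)) 0 t)) ^ 2 := fun t ht => by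
      rw [resp_congr 0 fun s hs => by rw [hul s (hs.trans (Finset.mem_range.1 ht))]]
    have hs₂ : ∀ t ∈ Finset.range n₂, (inner ℝ w (resp T (fun s => B (u s)) 0 (n₁ + t))) ^ 2
        = (inner ℝ w (resp T (fun s => B (u₂ s)) 0 t + (T ^ t) r)) ^ 2 := fun t _ => by
      rw [resp_add_time, resp_congr 0 (b' := fun s => B (u₁ s)) fun s hs => by rw [hul s hs],
        ← resp_add_init, zero_add]
      simp only [hur, hr]
    rw [Finset.sum_range_add, Finset.sum_congr rfl hs₁, Finset.sum_congr rfl hs₂]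
    have k1 := h.sum_inner_sq_ge hD₂0 hv₂ r w
    have k2 : 2 * D₂ * (N r / (1 - ρ)) * ‖w‖ ^ 2 ≤ R * ‖w‖ ^ 2 := by rw [hR]; gcongr
    have k3 := hq₁ w
    have k4 := hq₂ w
    have q1 := abs_le.1 (abs_inner_apply_le Q₁ w)
    have q2 := abs_le.1 (abs_inner_apply_le Q₂ w)
    have k5 : (R + ‖Q₁‖ + ‖Q₂‖) * ‖w‖ ^ 2 ≤ (n₁ + n₂) * θ / 2 * ‖w‖ ^ 2 := by
      gcongr; linarith
    have hQw : (a • ⇑Q₁ + b • ⇑Q₂) w = a • Q₁ w + b • Q₂ w := rfl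
    rw [hQw, inner_add_left, real_inner_smul_left, real_inner_smul_left]
    set x := inner ℝ (Q₁ w) w
    set y := inner ℝ (Q₂ w) w
    set W := ‖w‖ ^ 2
    have hd0 : 0 ≤ a * (n₁ + n₂) - n₁ := by linarith
    have hd1 : a * (n₁ + n₂) - n₁ ≤ 1 := by linarith
    have hW1 : 0 ≤ ‖Q₁‖ * W := by positivity
    have hW2 : 0 ≤ ‖Q₂‖ * W := by positivity
    have z0 : ∀ p M : ℝ, p ≤ M → 0 ≤ M → (a * (n₁ + n₂) - n₁) * p ≤ M := fun p M hp hM =>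
      (mul_le_mul_of_nonneg_left hp hd0).trans (mul_le_of_le_one_left hM hd1)
    have z1 := z0 x _ q1.2 hW1
    have z2 := z0 (-y) (‖Q₂‖ * W) (by linarith [q2.1]) hW2
    rw [mul_neg] at z2
    have z3 : (n₁ + n₂) * (a * x + b * y - θ * W) = n₁ * (x - θ / 2 * W) + n₂ * (y - θ / 2 * W)
       + (a * (n₁ + n₂) - n₁) * x + - ((a * (n₁ + n₂) - n₁) * y) - (n₁ + n₂) * θ / 2 * W := by
      rw [hb']; ring
    linarith

end Achievable

/-! ### Periodic and finite signals give achievable forms. -/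

section Periodic

variable {E : Type*} [NormedAddCommGroup E] [InnerProductSpace ℝ E]
  {U : Type*} [NormedAddCommGroup U] [NormedSpace ℝ U]
  {T : E →L[ℝ] E} {N : E → ℝ} {ρ K : ℝ} {B : U →L[ℝ] E} {γ : ℝ}

theorem sum_range_mul_of_periodic {f : ℕ → ℝ} {L : ℕ} (hf : Function.Periodic f L) (k : ℕ) :
    ∑ t ∈ Finset.range (L * k), f t = k * ∑ t ∈ Finset.range L, f t := by
  induction k with
  | zero => simp
  | succ k ih =>
    rw [mul_add, mul_one, Finset.sum_range_add, ih]
    have : ∀ t ∈ Finset.range L, f (L * k + t) = f t := fun t _ => by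
      rw [add_comm, mul_comm]
      simpa using hf.nat_mul k t
    rw [Finset.sum_congr rfl this]
    push_cast; ring

theorem le_sum_of_periodic {f : ℕ → ℝ} {L : ℕ} (hL : 1 ≤ L) (hf : Function.Periodic f L)
    (h0 : ∀ t, 0 ≤ f t) (t : ℕ) : f t ≤ ∑ s ∈ Finset.range L, f s := by
  rw [← hf.map_mod_nat]
  exact Finset.single_le_sum (fun s _ => h0 s) (Finset.mem_range.2 (Nat.mod_lt _ hL))

/-- Repeat the signal over all whole periods inside the horizon and then play zero. Starting at 0
instead of `y` costs a bounded amount, as does the incomplete last period. -/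
theorem IsLyapunov.periodic_mem_achievable (h : IsLyapunov T N ρ K) {L : ℕ} (hL : 1 ≤ L)
    {u : ℕ → U} (hu : Function.Periodic u L) {y : E} (hy : resp T (fun s => B (u s)) y L = y)
    (hpow : ∑ t ∈ Finset.range L, ‖u t‖ ^ 2 ≤ γ ^ 2 * L) {Q : E →L[ℝ] E}
    (hQ : ∀ w, L * inner ℝ (Q w) w
      ≤ ∑ t ∈ Finset.range L, (inner ℝ w (resp T (fun s => B (u s)) y t)) ^ 2) :
    Q ∈ achievable T B γ := by
  intro θ hθ
  have h1ρ : 0 < 1 - ρ := sub_pos.2 h.lt_one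
  have hb : Function.Periodic (fun s => B (u s)) L := hu.comp B
  have hper := resp_periodic hb hy
  set v := resp T (fun s => B (u s)) y with hv
  set Cv := ∑ t ∈ Finset.range L, ‖v t‖
  have hCv : 0 ≤ Cv := Finset.sum_nonneg fun _ _ => norm_nonneg _
  set Cu := ∑ t ∈ Finset.range L, ‖u t‖
  have hCu : 0 ≤ Cu := Finset.sum_nonneg fun _ _ => norm_nonneg _
  have hvC : ∀ t, ‖v t‖ ≤ Cv := le_sum_of_periodic hL (hper.comp _) fun _ => norm_nonneg _
  have huC : ∀ t, ‖u t‖ ≤ Cu := le_sum_of_periodic hL (hu.comp _) fun _ => norm_nonneg _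
  set R := 2 * Cv * (N (0 - y) / (1 - ρ)) with hR
  -- `R` bounds the effect of the initial state, and L‖Q‖ the contribution missing from the fewer
  -- than `L` leftover steps.
  refine ⟨Cu, hCu, ⌈(R + L * ‖Q‖) / θ⌉₊, fun n hn => ?_⟩
  have hn' : (R + L * ‖Q‖) / θ ≤ n := Nat.ceil_le.1 hn
  rw [div_le_iff₀ hθ] at hn'
  have hdm := Nat.div_add_mod n L
  have hlt := Nat.mod_lt n hL
  generalize n / L = k at hdm
  generalize n % L = j at hdm hlt
  have hle : L * k ≤ n := by omega
  refine ⟨fun t => if t < L * k then u t else 0, fun t => ?_, ?_, fun w => ?_⟩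
  · dsimp only
    split_ifs
    · exact huC t
    · simpa using hCu
  · have h1 : ∑ t ∈ Finset.range n, ‖if t < L * k then u t else 0‖ ^ 2
        = ∑ t ∈ Finset.range (L * k), ‖u t‖ ^ 2 := by
      symm
      rw [← Finset.sum_subset (Finset.range_mono hle)]
      · refine Finset.sum_congr rfl fun t ht => ?_
        rw [if_pos (Finset.mem_range.1 ht)]
      · intro t _ ht
        rw [if_neg (by simpa using ht)]; simp
    rw [h1, sum_range_mul_of_periodic (f := fun t => ‖u t‖ ^ 2) (hu.comp fun x => ‖x‖ ^ 2)]
    calc _ ≤ k * (γ ^ 2 * L) := by gcongr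
      _ = γ ^ 2 * ((L * k : ℕ) : ℝ) := by push_cast; ring
      _ ≤ _ := by gcongr
  · have h1 : ∑ t ∈ Finset.range (L * k), (inner ℝ w (v t + (T ^ t) (0 - y))) ^ 2
        ≤ ∑ t ∈ Finset.range n, (inner ℝ w (resp T
          (fun s => B (if s < L * k then u s else 0)) 0 t)) ^ 2 := by
      rw [Finset.sum_congr rfl fun t ht => by rw [hv, ← resp_sub_init]]
      refine le_trans (le_of_eq ?_) (Finset.sum_le_sum_of_subset_of_nonneg
        (Finset.range_mono hle) fun _ _ _ => sq_nonneg _)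
      refine Finset.sum_congr rfl fun t ht => ?_
      rw [resp_congr 0 (b := fun s => B (u s)) (b' := fun s => B (if s < L * k then u s else 0)) fun s hs => by
        rw [if_pos (hs.trans (Finset.mem_range.1 ht))]]
    refine le_trans ?_ h1
    refine le_trans ?_ (h.sum_inner_sq_ge hCv (fun t _ => hvC t) (0 - y) w)
    rw [← hR, sum_range_mul_of_periodic (f := fun t => (inner ℝ w (v t)) ^ 2)
      (hper.comp fun x => (inner ℝ w x) ^ 2)]
    have h2 : (k : ℝ) * (L * inner ℝ (Q w) w) ≤ k * ∑ t ∈ Finset.range L, (inner ℝ w (v t)) ^ 2 :=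
      mul_le_mul_of_nonneg_left (hQ w) k.cast_nonneg
    have h3 := (abs_le.1 (abs_inner_apply_le Q w)).2
    have h4 : (n : ℝ) = L * k + j := by exact_mod_cast hdm.symm
    have h5 : (j : ℝ) * inner ℝ (Q w) w ≤ L * (‖Q‖ * ‖w‖ ^ 2) := by
      calc _ ≤ (j : ℝ) * (‖Q‖ * ‖w‖ ^ 2) := by gcongr
        _ ≤ _ := by gcongr
    have h6 : (R + L * ‖Q‖) * ‖w‖ ^ 2 ≤ n * θ * ‖w‖ ^ 2 := by gcongr
    have h7 : (n : ℝ) * (inner ℝ (Q w) w - θ * ‖w‖ ^ 2)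
        = k * (L * inner ℝ (Q w) w) + j * inner ℝ (Q w) w - n * θ * ‖w‖ ^ 2 := by rw [h4]; ring
    linarith

theorem resp_eq_pow {b : ℕ → E} (x : E) {t : ℕ} (hb : ∀ s < t, b s = 0) :
    resp T b x t = (T ^ t) x := by
  induction t with
  | zero => simp [resp]
  | succ t ih =>
    simp only [resp]
    rw [ih fun s hs => hb s (by omega), hb t (by omega), pow_succ' T t, mul_apply_eq_comp, add_zero]

/-- Signals of finite length are turned into periodic ones, by a short pause after each period. -/
theorem IsLyapunov.block_mem_achievable [FiniteDimensional ℝ E] (h : IsLyapunov T N ρ K)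
    (B : U →L[ℝ] E) (γ : ℝ) (k : ℕ) (x₀ : E) {κ : ℝ} (hκ : 0 < κ) :
    ∃ G m₀ : ℕ, 8 * G ≤ m₀ ∧ 1 ≤ m₀ ∧ ∀ m ≥ m₀, ∀ u : ℕ → U,
      ∑ t ∈ Finset.range m, ‖u t‖ ^ 2 ≤ γ ^ 2 * (m + k) →
      (9 / 10 / (m + G : ℝ)) • ∑ t ∈ Finset.range m, InnerProductSpace.rankOne ℝ
        (resp T (fun s => B (u s)) x₀ t) (resp T (fun s => B (u s)) x₀ t) - κ • 1
        ∈ achievable T B γ := by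
  have h1ρ : 0 < 1 - ρ := sub_pos.2 h.lt_one
  set c := K ^ 2 / (1 - ρ) ^ 2 * (‖B‖ ^ 2 * γ ^ 2) with hc
  have hc0 : 0 ≤ c := by positivity
  obtain ⟨G₁, hG₁⟩ : ∃ G₁ : ℕ, ∀ G ≥ G₁, 18 / (1 - ρ) * (ρ ^ G * c) ≤ κ / 2 := by
    have h1 : Tendsto (fun G : ℕ => 18 / (1 - ρ) * (ρ ^ G * c)) atTop
        (𝓝 (18 / (1 - ρ) * (0 * c))) :=
      ((tendsto_pow_atTop_nhds_zero_of_lt_one h.pos.le h.lt_one).mul_const c).const_mul _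
    have h2 : ∀ᶠ G : ℕ in atTop, 18 / (1 - ρ) * (ρ ^ G * c) < κ / 2 :=
      h1.eventually_lt_const (by simp; exact hκ)
    obtain ⟨G₁, hG₁⟩ := eventually_atTop.1 h2
    exact ⟨G₁, fun G hG => (hG₁ G hG).le⟩
  -- The pause has two uses. Its length exceeds `k`, so the longer period pays for the surplus
  -- energy γ²k; and the factor ρ^G makes the state left over from the previous period negligible
  -- relative to `L`, although its square may be of order m. `G` is fixed before `m`, so the pause
  -- takes up a small fraction of the period.
  set G := max G₁ (k + 1) with hG
  have hGk : k + 1 ≤ G := le_max_right _ _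
  have hGc := hG₁ G (le_max_left _ _)
  set D := 18 / (1 - ρ) * N (-x₀) ^ 2 with hD
  refine ⟨G, 8 * G + 1 + ⌈D / (κ / 2)⌉₊, by omega, by omega, fun m hm u hu => ?_⟩
  have hDm : D / (κ / 2) ≤ m := Nat.ceil_le.1 (by omega)
  rw [div_le_iff₀ (by positivity)] at hDm
  set L := m + G with hL
  have hL1 : 1 ≤ L := by omega
  set u' : ℕ → U := fun t => if t % L < m then u (t % L) else 0 with hu'
  have hper : Function.Periodic u' L := fun t => by simp [hu']
  have hul : ∀ t < m, u' t = u t := fun t ht => by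
    simp only [hu']; rw [Nat.mod_eq_of_lt (by omega), if_pos ht]
  have hur : ∀ t < G, u' (m + t) = 0 := fun t ht => by
    simp only [hu']; rw [Nat.mod_eq_of_lt (by omega), if_neg (by omega)]
  obtain ⟨y, hy⟩ := h.exists_periodic_init (fun s => B (u' s)) hL1
  have hen : ∑ t ∈ Finset.range L, ‖u' t‖ ^ 2 = ∑ t ∈ Finset.range m, ‖u t‖ ^ 2 := by
    rw [hL, Finset.sum_range_add, Finset.sum_congr rfl fun t ht => by
      rw [hul t (Finset.mem_range.1 ht)], add_eq_left]
    exact Finset.sum_eq_zero fun t ht => by rw [hur t (Finset.mem_range.1 ht)]; simp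
  have hGk' : (k : ℝ) + 1 ≤ G := by exact_mod_cast hGk
  have hLr : (L : ℝ) = m + G := by rw [hL]; push_cast; ring
  refine h.periodic_mem_achievable hL1 hper hy ?_ fun w => ?_
  · rw [hen, hLr]
    refine hu.trans ?_
    gcongr; linarith
  set z := resp T (fun s => B (u' s)) y with hz
  set v := resp T (fun s => B (u s)) x₀ with hv
  have hzv : ∀ t < m, z t = v t + (T ^ t) (y - x₀) := fun t ht => by
    rw [hz, resp_sub_init _ x₀ y, resp_congr x₀ (b' := fun s => B (u s)) fun s hs => by
      rw [hul s (by omega)]]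
  have hym : y = (T ^ G) (z m) := by
    have e1 : z (m + G) = (T ^ G) (z m) := by
      rw [hz, resp_add_time, resp_eq_pow]
      intro s hs
      rw [hur s hs, map_zero]
    rw [← e1, ← hL, hy]
  have hzm : N (z m) ^ 2 ≤ c * (m + k) := by
    have e1 : N (z m) ^ 2 ≤ ∑ t ∈ Finset.range L, N (z t) ^ 2 :=
      Finset.single_le_sum (f := fun t => N (z t) ^ 2) (fun s _ => sq_nonneg _)
        (Finset.mem_range.2 (by omega))
    have e2 := h.sum_sq_resp_le_of_periodic (fun s => B (u' s)) hy
    have e3 : ∑ t ∈ Finset.range L, ‖B (u' t)‖ ^ 2 ≤ ‖B‖ ^ 2 * (γ ^ 2 * (m + k)) := by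
      calc _ ≤ ∑ t ∈ Finset.range L, ‖B‖ ^ 2 * ‖u' t‖ ^ 2 := by
            refine Finset.sum_le_sum fun t _ => ?_
            rw [← mul_pow]; gcongr; exact B.le_opNorm _
        _ = ‖B‖ ^ 2 * ∑ t ∈ Finset.range L, ‖u' t‖ ^ 2 := by rw [Finset.mul_sum]
        _ ≤ _ := by rw [hen]; gcongr
    calc _ ≤ _ := e1.trans e2
      _ ≤ K ^ 2 / (1 - ρ) ^ 2 * (‖B‖ ^ 2 * (γ ^ 2 * (m + k))) := by gcongr
      _ = _ := by rw [hc]; ring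
  have hNy : N y ^ 2 ≤ ρ ^ G * (c * (m + k)) := by
    have e1 : N y ≤ ρ ^ G * N (z m) := by
      conv_lhs => rw [hym]
      exact h.pow_le G _
    have e2 : ρ ^ G ≤ 1 := pow_le_one₀ h.pos.le h.lt_one.le
    have e3 : 0 ≤ ρ ^ G := pow_nonneg h.pos.le _
    calc N y ^ 2 ≤ (ρ ^ G * N (z m)) ^ 2 := by have := h.nonneg y; gcongr
      _ = ρ ^ G * (ρ ^ G * N (z m) ^ 2) := by ring
      _ ≤ ρ ^ G * (1 * N (z m) ^ 2) := by gcongr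
      _ ≤ ρ ^ G * (c * (m + k)) := by rw [one_mul]; gcongr
  have hNyx : N (y - x₀) ^ 2 ≤ 2 * (ρ ^ G * (c * (m + k))) + 2 * N (-x₀) ^ 2 := by
    have e1 : N (y - x₀) ≤ N y + N (-x₀) := by rw [sub_eq_add_neg]; exact h.add_le _ _
    have e2 : N (y - x₀) ^ 2 ≤ (N y + N (-x₀)) ^ 2 := by
      have := h.nonneg (y - x₀); gcongr
    linarith [sq_nonneg (N y - N (-x₀))]
  -- This is (a + b)² ≥ (9/10)a² - 9b², whose defect is (a + 10b)²/10. A cross-term bound as in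
  -- `sum_inner_sq_ge` is unavailable, since no amplitude bound uniform in `m` is assumed.
  have hsum : 9 / 10 * ∑ t ∈ Finset.range m, (inner ℝ w (v t)) ^ 2
      - 9 * ∑ t ∈ Finset.range m, (inner ℝ w ((T ^ t) (y - x₀))) ^ 2
      ≤ ∑ t ∈ Finset.range L, (inner ℝ w (z t)) ^ 2 := by
    refine le_trans ?_ (Finset.sum_le_sum_of_subset_of_nonneg
      (Finset.range_mono (by omega : m ≤ L)) fun _ _ _ => sq_nonneg _)
    rw [Finset.mul_sum, Finset.mul_sum, ← Finset.sum_sub_distrib]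
    refine Finset.sum_le_sum fun t ht => ?_
    rw [hzv t (Finset.mem_range.1 ht), inner_add_right]
    nlinarith [sq_nonneg (inner ℝ w (v t) + 10 * inner ℝ w ((T ^ t) (y - x₀)))]
  have herr : 9 * ∑ t ∈ Finset.range m, (inner ℝ w ((T ^ t) (y - x₀))) ^ 2 ≤ L * κ * ‖w‖ ^ 2 := by
    have e1 : ∑ t ∈ Finset.range m, (inner ℝ w ((T ^ t) (y - x₀))) ^ 2
        ≤ ‖w‖ ^ 2 * (N (y - x₀) ^ 2 / (1 - ρ)) := by
      calc _ ≤ ∑ t ∈ Finset.range m, ‖w‖ ^ 2 * ‖(T ^ t) (y - x₀)‖ ^ 2 := by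
            refine Finset.sum_le_sum fun t _ => ?_
            rw [← mul_pow, ← sq_abs]; gcongr; exact abs_real_inner_le_norm _ _
        _ = ‖w‖ ^ 2 * ∑ t ∈ Finset.range m, ‖(T ^ t) (y - x₀)‖ ^ 2 := by rw [Finset.mul_sum]
        _ ≤ _ := by gcongr; exact h.sum_sq_norm_pow_le _ _
    have e2 : 9 * (N (y - x₀) ^ 2 / (1 - ρ)) ≤ L * κ := by
      calc 9 * (N (y - x₀) ^ 2 / (1 - ρ))
          ≤ 9 * ((2 * (ρ ^ G * (c * (m + k))) + 2 * N (-x₀) ^ 2) / (1 - ρ)) := by gcongr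
        _ = 18 / (1 - ρ) * (ρ ^ G * c) * (m + k) + D := by rw [hD]; field_simp; ring
        _ ≤ κ / 2 * (m + k) + m * (κ / 2) := by gcongr
        _ ≤ L * κ := by rw [hLr]; nlinarith
    calc _ ≤ 9 * (‖w‖ ^ 2 * (N (y - x₀) ^ 2 / (1 - ρ))) := by gcongr
      _ = 9 * (N (y - x₀) ^ 2 / (1 - ρ)) * ‖w‖ ^ 2 := by ring
      _ ≤ _ := by gcongr
  have hLp : (0 : ℝ) < m + G := by rw [← hLr]; exact_mod_cast hL1
  have hQ : (L : ℝ) * inner ℝ (((9 / 10 / (m + G : ℝ)) • ∑ t ∈ Finset.range m,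
      InnerProductSpace.rankOne ℝ (v t) (v t) - κ • (1 : E →L[ℝ] E)) w) w
      = 9 / 10 * ∑ t ∈ Finset.range m, (inner ℝ w (v t)) ^ 2 - L * κ * ‖w‖ ^ 2 := by
    have e1 : ((9 / 10 / (m + G : ℝ)) • ∑ t ∈ Finset.range m,
      InnerProductSpace.rankOne ℝ (v t) (v t) - κ • (1 : E →L[ℝ] E)) w
      = (9 / 10 / (m + G : ℝ)) • ∑ t ∈ Finset.range m, inner ℝ (v t) w • v t - κ • w := by
      simp
    rw [e1, inner_sub_left, real_inner_smul_left, real_inner_smul_left, sum_inner,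
      real_inner_self_eq_norm_sq, hLr]
    have e2 : ∑ t ∈ Finset.range m, inner ℝ (inner ℝ (v t) w • v t) w
        = ∑ t ∈ Finset.range m, (inner ℝ w (v t)) ^ 2 := by
      refine Finset.sum_congr rfl fun t _ => ?_
      rw [real_inner_smul_left, real_inner_comm]; ring
    rw [e2]
    field_simp
  rw [hQ]
  linarith

end Periodic

/-! ### The minimum eigenvalue as a bound on quadratic forms. -/

section LambdaMin

open scoped MatrixOrder ComplexOrder

variable {d : ℕ}

theorem le_lambdaMin_iff (hd : 1 ≤ d) {M : Matrix (Fin d) (Fin d) ℂ} (hM : M.IsHermitian) (c : ℝ) :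
    c ≤ lambdaMin M ↔ (M - algebraMap ℝ _ c).PosSemidef := by
  have : Nonempty (Fin d) := ⟨⟨0, hd⟩⟩
  have hsp := hM.spectrum_real_eq_range_eigenvalues
  have hH : (M - algebraMap ℝ (Matrix (Fin d) (Fin d) ℂ) c).IsHermitian := by
    refine hM.sub ?_
    have : IsSelfAdjoint (algebraMap ℝ (Matrix (Fin d) (Fin d) ℂ) c) :=
      IsSelfAdjoint.algebraMap _ (IsSelfAdjoint.all c)
    exact this
  have hsp' := hH.spectrum_real_eq_range_eigenvalues
  rw [hH.posSemidef_iff_eigenvalues_nonneg, lambdaMin, le_csInf_iff]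
  · have h1 : (0 ≤ hH.eigenvalues) ↔ ∀ x ∈ spectrum ℝ (M - algebraMap ℝ _ c), 0 ≤ x := by
      rw [hsp', Set.forall_mem_range]; rfl
    rw [h1, ← spectrum.sub_singleton_eq]
    simp
  · rw [hsp]; exact (Set.finite_range _).bddBelow
  · rw [hsp]; exact Set.range_nonempty _

/-- Weyl's inequality: a Hermitian difference is bounded below by minus its norm. It yields
continuity, and thus attained maxima. -/
theorem lambdaMin_sub_norm_le (hd : 1 ≤ d) {M M' : Matrix (Fin d) (Fin d) ℂ} (hM : M.IsHermitian)
    (hM' : M'.IsHermitian) : lambdaMin M - ‖M - M'‖ ≤ lambdaMin M' := by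
  rw [le_lambdaMin_iff hd hM']
  have h1 := (le_lambdaMin_iff hd hM (lambdaMin M)).1 le_rfl
  have h2 : -(algebraMap ℝ (Matrix (Fin d) (Fin d) ℂ) ‖M' - M‖) ≤ M' - M :=
    IsSelfAdjoint.neg_algebraMap_norm_le_self (a := M' - M) (hM'.sub hM)
  have h3 : (M' - M + algebraMap ℝ (Matrix (Fin d) (Fin d) ℂ) ‖M' - M‖).PosSemidef := by
    rw [← Matrix.nonneg_iff_posSemidef]
    rw [← sub_nonneg] at h2
    simpa using h2
  have h4 := h1.add h3
  rw [norm_sub_rev]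
  convert h4 using 1
  rw [map_sub]; abel

theorem continuous_lambdaMin_comp (hd : 1 ≤ d) {X : Type*} [TopologicalSpace X]
    {f : X → Matrix (Fin d) (Fin d) ℂ} (hf : Continuous f) (hH : ∀ x, (f x).IsHermitian) :
    Continuous fun x => lambdaMin (f x) := by
  rw [continuous_iff_continuousAt]
  intro x
  rw [ContinuousAt, tendsto_iff_dist_tendsto_zero]
  have h1 : Tendsto (fun y => ‖f y - f x‖) (𝓝 x) (𝓝 0) := by
    have : ContinuousAt (fun y => ‖f y - f x‖) x := by fun_prop
    simpa [ContinuousAt] using this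
  refine squeeze_zero (fun _ => dist_nonneg) (fun y => ?_) h1
  rw [Real.dist_eq, abs_le]
  have h2 := lambdaMin_sub_norm_le hd (hH y) (hH x)
  have h3 := lambdaMin_sub_norm_le hd (hH x) (hH y)
  rw [norm_sub_rev] at h3
  constructor <;> linarith

theorem le_lambdaMin_toComplex_iff (hd : 1 ≤ d) {S : Matrix (Fin d) (Fin d) ℝ}
    (hS : S.IsSymm) (c : ℝ) : c ≤ lambdaMin (toComplex S) ↔
      ∀ w : EuclideanSpace ℝ (Fin d), c * ‖w‖ ^ 2 ≤ inner ℝ w (Matrix.toEuclideanLin S w) := by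
  have hH : (toComplex S).IsHermitian := by
    ext i j
    simp [toComplex, Matrix.conjTranspose_apply, hS.apply i j]
  have hsum : ∀ x : Fin d → ℝ, x ⬝ᵥ S.mulVec x = ∑ i, ∑ j, x i * S i j * x j := fun x => by
    simp only [dotProduct, Matrix.mulVec, Finset.mul_sum, mul_assoc]
  have hw : ∀ w : EuclideanSpace ℝ (Fin d),
      inner ℝ w (Matrix.toEuclideanLin S w) = ∑ i, ∑ j, w i * S i j * w j := fun w => by
    rw [← hsum]
    simp [PiLp.inner_apply, dotProduct, Matrix.toLpLin_apply, mul_comm]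
  have hn : ∀ w : EuclideanSpace ℝ (Fin d), ‖w‖ ^ 2 = ∑ i, w i ^ 2 :=
    fun w => EuclideanSpace.real_norm_sq_eq w
  rw [le_lambdaMin_iff hd hH, Matrix.posSemidef_iff_dotProduct_mulVec]
  have hH' : (toComplex S - algebraMap ℝ (Matrix (Fin d) (Fin d) ℂ) c).IsHermitian := by
    refine hH.sub ?_
    have : IsSelfAdjoint (algebraMap ℝ (Matrix (Fin d) (Fin d) ℂ) c) :=
      IsSelfAdjoint.algebraMap _ (IsSelfAdjoint.all c)
    exact this
  -- For a real symmetric matrix the form at z is the sum of the forms at Re z and Im z, so real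
  -- test vectors suffice.
  have key : ∀ z : Fin d → ℂ, star z ⬝ᵥ (toComplex S - algebraMap ℝ _ c).mulVec z
      = (((∑ i, ∑ j, (z i).re * S i j * (z j).re + ∑ i, ∑ j, (z i).im * S i j * (z j).im)
        - c * (∑ i, (z i).re ^ 2 + ∑ i, (z i).im ^ 2) : ℝ) : ℂ) := by
    intro z
    have him : (star z ⬝ᵥ (toComplex S - algebraMap ℝ _ c).mulVec z).im = 0 := by
      exact hH'.im_star_dotProduct_mulVec_self z
    apply Complex.ext
    · rw [Matrix.sub_mulVec, dotProduct_sub, Complex.sub_re, Complex.ofReal_re]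
      congr 1
      · simp only [dotProduct, Matrix.mulVec, Finset.mul_sum, Complex.re_sum, toComplex,
          Matrix.map_apply, Pi.star_apply]
        rw [← Finset.sum_add_distrib]
        refine Finset.sum_congr rfl fun i _ => ?_
        rw [← Finset.sum_add_distrib]
        refine Finset.sum_congr rfl fun j _ => ?_
        simp; ring
      · rw [Algebra.algebraMap_eq_smul_one, Matrix.smul_mulVec, Matrix.one_mulVec, ← Finset.sum_add_distrib]
        simp only [dotProduct, Finset.mul_sum, Complex.re_sum, Pi.star_apply, Pi.smul_apply]
        refine Finset.sum_congr rfl fun i _ => ?_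
        simp; ring
    · rw [him, Complex.ofReal_im]
  constructor
  · rintro ⟨_, h⟩ w
    have h1 := h fun i => (w i : ℂ)
    rw [key] at h1
    have h2 := Complex.zero_le_real.1 h1
    simp at h2
    rw [hw, hn]
    exact h2
  · intro h
    refine ⟨hH', fun z => ?_⟩
    rw [key]
    have h1 := h (WithLp.toLp 2 fun i => (z i).re)
    have h2 := h (WithLp.toLp 2 fun i => (z i).im)
    rw [hw, hn] at h1 h2
    simp only at h1 h2
    apply Complex.zero_le_real.2
    linarith

end LambdaMin

/-! ### Spectral radius, transfer matrices and Parseval's identity. -/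

section Fourier

variable {d p : ℕ}

/-- The state matrix as an operator on Euclidean space. -/
noncomputable abbrev stateMap (A : Matrix (Fin d) (Fin d) ℝ) :
    EuclideanSpace ℝ (Fin d) →L[ℝ] EuclideanSpace ℝ (Fin d) :=
  LinearMap.toContinuousLinearMap (Matrix.toEuclideanLin A)

/-- The input matrix as an operator between Euclidean spaces. -/
noncomputable abbrev inputMap (B : Matrix (Fin d) (Fin p) ℝ) :
    EuclideanSpace ℝ (Fin p) →L[ℝ] EuclideanSpace ℝ (Fin d) :=
  LinearMap.toContinuousLinearMap (Matrix.toEuclideanLin B)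

theorem toComplex_pow (A : Matrix (Fin d) (Fin d) ℝ) (m : ℕ) :
    toComplex (A ^ m) = toComplex A ^ m :=
  Matrix.map_pow A Complex.ofRealHom m

theorem stateMap_pow (A : Matrix (Fin d) (Fin d) ℝ) (m : ℕ) (x : EuclideanSpace ℝ (Fin d)) :
    (stateMap A ^ m) x = Matrix.toEuclideanLin (A ^ m) x := by
  induction m with
  | zero => simp
  | succ m ih =>
    rw [pow_succ' (stateMap A), mul_apply_eq_comp, ih, pow_succ' A]
    simp [Matrix.toLpLin_apply]

/-- Gelfand's formula turns the spectral hypothesis into contraction by one power, which is all the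
Lyapunov construction needs. -/
theorem exists_pow_norm_le {A : Matrix (Fin d) (Fin d) ℝ}
    (hA : spectralRadius ℂ (toComplex A) < 1) :
    ∃ m, 1 ≤ m ∧ ‖toComplex A ^ m‖ ≤ 1 / 2 := by
  obtain ⟨r, hr1, hr2⟩ := ENNReal.lt_iff_exists_nnreal_btwn.1 hA
  have hr2' : r < 1 := by exact_mod_cast hr2
  have h1 := spectrum.pow_nnnorm_pow_one_div_tendsto_nhds_spectralRadius (toComplex A)
  have h2 := h1.eventually_lt_const hr1
  have h3 : Tendsto (fun n : ℕ => (r : ℝ) ^ n) atTop (𝓝 0) :=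
    tendsto_pow_atTop_nhds_zero_of_lt_one r.2 hr2'
  have h4 := h3.eventually_lt_const (by norm_num : (0 : ℝ) < 1 / 2)
  obtain ⟨m, ⟨hm1, hm2⟩, hm3⟩ := ((h2.and h4).and (eventually_ge_atTop 1)).exists
  refine ⟨m, hm3, ?_⟩
  have hm0 : (0 : ℝ) < m := by exact_mod_cast hm3
  have h5 : ((‖toComplex A ^ m‖₊ : ENNReal) ^ (1 / (m : ℝ))) ^ (m : ℝ) ≤ (r : ENNReal) ^ (m : ℝ) :=
    ENNReal.rpow_le_rpow hm1.le hm0.le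
  rw [← ENNReal.rpow_mul, one_div_mul_cancel hm0.ne', ENNReal.rpow_one, ENNReal.rpow_natCast] at h5
  have h6 : ‖toComplex A ^ m‖₊ ≤ r ^ m := by exact_mod_cast h5
  have h7 : ‖toComplex A ^ m‖ ≤ (r : ℝ) ^ m := by exact_mod_cast h6
  linarith

theorem norm_toEuclideanLin_le (M : Matrix (Fin d) (Fin d) ℝ) (x : EuclideanSpace ℝ (Fin d)) :
    ‖Matrix.toEuclideanLin M x‖ ≤ ‖toComplex M‖ * ‖x‖ := by
  have hn : ∀ y : EuclideanSpace ℝ (Fin d),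
      ‖(WithLp.toLp 2 fun i => (y i : ℂ) : EuclideanSpace ℂ (Fin d))‖ = ‖y‖ := fun y => by
    simp [EuclideanSpace.norm_eq]
  have h1 := Matrix.l2_opNorm_mulVec (toComplex M)
    (WithLp.toLp 2 fun i => (x i : ℂ) : EuclideanSpace ℂ (Fin d))
  rw [hn] at h1
  refine le_trans (le_of_eq ?_) h1
  rw [← hn]
  congr 1
  ext i
  simp [Matrix.toLpLin_apply, Matrix.mulVec, dotProduct, toComplex]

theorem exists_isLyapunov_stateMap {A : Matrix (Fin d) (Fin d) ℝ}
    (hA : spectralRadius ℂ (toComplex A) < 1) :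
    ∃ (N : EuclideanSpace ℝ (Fin d) → ℝ) (ρ K : ℝ), IsLyapunov (stateMap A) N ρ K := by
  obtain ⟨m, hm1, hm⟩ := exists_pow_norm_le hA
  refine exists_isLyapunov _ m hm1 fun x => ?_
  rw [stateMap_pow]
  refine (norm_toEuclideanLin_le _ x).trans ?_
  rw [toComplex_pow]
  gcongr

theorem isUnit_det_sub {A : Matrix (Fin d) (Fin d) ℝ} (hA : spectralRadius ℂ (toComplex A) < 1)
    {e : ℂ} (he : ‖e‖ = 1) : IsUnit (e • (1 : Matrix (Fin d) (Fin d) ℂ) - toComplex A).det := by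
  rw [← Matrix.isUnit_iff_isUnit_det, ← Algebra.algebraMap_eq_smul_one]
  have he' : ‖e‖₊ = 1 := NNReal.eq he
  exact spectrum.mem_resolventSet_of_spectralRadius_lt (by rw [he']; exact_mod_cast hA)

theorem sum_root_mul {n : ℕ} (hn : 1 ≤ n) {ζ : ℂ} (hζ : IsPrimitiveRoot ζ n) {s t : ℕ}
    (hs : s < n) (ht : t < n) :
    ∑ ℓ : Fin n, ((ζ ^ (ℓ : ℕ)) ^ t)⁻¹ * (ζ ^ (ℓ : ℕ)) ^ s = if s = t then (n : ℂ) else 0 := by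
  have hζ0 : ζ ≠ 0 := hζ.ne_zero (by omega)
  have h1 : ∀ ℓ : Fin n, ((ζ ^ (ℓ : ℕ)) ^ t)⁻¹ * (ζ ^ (ℓ : ℕ)) ^ s = ((ζ ^ t)⁻¹ * ζ ^ s) ^ (ℓ : ℕ) :=
    fun ℓ => by rw [mul_pow, inv_pow, pow_right_comm, pow_right_comm ζ _ s]
  simp only [h1]
  rw [Fin.sum_univ_eq_sum_range (fun ℓ => ((ζ ^ t)⁻¹ * ζ ^ s) ^ ℓ) n]
  split_ifs with hst
  · subst hst
    simp [hζ0]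
  · have h2 := geom_sum_mul ((ζ ^ t)⁻¹ * ζ ^ s) n
    have h3 : ((ζ ^ t)⁻¹ * ζ ^ s) ^ n = 1 := by
      rw [mul_pow, inv_pow, pow_right_comm, hζ.pow_eq_one, pow_right_comm, hζ.pow_eq_one]; simp
    rw [h3, sub_self, mul_eq_zero] at h2
    refine h2.resolve_right fun h4 => hst ?_
    rw [sub_eq_zero, inv_mul_eq_one₀ (pow_ne_zero _ hζ0)] at h4
    exact (hζ.pow_inj ht hs h4).symm

/-- On a periodic orbit the discrete Fourier transform turns the time shift into multiplication by
the root of unity `e`. The recursion becomes (e I - A) ẑ = B û, and e I - A is invertible because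
|e| = 1 exceeds the spectral radius. -/
theorem transfer_mulVec_dft {A : Matrix (Fin d) (Fin d) ℝ}
    (hA : spectralRadius ℂ (toComplex A) < 1) (B : Matrix (Fin d) (Fin p) ℝ) {n : ℕ} (hn : 1 ≤ n)
    (u : ℕ → EuclideanSpace ℝ (Fin p)) {y : EuclideanSpace ℝ (Fin d)}
    (hy : resp (stateMap A) (fun s => inputMap B (u s)) y n = y) (ℓ : Fin n) :
    (transfer A B n ℓ).mulVec (dft (fun i : Fin n => u i) ℓ) = fun i => ∑ t ∈ Finset.range n,
      ((Complex.exp (2 * Real.pi * Complex.I / n) ^ (ℓ : ℕ)) ^ t)⁻¹ *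
        (resp (stateMap A) (fun s => inputMap B (u s)) y t i : ℂ) := by
  set z := resp (stateMap A) (fun s => inputMap B (u s)) y with hz
  have hn0 : (n : ℂ) ≠ 0 := by exact_mod_cast (by omega : n ≠ 0)
  have hζ := Complex.isPrimitiveRoot_exp n (by omega)
  have he : Complex.exp (2 * Real.pi * (ℓ : ℕ) / (n : ℂ) * Complex.I)
      = Complex.exp (2 * Real.pi * Complex.I / n) ^ (ℓ : ℕ) := by
    rw [← Complex.exp_nat_mul]; congr 1; field_simp
  have hen : (Complex.exp (2 * Real.pi * Complex.I / n) ^ (ℓ : ℕ)) ^ n = 1 := by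
    rw [pow_right_comm, hζ.pow_eq_one, one_pow]
  have henorm : ‖Complex.exp (2 * Real.pi * Complex.I / n) ^ (ℓ : ℕ)‖ = 1 :=
    Complex.norm_eq_one_of_pow_eq_one hen (by omega)
  have hdft : dft (fun i : Fin n => u i) ℓ = fun i => ∑ t ∈ Finset.range n,
      ((Complex.exp (2 * Real.pi * Complex.I / n) ^ (ℓ : ℕ)) ^ t)⁻¹ * (u t i : ℂ) := by
    funext i
    rw [← Fin.sum_univ_eq_sum_range (fun t =>
      ((Complex.exp (2 * Real.pi * Complex.I / n) ^ (ℓ : ℕ)) ^ t)⁻¹ * (u t i : ℂ)), dft]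
    refine Finset.sum_congr rfl fun t _ => ?_
    congr 1
    rw [← Complex.exp_nat_mul, ← Complex.exp_nat_mul, ← Complex.exp_neg]
    congr 1; field_simp
  rw [hdft, transfer, he]
  generalize Complex.exp (2 * Real.pi * Complex.I / n) ^ (ℓ : ℕ) = e at *
  have he0 : e ≠ 0 := by rintro rfl; simp at henorm
  have hdet := isUnit_det_sub hA henorm
  have key : (e • (1 : Matrix (Fin d) (Fin d) ℂ) - toComplex A).mulVec
      (fun i => ∑ t ∈ Finset.range n, (e ^ t)⁻¹ * (z t i : ℂ))
      = (toComplex B).mulVec (fun i => ∑ t ∈ Finset.range n, (e ^ t)⁻¹ * (u t i : ℂ)) := by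
    funext i
    rw [Matrix.sub_mulVec, Matrix.smul_mulVec, Matrix.one_mulVec]
    -- Reindexing leaves two boundary terms, which cancel because e^n = 1 and the orbit closes up
    -- after `n` steps.
    have h1 : ∑ t ∈ Finset.range n, e * ((e ^ t)⁻¹ * (z t i : ℂ))
        = ∑ t ∈ Finset.range n, (e ^ t)⁻¹ * (z (t + 1) i : ℂ) := by
      have h2 := Finset.sum_range_succ' (fun t => e * ((e ^ t)⁻¹ * (z t i : ℂ))) n
      rw [Finset.sum_range_succ, hen, hy] at h2
      simp only [pow_zero] at h2
      have h3 : z 0 = y := rfl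
      rw [h3, add_left_inj] at h2
      rw [h2]
      refine Finset.sum_congr rfl fun t _ => ?_
      rw [pow_succ]; field_simp
    have h4 : ∀ t, (z (t + 1) i : ℂ) = ∑ j, (A i j : ℂ) * z t j + ∑ j, (B i j : ℂ) * u t j := by
      intro t
      have : z (t + 1) i = ∑ j, A i j * z t j + ∑ j, B i j * u t j := by
        simp [hz, resp, Matrix.toLpLin_apply, Matrix.mulVec, dotProduct]
      rw [this]; push_cast; rfl
    have h5 : ∀ (q : ℕ) (M : Fin q → ℝ) (x : ℕ → Fin q → ℝ),
        ∑ j, (M j : ℂ) * ∑ t ∈ Finset.range n, (e ^ t)⁻¹ * (x t j : ℂ)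
        = ∑ t ∈ Finset.range n, (e ^ t)⁻¹ * ∑ j, (M j : ℂ) * x t j := fun q M x => by
      simp only [Finset.mul_sum]
      rw [Finset.sum_comm]
      exact Finset.sum_congr rfl fun t _ => Finset.sum_congr rfl fun j _ => by ring
    simp only [Pi.sub_apply, Pi.smul_apply, smul_eq_mul, Matrix.mulVec, dotProduct, toComplex,
      Matrix.map_apply]
    rw [h5 d (A i) (fun t => z t), h5 p (B i) (fun t => u t), Finset.mul_sum, h1,
      ← Finset.sum_sub_distrib]
    refine Finset.sum_congr rfl fun t _ => ?_
    rw [h4]; ring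
  rw [← Matrix.mulVec_mulVec, ← key, Matrix.mulVec_mulVec, Matrix.nonsing_inv_mul _ hdet,
    Matrix.one_mulVec]

/-- Parseval's identity: orthogonality of the characters removes all products of states at different
times. -/
theorem inputCov_eq {A : Matrix (Fin d) (Fin d) ℝ}
    (hA : spectralRadius ℂ (toComplex A) < 1) (B : Matrix (Fin d) (Fin p) ℝ) {γ : ℝ} (hγ : 0 < γ)
    {n : ℕ} (hn : 1 ≤ n) (u : ℕ → EuclideanSpace ℝ (Fin p)) {y : EuclideanSpace ℝ (Fin d)}
    (hy : resp (stateMap A) (fun s => inputMap B (u s)) y n = y) :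
    γ ^ 2 • inputCov A B γ (fun i : Fin n => u i) = toComplex ((1 / (n : ℝ)) •
      ∑ t ∈ Finset.range n, Matrix.vecMulVec (resp (stateMap A) (fun s => inputMap B (u s)) y t).ofLp
        (resp (stateMap A) (fun s => inputMap B (u s)) y t).ofLp) := by
  have hT := transfer_mulVec_dft hA B hn u hy
  set z := resp (stateMap A) (fun s => inputMap B (u s)) y with hz
  have hζ := Complex.isPrimitiveRoot_exp n (by omega)
  have hen : ∀ ℓ : ℕ, ‖Complex.exp (2 * Real.pi * Complex.I / n) ^ ℓ‖ = 1 := fun ℓ =>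
    Complex.norm_eq_one_of_pow_eq_one (n := n) (by rw [pow_right_comm, hζ.pow_eq_one, one_pow])
      (by omega)
  have horth := fun s t (hs : s < n) (ht : t < n) => sum_root_mul hn hζ hs ht
  generalize Complex.exp (2 * Real.pi * Complex.I / n) = ζ at *
  have hstar : ∀ ℓ s : ℕ, star (((ζ ^ ℓ) ^ s)⁻¹) = (ζ ^ ℓ) ^ s := fun ℓ s => by
    have h1 : ‖(ζ ^ ℓ) ^ s‖ = 1 := by rw [norm_pow, hen, one_pow]
    rw [Complex.inv_eq_conj h1]
    exact Complex.conj_conj _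
  have hterm : ∀ ℓ : Fin n, transfer A B n ℓ * Matrix.vecMulVec (dft (fun i : Fin n => u i) ℓ)
      (star (dft (fun i : Fin n => u i) ℓ)) * (transfer A B n ℓ).conjTranspose
      = Matrix.vecMulVec ((transfer A B n ℓ).mulVec (dft (fun i : Fin n => u i) ℓ))
        (star ((transfer A B n ℓ).mulVec (dft (fun i : Fin n => u i) ℓ))) := fun ℓ => by
    rw [Matrix.mul_vecMulVec, Matrix.vecMulVec_mul, Matrix.star_mulVec]
  have hsum : ∑ ℓ : Fin n, Matrix.vecMulVec
      ((transfer A B n ℓ).mulVec (dft (fun i : Fin n => u i) ℓ))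
      (star ((transfer A B n ℓ).mulVec (dft (fun i : Fin n => u i) ℓ)))
      = (n : ℝ) • toComplex (∑ t ∈ Finset.range n, Matrix.vecMulVec (z t).ofLp (z t).ofLp) := by
    ext i j
    simp only [hT, Matrix.sum_apply, Matrix.vecMulVec_apply, Pi.star_apply, star_sum, star_mul',
      hstar, toComplex, Matrix.smul_apply, Matrix.map_apply, Finset.sum_mul_sum]
    rw [Finset.sum_comm]
    rw [Complex.ofReal_sum, Finset.smul_sum]
    refine Finset.sum_congr rfl fun t ht => ?_
    rw [Finset.sum_comm]
    have h1 : ∀ s ∈ Finset.range n, ∑ ℓ : Fin n, ((ζ ^ (ℓ : ℕ)) ^ t)⁻¹ * (z t i : ℂ)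
        * ((ζ ^ (ℓ : ℕ)) ^ s * star (z s j : ℂ))
        = if s = t then (n : ℂ) * (z t i * z s j) else 0 := fun s hs => by
      have h2 := horth s t (Finset.mem_range.1 hs) (Finset.mem_range.1 ht)
      calc _ = (∑ ℓ : Fin n, ((ζ ^ (ℓ : ℕ)) ^ t)⁻¹ * (ζ ^ (ℓ : ℕ)) ^ s) * (z t i * z s j) := by
            rw [Finset.sum_mul]
            refine Finset.sum_congr rfl fun ℓ _ => ?_
            simp; ring
        _ = _ := by rw [h2]; split_ifs <;> simp
    rw [Finset.sum_congr rfl h1, Finset.sum_ite_eq', if_pos ht]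
    simp
  rw [inputCov, Finset.sum_congr rfl fun ℓ _ => hterm ℓ, hsum, smul_smul, smul_smul]
  have hn0 : (n : ℝ) ≠ 0 := by exact_mod_cast (by omega : n ≠ 0)
  have h1 : γ ^ 2 * (1 / (γ ^ 2 * (n : ℝ) ^ 2)) * n = 1 / n := by field_simp
  rw [h1]
  ext i j
  simp [toComplex]

/-- The quadratic form of `Γ_n = ∑_{s<n} A^s (A^s)ᵀ`. -/
noncomputable def noiseForm (A : Matrix (Fin d) (Fin d) ℝ) (n : ℕ)
    (w : EuclideanSpace ℝ (Fin d)) : ℝ :=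
  ∑ s ∈ Finset.range n, ‖Matrix.toEuclideanLin (A ^ s).transpose w‖ ^ 2

theorem inner_toEuclideanLin (M : Matrix (Fin d) (Fin d) ℝ) (w x : EuclideanSpace ℝ (Fin d)) :
    inner ℝ w (Matrix.toEuclideanLin M x) = inner ℝ (Matrix.toEuclideanLin M.transpose w) x := by
  simp only [PiLp.inner_apply, Matrix.toLpLin_apply, Matrix.mulVec, dotProduct, RCLike.inner_apply,
    conj_trivial, Matrix.transpose_apply, Finset.sum_mul, Finset.mul_sum]
  rw [Finset.sum_comm]
  exact Finset.sum_congr rfl fun i _ => Finset.sum_congr rfl fun j _ => by ring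

theorem inner_noiseCov (A : Matrix (Fin d) (Fin d) ℝ) (n : ℕ) (w : EuclideanSpace ℝ (Fin d)) :
    inner ℝ w (Matrix.toEuclideanLin (noiseCov A n) w) = noiseForm A n w := by
  rw [noiseCov, noiseForm, map_sum, LinearMap.sum_apply, inner_sum]
  refine Finset.sum_congr rfl fun s _ => ?_
  have : Matrix.toEuclideanLin (A ^ s * (A ^ s).transpose) w
      = Matrix.toEuclideanLin (A ^ s) (Matrix.toEuclideanLin (A ^ s).transpose w) := by
    simp
  rw [this, inner_toEuclideanLin, real_inner_self_eq_norm_sq]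

theorem inner_vecMulVec (v w : EuclideanSpace ℝ (Fin d)) :
    inner ℝ w (Matrix.toEuclideanLin (Matrix.vecMulVec v.ofLp v.ofLp) w) = (inner ℝ w v) ^ 2 := by
  have : Matrix.toEuclideanLin (Matrix.vecMulVec v.ofLp v.ofLp) w = (inner ℝ w v) • v := by
    ext i
    simp only [Matrix.toLpLin_apply, Matrix.mulVec, dotProduct, Matrix.vecMulVec_apply,
      PiLp.smul_apply, smul_eq_mul, PiLp.inner_apply, RCLike.inner_apply, conj_trivial,
      Finset.sum_mul]
    exact Finset.sum_congr rfl fun j _ => by ring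
  rw [this, real_inner_smul_right]; ring

theorem le_lambdaMin_excitation_iff (hd : 1 ≤ d) {A : Matrix (Fin d) (Fin d) ℝ}
    (hA : spectralRadius ℂ (toComplex A) < 1) (B : Matrix (Fin d) (Fin p) ℝ) (σ : ℝ) {γ : ℝ}
    (hγ : 0 < γ) {n : ℕ} (hn : 1 ≤ n) (u : ℕ → EuclideanSpace ℝ (Fin p))
    {y : EuclideanSpace ℝ (Fin d)}
    (hy : resp (stateMap A) (fun s => inputMap B (u s)) y n = y) (c : ℝ) :
    c ≤ lambdaMin (σ ^ 2 • toComplex (noiseCov A n) + γ ^ 2 • inputCov A B γ (fun i : Fin n => u i))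
    ↔ ∀ w, c * ‖w‖ ^ 2 ≤ σ ^ 2 * noiseForm A n w + 1 / n * ∑ t ∈ Finset.range n,
        (inner ℝ w (resp (stateMap A) (fun s => inputMap B (u s)) y t)) ^ 2 := by
  rw [inputCov_eq hA B hγ hn u hy]
  set z := resp (stateMap A) (fun s => inputMap B (u s)) y
  have h1 : σ ^ 2 • toComplex (noiseCov A n) + toComplex ((1 / (n : ℝ)) •
      ∑ t ∈ Finset.range n, Matrix.vecMulVec (z t).ofLp (z t).ofLp)
      = toComplex (σ ^ 2 • noiseCov A n + (1 / (n : ℝ)) •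
      ∑ t ∈ Finset.range n, Matrix.vecMulVec (z t).ofLp (z t).ofLp) := by
    ext i j; simp [toComplex]
  have hs : (σ ^ 2 • noiseCov A n + (1 / (n : ℝ)) •
      ∑ t ∈ Finset.range n, Matrix.vecMulVec (z t).ofLp (z t).ofLp).IsSymm := by
    refine Matrix.IsSymm.add (Matrix.IsSymm.smul ?_ _) (Matrix.IsSymm.smul ?_ _)
    · rw [Matrix.IsSymm, noiseCov, Matrix.transpose_sum]
      refine Finset.sum_congr rfl fun s _ => ?_
      rw [Matrix.transpose_mul, Matrix.transpose_transpose]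
    · rw [Matrix.IsSymm, Matrix.transpose_sum]
      refine Finset.sum_congr rfl fun s _ => ?_
      rw [Matrix.transpose_vecMulVec]
  rw [h1, le_lambdaMin_toComplex_iff hd hs]
  refine forall_congr' fun w => ?_
  rw [map_add, map_smul, map_smul, map_sum, LinearMap.add_apply, LinearMap.smul_apply,
    LinearMap.smul_apply, LinearMap.sum_apply, inner_add_right, real_inner_smul_right,
    real_inner_smul_right, inner_sum, inner_noiseCov]
  simp only [inner_vecMulVec]

end Fourier

/-! ### The optimal excitation: attained maxima, the limit, and a bound for achievable forms. -/

section Excitation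

variable {d p : ℕ}

theorem isHermitian_excitation (A : Matrix (Fin d) (Fin d) ℝ) (B : Matrix (Fin d) (Fin p) ℝ)
    (σ γ : ℝ) {n : ℕ} (u : Fin n → EuclideanSpace ℝ (Fin p)) :
    (σ ^ 2 • toComplex (noiseCov A n) + γ ^ 2 • inputCov A B γ u).IsHermitian := by
  have hr : ∀ (r : ℝ) (M : Matrix (Fin d) (Fin d) ℂ), M.IsHermitian → (r • M).IsHermitian :=
    fun r M hM => by
      rw [Matrix.IsHermitian, Matrix.conjTranspose_smul, hM.eq, star_trivial]
  refine (hr _ _ ?_).add (hr _ _ (hr _ _ ?_))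
  · have h1 : (noiseCov A n).transpose = noiseCov A n := by
      rw [noiseCov, Matrix.transpose_sum]
      refine Finset.sum_congr rfl fun s _ => ?_
      rw [Matrix.transpose_mul, Matrix.transpose_transpose]
    ext i j
    have h2 : noiseCov A n j i = noiseCov A n i j := congrFun (congrFun h1 i) j
    simp [toComplex, Matrix.conjTranspose_apply, h2]
  · rw [Matrix.IsHermitian, Matrix.conjTranspose_sum]
    refine Finset.sum_congr rfl fun ℓ _ => ?_
    rw [Matrix.conjTranspose_mul, Matrix.conjTranspose_mul, Matrix.conjTranspose_conjTranspose,
      Matrix.conjTranspose_vecMulVec, star_star, Matrix.mul_assoc]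

theorem continuous_inputCov (A : Matrix (Fin d) (Fin d) ℝ) (B : Matrix (Fin d) (Fin p) ℝ)
    (γ : ℝ) (n : ℕ) : Continuous (inputCov A B γ (k := n)) := by
  have hdft : ∀ ℓ : Fin n, Continuous fun u : Fin n → EuclideanSpace ℝ (Fin p) => dft u ℓ := by
    intro ℓ
    unfold dft
    fun_prop
  have hsum : Continuous fun u : Fin n → EuclideanSpace ℝ (Fin p) => ∑ ℓ : Fin n,
      transfer A B n ℓ * Matrix.vecMulVec (dft u ℓ) (star (dft u ℓ)) *
        (transfer A B n ℓ).conjTranspose :=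
    continuous_finsetSum _ fun ℓ _ =>
      (continuous_const.matrix_mul ((hdft ℓ).matrix_vecMulVec
        (continuous_star.comp (hdft ℓ)))).matrix_mul continuous_const
  exact Continuous.const_smul hsum (1 / (γ ^ 2 * (n : ℝ) ^ 2))

theorem isCompact_powerBounded (p : ℕ) (γ : ℝ) {n : ℕ} (hn : 1 ≤ n) :
    IsCompact (powerBounded p γ n) := by
  have hn0 : (0 : ℝ) < n := by exact_mod_cast hn
  refine Metric.isCompact_of_isClosed_isBounded ?_ ?_
  · exact isClosed_le (by fun_prop) continuous_const
  · refine (Metric.isBounded_closedBall (x := 0) (r := √(n * γ ^ 2))).subset fun u hu => ?_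
    rw [mem_closedBall_zero_iff, pi_norm_le_iff_of_nonneg (Real.sqrt_nonneg _)]
    intro t
    refine Real.le_sqrt_of_sq_le ?_
    have h1 : 1 / (n : ℝ) * ∑ t, ‖u t‖ ^ 2 ≤ γ ^ 2 := hu
    rw [one_div, inv_mul_le_iff₀ hn0] at h1
    exact (Finset.single_le_sum (f := fun t => ‖u t‖ ^ 2) (fun _ _ => sq_nonneg _)
      (Finset.mem_univ t)).trans h1

theorem isGreatest_maxExcitation (hd : 1 ≤ d) (A : Matrix (Fin d) (Fin d) ℝ)
    (B : Matrix (Fin d) (Fin p) ℝ) (σ γ : ℝ) {n : ℕ} (hn : 1 ≤ n) :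
    IsGreatest (excitationValues A B σ γ n) (maxExcitation A B σ γ n) := by
  refine IsCompact.isGreatest_sSup ?_ ?_
  · refine (isCompact_powerBounded p γ hn).image ?_
    refine continuous_lambdaMin_comp hd ?_ (isHermitian_excitation A B σ γ)
    refine continuous_const.add ?_
    exact Continuous.const_smul (continuous_inputCov A B γ n) (γ ^ 2)
  · refine Set.Nonempty.image _ ⟨0, ?_⟩
    simp [powerBounded, sq_nonneg]

theorem noiseForm_mono (A : Matrix (Fin d) (Fin d) ℝ) (w : EuclideanSpace ℝ (Fin d)) {m n : ℕ}
    (h : m ≤ n) : noiseForm A m w ≤ noiseForm A n w :=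
  Finset.sum_le_sum_of_subset_of_nonneg (Finset.range_mono h) fun _ _ _ => sq_nonneg _

/-- The decay of the powers of `A` passes to their transposes by duality: with v = (A^s)ᵀw one has
‖v‖² = ⟨w, A^s v⟩ ≤ ‖w‖ K ρ^s ‖v‖. -/
theorem noiseForm_le {A : Matrix (Fin d) (Fin d) ℝ} {N : EuclideanSpace ℝ (Fin d) → ℝ} {ρ K : ℝ}
    (h : IsLyapunov (stateMap A) N ρ K) (n : ℕ) (w : EuclideanSpace ℝ (Fin d)) :
    noiseForm A n w ≤ K ^ 2 / (1 - ρ) * ‖w‖ ^ 2 := by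
  have hK := h.one_le
  have h1ρ : 0 < 1 - ρ := sub_pos.2 h.lt_one
  have hρ := h.pos
  have h1 : ∀ s, ‖Matrix.toEuclideanLin (A ^ s).transpose w‖ ^ 2 ≤ ρ ^ s * (K ^ 2 * ‖w‖ ^ 2) := by
    intro s
    set v := Matrix.toEuclideanLin (A ^ s).transpose w with hv
    have h2 : ‖v‖ ^ 2 = inner ℝ w ((stateMap A ^ s) v) := by
      rw [stateMap_pow, inner_toEuclideanLin, real_inner_self_eq_norm_sq]
    have h3 : ‖(stateMap A ^ s) v‖ ≤ ρ ^ s * (K * ‖v‖) :=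
      (h.norm_le _).trans ((h.pow_le s v).trans (by gcongr; exact h.le_norm v))
    have h4 : ‖v‖ * ‖v‖ ≤ (‖w‖ * (ρ ^ s * K)) * ‖v‖ := by
      calc ‖v‖ * ‖v‖ = inner ℝ w ((stateMap A ^ s) v) := by rw [← h2]; ring
        _ ≤ ‖w‖ * ‖(stateMap A ^ s) v‖ := real_inner_le_norm _ _
        _ ≤ ‖w‖ * (ρ ^ s * (K * ‖v‖)) := by gcongr
        _ = _ := by ring
    have h5 : ‖v‖ ≤ ‖w‖ * (ρ ^ s * K) := by
      rcases (norm_nonneg v).eq_or_lt with h0 | h0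
      · rw [← h0]; positivity
      · exact le_of_mul_le_mul_right h4 h0
    have h6 : ρ ^ s ≤ 1 := pow_le_one₀ hρ.le h.lt_one.le
    calc ‖v‖ ^ 2 ≤ (‖w‖ * (ρ ^ s * K)) ^ 2 := by gcongr
      _ = ρ ^ s * (ρ ^ s * (K ^ 2 * ‖w‖ ^ 2)) := by ring
      _ ≤ ρ ^ s * (1 * (K ^ 2 * ‖w‖ ^ 2)) := by gcongr
      _ = _ := by ring
  calc noiseForm A n w ≤ ∑ s ∈ Finset.range n, ρ ^ s * (K ^ 2 * ‖w‖ ^ 2) :=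
        Finset.sum_le_sum fun s _ => h1 s
    _ = (∑ s ∈ Finset.range n, ρ ^ s) * (K ^ 2 * ‖w‖ ^ 2) := by rw [Finset.sum_mul]
    _ ≤ 1 / (1 - ρ) * (K ^ 2 * ‖w‖ ^ 2) := by gcongr; exact h.geom_le n
    _ = _ := by ring

theorem exists_unit_vector (hd : 1 ≤ d) : ∃ w : EuclideanSpace ℝ (Fin d), ‖w‖ = 1 :=
  ⟨EuclideanSpace.single ⟨0, hd⟩ 1, by simp⟩

/-- The periodic extension of a signal of positive length. -/
theorem exists_periodic_extension {X : Type*} {n : ℕ} (hn : 1 ≤ n) (u : Fin n → X) :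
    ∃ v : ℕ → X, Function.Periodic v n ∧ (fun i : Fin n => v i) = u :=
  ⟨fun t => u ⟨t % n, Nat.mod_lt _ hn⟩, fun t => by simp,
    funext fun i => by simp [Nat.mod_eq_of_lt i.2]⟩

theorem restrict_mem_powerBounded_iff {γ : ℝ} {n : ℕ} (hn : 1 ≤ n)
    (u : ℕ → EuclideanSpace ℝ (Fin p)) : (fun i : Fin n => u i) ∈ powerBounded p γ n ↔
      ∑ t ∈ Finset.range n, ‖u t‖ ^ 2 ≤ γ ^ 2 * n := by
  have hn0 : (0 : ℝ) < n := by exact_mod_cast hn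
  change 1 / (n : ℝ) * ∑ t : Fin n, ‖u t‖ ^ 2 ≤ γ ^ 2 ↔ _
  rw [Fin.sum_univ_eq_sum_range (fun t => ‖u t‖ ^ 2), one_div, inv_mul_le_iff₀ hn0, mul_comm]

/-- A signal played twice has the same power and the same mean steady-state form, while Γ can only
grow. Hence the maxima increase along the periods 2^i. -/
theorem maxExcitation_le_mul_two (hd : 1 ≤ d) {A : Matrix (Fin d) (Fin d) ℝ}
    (hA : spectralRadius ℂ (toComplex A) < 1) (B : Matrix (Fin d) (Fin p) ℝ) (σ : ℝ) {γ : ℝ}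
    (hγ : 0 < γ) {n : ℕ} (hn : 1 ≤ n) :
    maxExcitation A B σ γ n ≤ maxExcitation A B σ γ (n * 2) := by
  have hn0 : (0 : ℝ) < n := by exact_mod_cast hn
  obtain ⟨N, ρ, K, h⟩ := exists_isLyapunov_stateMap hA
  obtain ⟨⟨u, hu, hval⟩, -⟩ := isGreatest_maxExcitation hd A B σ γ hn
  obtain ⟨v, hv, rfl⟩ := exists_periodic_extension hn u
  obtain ⟨y, hy⟩ := h.exists_periodic_init (fun s => inputMap B (v s)) hn
  have hb : Function.Periodic (fun s => inputMap B (v s)) n := hv.comp _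
  have hper := resp_periodic hb hy
  have hy2 : resp (stateMap A) (fun s => inputMap B (v s)) y (n * 2) = y := by
    rw [mul_two, hper, hy]
  rw [restrict_mem_powerBounded_iff hn] at hu
  have hu2 : (fun i : Fin (n * 2) => v i) ∈ powerBounded p γ (n * 2) := by
    rw [restrict_mem_powerBounded_iff (by omega),
      sum_range_mul_of_periodic (f := fun t => ‖v t‖ ^ 2) (hv.comp fun x => ‖x‖ ^ 2)]
    push_cast; linarith
  have h2 := (isGreatest_maxExcitation hd A B σ γ (n := n * 2) (by omega)).2
    (Set.mem_image_of_mem _ hu2)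
  refine le_trans ?_ h2
  have h3 := (le_lambdaMin_excitation_iff hd hA B σ hγ hn v hy _).1 hval.ge
  refine (le_lambdaMin_excitation_iff hd hA B σ hγ (by omega) v hy2 _).2 fun w => ?_
  refine (h3 w).trans ?_
  rw [sum_range_mul_of_periodic (f := fun t => (inner ℝ w
    (resp (stateMap A) (fun s => inputMap B (v s)) y t)) ^ 2) (hper.comp fun x => (inner ℝ w x) ^ 2)]
  have h4 := noiseForm_mono A w (by omega : n ≤ n * 2)
  have h5 : ∀ S : ℝ, 1 / ((n * 2 : ℕ) : ℝ) * ((2 : ℕ) * S) = 1 / n * S := fun S => by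
    push_cast; field_simp
  rw [h5]
  gcongr

theorem exists_maxExcitation_le (hd : 1 ≤ d) {A : Matrix (Fin d) (Fin d) ℝ}
    (hA : spectralRadius ℂ (toComplex A) < 1) (B : Matrix (Fin d) (Fin p) ℝ) (σ : ℝ) {γ : ℝ}
    (hγ : 0 < γ) : ∃ C, ∀ n, 1 ≤ n → maxExcitation A B σ γ n ≤ C := by
  obtain ⟨N, ρ, K, h⟩ := exists_isLyapunov_stateMap hA
  have h1ρ : 0 < 1 - ρ := sub_pos.2 h.lt_one
  obtain ⟨w, hw⟩ := exists_unit_vector hd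
  refine ⟨σ ^ 2 * (K ^ 2 / (1 - ρ)) + K ^ 2 / (1 - ρ) ^ 2 * (‖inputMap B‖ ^ 2 * γ ^ 2),
    fun n hn => ?_⟩
  have hn0 : (0 : ℝ) < n := by exact_mod_cast hn
  obtain ⟨⟨u, hu, hval⟩, -⟩ := isGreatest_maxExcitation hd A B σ γ hn
  obtain ⟨v, hv, rfl⟩ := exists_periodic_extension hn u
  obtain ⟨y, hy⟩ := h.exists_periodic_init (fun s => inputMap B (v s)) hn
  rw [restrict_mem_powerBounded_iff hn] at hu
  have h3 := (le_lambdaMin_excitation_iff hd hA B σ hγ hn v hy _).1 hval.ge w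
  rw [hw] at h3
  have h4 := noiseForm_le h n w
  rw [hw] at h4
  have h5 : ∑ t ∈ Finset.range n, (inner ℝ w
      (resp (stateMap A) (fun s => inputMap B (v s)) y t)) ^ 2
      ≤ K ^ 2 / (1 - ρ) ^ 2 * (‖inputMap B‖ ^ 2 * (γ ^ 2 * n)) := by
    calc _ ≤ ∑ t ∈ Finset.range n, N (resp (stateMap A) (fun s => inputMap B (v s)) y t) ^ 2 := by
          refine Finset.sum_le_sum fun t _ => ?_
          rw [← sq_abs]
          gcongr
          refine (abs_real_inner_le_norm _ _).trans ?_
          rw [hw, one_mul]; exact h.norm_le _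
      _ ≤ _ := h.sum_sq_resp_le_of_periodic _ hy
      _ ≤ K ^ 2 / (1 - ρ) ^ 2 * ∑ t ∈ Finset.range n, ‖inputMap B‖ ^ 2 * ‖v t‖ ^ 2 := by
          gcongr with t _
          rw [← mul_pow]; gcongr; exact (inputMap B).le_opNorm _
      _ ≤ _ := by rw [← Finset.mul_sum]; gcongr
  calc maxExcitation A B σ γ n
      ≤ σ ^ 2 * noiseForm A n w + 1 / n * ∑ t ∈ Finset.range n, (inner ℝ w
        (resp (stateMap A) (fun s => inputMap B (v s)) y t)) ^ 2 := by simpa using h3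
    _ ≤ σ ^ 2 * (K ^ 2 / (1 - ρ) * 1 ^ 2)
        + 1 / n * (K ^ 2 / (1 - ρ) ^ 2 * (‖inputMap B‖ ^ 2 * (γ ^ 2 * n))) := by gcongr
    _ = _ := by field_simp

theorem tendsto_maxExcitation (hd : 1 ≤ d) {A : Matrix (Fin d) (Fin d) ℝ}
    (hA : spectralRadius ℂ (toComplex A) < 1) (B : Matrix (Fin d) (Fin p) ℝ) (σ : ℝ) {γ : ℝ}
    (hγ : 0 < γ) :
    Tendsto (fun i : ℕ => maxExcitation A B σ γ (2 ^ i)) atTop (𝓝 (maxExcitationLimit A B σ γ)) ∧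
    ∀ i, maxExcitation A B σ γ (2 ^ i) ≤ maxExcitationLimit A B σ γ := by
  have hmono : Monotone fun i : ℕ => maxExcitation A B σ γ (2 ^ i) :=
    monotone_nat_of_le_succ fun i => by
      rw [pow_succ]; exact maxExcitation_le_mul_two hd hA B σ hγ Nat.one_le_two_pow
  obtain ⟨C, hC⟩ := exists_maxExcitation_le hd hA B σ hγ
  have hbdd : BddAbove (Set.range fun i : ℕ => maxExcitation A B σ γ (2 ^ i)) :=
    ⟨C, by rintro _ ⟨i, rfl⟩; exact hC _ Nat.one_le_two_pow⟩
  have ht := tendsto_atTop_ciSup hmono hbdd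
  have heq : maxExcitationLimit A B σ γ = ⨆ i : ℕ, maxExcitation A B σ γ (2 ^ i) := ht.limUnder_eq
  rw [heq]
  exact ⟨ht, fun i => le_ciSup hbdd i⟩

theorem sq_le_maxExcitationLimit (hd : 1 ≤ d) {A : Matrix (Fin d) (Fin d) ℝ}
    (hA : spectralRadius ℂ (toComplex A) < 1) (B : Matrix (Fin d) (Fin p) ℝ) (σ : ℝ) {γ : ℝ}
    (hγ : 0 < γ) : σ ^ 2 ≤ maxExcitationLimit A B σ γ := by
  obtain ⟨N, ρ, K, h⟩ := exists_isLyapunov_stateMap hA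
  refine le_trans ?_ ((tendsto_maxExcitation hd hA B σ hγ).2 0)
  obtain ⟨y, hy⟩ := h.exists_periodic_init
    (fun s => inputMap B ((fun _ => 0 : ℕ → EuclideanSpace ℝ (Fin p)) s)) le_rfl
  rw [pow_zero]
  have hu : (fun i : Fin 1 => (fun _ => 0 : ℕ → EuclideanSpace ℝ (Fin p)) i)
      ∈ powerBounded p γ 1 := by
    rw [restrict_mem_powerBounded_iff le_rfl (fun _ => 0)]; simp [sq_nonneg]
  refine le_trans ?_ ((isGreatest_maxExcitation hd A B σ γ le_rfl).2 (Set.mem_image_of_mem _ hu))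
  refine (le_lambdaMin_excitation_iff hd hA B σ hγ le_rfl _ hy _).2 fun w => ?_
  have h1 : noiseForm A 1 w = ‖w‖ ^ 2 := by simp [noiseForm]
  rw [h1]
  exact le_add_of_nonneg_right (by positivity)

/-- Otherwise every direction is excited above Λ + θ. Realizing `Q` on a horizon 2^i and passing to
the periodic orbit of the same signal would then give an admissible periodic input with minimum
eigenvalue at least Λ + θ/2, although the maximum at period 2^i is at most Λ. -/
theorem exists_noiseForm_add_le_of_achievable (hd : 1 ≤ d) {A : Matrix (Fin d) (Fin d) ℝ}
    (hA : spectralRadius ℂ (toComplex A) < 1) (B : Matrix (Fin d) (Fin p) ℝ) (σ : ℝ) {γ : ℝ}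
    (hγ : 0 < γ) {Q : EuclideanSpace ℝ (Fin d) →L[ℝ] EuclideanSpace ℝ (Fin d)}
    (hQ : Q ∈ achievable (stateMap A) (inputMap B) γ) (m : ℕ) {θ : ℝ} (hθ : 0 < θ) :
    ∃ w : EuclideanSpace ℝ (Fin d), ‖w‖ = 1 ∧
      σ ^ 2 * noiseForm A m w + inner ℝ (Q w) w ≤ maxExcitationLimit A B σ γ + θ := by
  obtain ⟨N, ρ, K, h⟩ := exists_isLyapunov_stateMap hA
  have h1ρ : 0 < 1 - ρ := sub_pos.2 h.lt_one
  have hK := h.one_le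
  by_contra! hcon
  set Λ := maxExcitationLimit A B σ γ
  have hall : ∀ w, (Λ + θ) * ‖w‖ ^ 2 ≤ σ ^ 2 * noiseForm A m w + inner ℝ (Q w) w := by
    intro w
    rcases eq_or_ne w 0 with rfl | hw
    · simp [noiseForm]
    have hw0 : ‖w‖ ≠ 0 := norm_ne_zero_iff.2 hw
    have h1 := hcon (‖w‖⁻¹ • w) (by rw [norm_smul, norm_inv, norm_norm, inv_mul_cancel₀ hw0])
    have h2 : noiseForm A m (‖w‖⁻¹ • w) = ‖w‖⁻¹ ^ 2 * noiseForm A m w := by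
      simp only [noiseForm, map_smul, norm_smul, norm_inv, norm_norm, mul_pow, Finset.mul_sum]
    rw [h2, map_smul, real_inner_smul_left, real_inner_smul_right] at h1
    have h3 : σ ^ 2 * (‖w‖⁻¹ ^ 2 * noiseForm A m w) + ‖w‖⁻¹ * (‖w‖⁻¹ * inner ℝ (Q w) w)
        = (σ ^ 2 * noiseForm A m w + inner ℝ (Q w) w) / ‖w‖ ^ 2 := by field_simp
    rw [h3, lt_div_iff₀ (by positivity)] at h1
    exact h1.le
  obtain ⟨C, hC, n₀, H⟩ := hQ (θ / 4) (by positivity)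
  set D := K * (‖inputMap B‖ * C) / (1 - ρ) with hD
  have hD0 : 0 ≤ D := by positivity
  set R := 2 * D * (D / (1 - ρ) / (1 - ρ)) with hR
  -- The period must realize `Q` up to θ/4, exceed `m` so that Γ dominates, and make the change of
  -- initial state cost at most another θ/4.
  obtain ⟨i, hi⟩ : ∃ i : ℕ, n₀ + m + ⌈R / (θ / 4)⌉₊ ≤ 2 ^ i := ⟨_, Nat.lt_two_pow_self.le⟩
  have hn1 : 1 ≤ 2 ^ i := Nat.one_le_two_pow
  have hlim := (tendsto_maxExcitation hd hA B σ hγ).2 i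
  generalize 2 ^ i = n at hi hn1 hlim
  have hn0 : (0 : ℝ) < n := by exact_mod_cast hn1
  have hRn : R / (θ / 4) ≤ n := Nat.ceil_le.1 (by omega)
  rw [div_le_iff₀ (by positivity)] at hRn
  obtain ⟨u, huC, hupow, huQ⟩ := H n (by omega)
  obtain ⟨y, hy⟩ := h.exists_periodic_init (fun s => inputMap B (u s)) hn1
  have hbC : ∀ t < n, ‖inputMap B (u t)‖ ≤ ‖inputMap B‖ * C := fun t _ =>
    ((inputMap B).le_opNorm _).trans (by gcongr; exact huC t)
  have hN0 : N 0 = 0 := le_antisymm (by simpa using h.le_norm 0) (h.nonneg 0)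
  have hNy : N y ≤ D / (1 - ρ) := by
    have h1 := h.resp_le (by positivity) hbC y n le_rfl
    rw [hy] at h1
    have h2 : ρ ^ n ≤ ρ := pow_le_of_le_one h.pos.le h.lt_one.le (by omega)
    have h3 : ρ ^ n * N y ≤ ρ * N y := by have := h.nonneg y; gcongr
    rw [le_div_iff₀ h1ρ]
    linarith
  have hvD : ∀ t < n, ‖resp (stateMap A) (fun s => inputMap B (u s)) 0 t‖ ≤ D := fun t ht => by
    have h1 := h.resp_le (by positivity) hbC 0 t ht.le
    rw [hN0, mul_zero, zero_add] at h1
    exact (h.norm_le _).trans h1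
  have hup : (fun i : Fin n => u i) ∈ powerBounded p γ n := by
    rwa [restrict_mem_powerBounded_iff hn1]
  have hle := ((isGreatest_maxExcitation hd A B σ γ hn1).2 (Set.mem_image_of_mem _ hup)).trans hlim
  have hge : Λ + θ / 2 ≤ lambdaMin (σ ^ 2 • toComplex (noiseCov A n)
      + γ ^ 2 • inputCov A B γ (fun i : Fin n => u i)) := by
    refine (le_lambdaMin_excitation_iff hd hA B σ hγ hn1 u hy _).2 fun w => ?_
    have h1 := h.sum_inner_sq_ge hD0 hvD y w
    have h2 : ∀ t, resp (stateMap A) (fun s => inputMap B (u s)) 0 t + (stateMap A ^ t) y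
        = resp (stateMap A) (fun s => inputMap B (u s)) y t := fun t => by
      rw [← resp_add_init, zero_add]
    simp only [h2] at h1
    have h3 : 2 * D * (N y / (1 - ρ)) * ‖w‖ ^ 2 ≤ n * (θ / 4) * ‖w‖ ^ 2 := by
      refine mul_le_mul_of_nonneg_right (le_trans ?_ hRn) (sq_nonneg _)
      rw [hR]; gcongr
    have h4 := huQ w
    have h5 : (n : ℝ) * (inner ℝ (Q w) w - θ / 2 * ‖w‖ ^ 2) ≤ ∑ t ∈ Finset.range n, (inner ℝ w
      (resp (stateMap A) (fun s => inputMap B (u s)) y t)) ^ 2 := by linarith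
    have h6 : inner ℝ (Q w) w - θ / 2 * ‖w‖ ^ 2 ≤ 1 / n * ∑ t ∈ Finset.range n, (inner ℝ w
      (resp (stateMap A) (fun s => inputMap B (u s)) y t)) ^ 2 := by
      rw [one_div, le_inv_mul_iff₀ hn0]; exact h5
    have h7 : σ ^ 2 * noiseForm A m w ≤ σ ^ 2 * noiseForm A n w := by
      gcongr; exact noiseForm_mono A w (by omega)
    have h8 := hall w
    linarith
  linarith

end Excitation

/-! ### Shifts and second moments of the Gaussian noise. -/

section Gaussian

open scoped NNReal ENNReal

theorem gaussianReal_eq_withDensity (a : ℝ) {v : ℝ≥0} (hv : v ≠ 0) :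
    gaussianReal a v = (gaussianReal 0 v).withDensity
      (fun x => ENNReal.ofReal (Real.exp (a * x / v - a ^ 2 / (2 * v)))) := by
  have hv0 : (v : ℝ) ≠ 0 := by exact_mod_cast hv
  rw [gaussianReal_of_var_ne_zero _ hv, gaussianReal_of_var_ne_zero _ hv,
    ← withDensity_mul _ (measurable_gaussianPDF 0 v) (by fun_prop)]
  congr 1
  funext x
  rw [Pi.mul_apply, gaussianPDF, gaussianPDF, ← ENNReal.ofReal_mul (gaussianPDFReal_nonneg _ _ _),
    gaussianPDFReal, gaussianPDFReal, mul_assoc (√(2 * Real.pi * v))⁻¹, ← Real.exp_add]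
  congr 3
  field_simp
  ring

/-- It suffices to compare boxes, on which the density is a product of functions of independent
coordinates. -/
theorem pi_withDensity {ι : Type*} [Fintype ι] {X : ι → Type*} [∀ i, MeasurableSpace (X i)]
    (μ : ∀ i, Measure (X i)) [∀ i, IsProbabilityMeasure (μ i)] (f : ∀ i, X i → ℝ≥0∞)
    (hf : ∀ i, Measurable (f i)) [∀ i, SigmaFinite ((μ i).withDensity (f i))] :
    Measure.pi (fun i => (μ i).withDensity (f i))
      = (Measure.pi μ).withDensity fun x => ∏ i, f i (x i) := by
  refine Measure.pi_eq fun s hs => ?_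
  rw [withDensity_apply _ (MeasurableSet.univ_pi hs), ← lintegral_indicator (MeasurableSet.univ_pi hs)]
  have h1 : (fun x : ∀ i, X i => (Set.univ.pi s).indicator (fun x => ∏ i, f i (x i)) x)
      = fun x => ∏ i, (s i).indicator (f i) (x i) := by
    funext x
    by_cases hx : x ∈ Set.univ.pi s
    · rw [Set.indicator_of_mem hx]
      exact Finset.prod_congr rfl fun i _ => by rw [Set.indicator_of_mem (hx i (Set.mem_univ i))]
    · rw [Set.indicator_of_notMem hx]
      simp only [Set.mem_pi, Set.mem_univ, true_imp_iff, not_forall] at hx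
      obtain ⟨i, hi⟩ := hx
      exact (Finset.prod_eq_zero (Finset.mem_univ i) (Set.indicator_of_notMem hi _)).symm
  have hm : ∀ i, Measurable ((s i).indicator (f i)) := fun i => (hf i).indicator (hs i)
  rw [h1, lintegral_prod_eq_prod_lintegral_of_indepFun Finset.univ
    (fun i (x : ∀ i, X i) => (s i).indicator (f i) (x i))
    (iIndepFun_pi fun i => (hm i).aemeasurable) fun i => (hm i).comp (measurable_pi_apply i)]
  refine Finset.prod_congr rfl fun i _ => ?_
  rw [(measurePreserving_eval μ i).lintegral_comp (hm i), lintegral_indicator (hs i),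
    withDensity_apply _ (hs i)]

variable {d : ℕ}

/-- The law `N(0, σ² I)` of the noise at one time. -/
noncomputable abbrev noiseLaw (d : ℕ) (σ : ℝ) : Measure (EuclideanSpace ℝ (Fin d)) :=
  multivariateGaussian 0 (σ ^ 2 • (1 : Matrix (Fin d) (Fin d) ℝ))

theorem posSemidef_smul_one (σ : ℝ) : (σ ^ 2 • (1 : Matrix (Fin d) (Fin d) ℝ)).PosSemidef :=
  Matrix.PosSemidef.one.smul (sq_nonneg σ)

theorem noiseLaw_eq_map_pi (σ : ℝ) : noiseLaw d σ
    = (Measure.pi fun _ : Fin d => gaussianReal 0 (σ ^ 2).toNNReal).map (WithLp.toLp 2) := by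
  have : IsProbabilityMeasure ((Measure.pi fun _ : Fin d =>
      gaussianReal 0 (σ ^ 2).toNNReal).map (WithLp.toLp 2)) :=
    Measure.isProbabilityMeasure_map (by fun_prop)
  apply Measure.ext_of_charFun (E := EuclideanSpace ℝ (Fin d))
  ext t
  rw [charFun_multivariateGaussian (posSemidef_smul_one σ)]
  simp_rw [charFun_pi, charFun_gaussianReal, ← Complex.exp_sum]
  congr 1
  simp [Real.coe_toNNReal _ (sq_nonneg σ), Matrix.smul_mulVec, dotProduct,
    Finset.sum_div, ← Finset.sum_neg_distrib]
  exact Finset.sum_congr rfl fun i _ => by ring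

/-- The Cameron–Martin formula, obtained coordinatewise from the ratio of one-dimensional Gaussian
densities. -/
theorem lintegral_noiseLaw_add {σ : ℝ} (hσ : 0 < σ) (a : EuclideanSpace ℝ (Fin d))
    {g : EuclideanSpace ℝ (Fin d) → ℝ≥0∞} (hg : Measurable g) :
    ∫⁻ e, g (e + a) ∂(noiseLaw d σ) = ∫⁻ e, ENNReal.ofReal (Real.exp
      (inner ℝ a e / σ ^ 2 - ‖a‖ ^ 2 / (2 * σ ^ 2))) * g e ∂(noiseLaw d σ) := by
  set v := (σ ^ 2).toNNReal with hv
  have hv0 : v ≠ 0 := by rw [hv]; simp [hσ.ne']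
  have hvσ : (v : ℝ) = σ ^ 2 := Real.coe_toNNReal _ (sq_nonneg σ)
  rw [noiseLaw_eq_map_pi, ← hv, lintegral_map (by fun_prop) (by fun_prop),
    lintegral_map (by fun_prop) (by fun_prop)]
  have h1 : (Measure.pi fun _ : Fin d => gaussianReal 0 v).map (fun x i => x i + a i)
      = (Measure.pi fun _ : Fin d => gaussianReal 0 v).withDensity fun x =>
        ∏ i, ENNReal.ofReal (Real.exp (a i * x i / v - a i ^ 2 / (2 * v))) := by
    rw [Measure.pi_map_pi (f := fun i x => x + a i) fun i => by fun_prop]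
    have h2 : ∀ i, (gaussianReal 0 v).map (fun x => x + a i) = (gaussianReal 0 v).withDensity
        (fun x => ENNReal.ofReal (Real.exp (a i * x / v - a i ^ 2 / (2 * v)))) := fun i => by
      rw [← gaussianReal_eq_withDensity _ hv0, gaussianReal_map_add_const, zero_add]
    have h3 : ∀ i, SigmaFinite ((gaussianReal 0 v).withDensity
        (fun x => ENNReal.ofReal (Real.exp (a i * x / v - a i ^ 2 / (2 * v))))) := fun i => by
      rw [← gaussianReal_eq_withDensity _ hv0]; infer_instance
    simp_rw [h2]
    rw [pi_withDensity (fun _ => gaussianReal 0 v) _ fun i => by fun_prop]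
  have h4 : ∫⁻ x, g (WithLp.toLp 2 x + a) ∂(Measure.pi fun _ : Fin d => gaussianReal 0 v)
      = ∫⁻ x, g (WithLp.toLp 2 x)
        ∂((Measure.pi fun _ : Fin d => gaussianReal 0 v).map (fun x i => x i + a i)) := by
    rw [lintegral_map (by fun_prop) (by fun_prop)]
    rfl
  rw [h4, h1, lintegral_withDensity_eq_lintegral_mul _ (by fun_prop) (by fun_prop)]
  refine lintegral_congr fun x => ?_
  rw [Pi.mul_apply, ← ENNReal.ofReal_prod_of_nonneg fun i _ => (Real.exp_pos _).le, ← Real.exp_sum]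
  congr 3
  rw [Finset.sum_sub_distrib, ← Finset.sum_div, ← Finset.sum_div, hvσ,
    EuclideanSpace.real_norm_sq_eq]
  simp [PiLp.inner_apply, mul_comm]

theorem memLp_noiseLaw (σ : ℝ) : MemLp (fun e : EuclideanSpace ℝ (Fin d) => e) 2 (noiseLaw d σ) :=
  IsGaussian.memLp_two_id

theorem integral_inner_sq_noiseLaw (σ : ℝ) (w : EuclideanSpace ℝ (Fin d)) :
    ∫ e, (inner ℝ w e) ^ 2 ∂(noiseLaw d σ) = σ ^ 2 * ‖w‖ ^ 2 := by
  have h1 := covarianceBilin_multivariateGaussian (μ := 0) (posSemidef_smul_one σ) w w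
  rw [covarianceBilin_apply (memLp_noiseLaw σ)] at h1
  simp only [integral_id_multivariateGaussian', sub_zero] at h1
  rw [EuclideanSpace.real_norm_sq_eq]
  have h2 : w.ofLp ⬝ᵥ (σ ^ 2 • (1 : Matrix (Fin d) (Fin d) ℝ)).mulVec w.ofLp
      = σ ^ 2 * ∑ i, w i ^ 2 := by
    rw [Matrix.smul_mulVec, Matrix.one_mulVec, dotProduct_smul, smul_eq_mul]
    simp [dotProduct, sq]
  rw [h2] at h1
  rw [← h1]
  exact integral_congr_ae (ae_of_all _ fun e => by ring)

end Gaussian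

/-! ### Relative entropy and testing error. -/

section ChangeOfMeasure

/-- A form of the Bretagnolle–Huber inequality. -/
theorem log_le_neg_integral {Ω : Type*} [MeasurableSpace Ω] {P : Measure Ω} [IsProbabilityMeasure P]
    {L : Ω → ℝ} (hL : Integrable L P) (hexp : Integrable (fun ω => Real.exp (L ω)) P)
    (hexp1 : ∫ ω, Real.exp (L ω) ∂P = 1) {S : Set Ω} (hS : MeasurableSet S) {δ : ℝ} (hδ : 0 < δ)
    (h1 : ∫ ω in S, Real.exp (L ω) ∂P ≤ δ) (h2 : P.real Sᶜ ≤ δ) :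
    Real.log (1 / (4 * δ)) ≤ -∫ ω, L ω ∂P := by
  set q := √δ with hq
  have hq0 : 0 < q := Real.sqrt_pos.2 hδ
  have hqδ : q ^ 2 = δ := Real.sq_sqrt hδ.le
  set c := (∫ ω, L ω ∂P) / 2 with hc
  -- The tangent of exp at the mean `c` of L/2; integrating it gives Jensen's inequality exp c ≤ E
  -- exp(L/2).
  have hlow : ∀ ω, Real.exp c * (1 + L ω / 2 - c) ≤ Real.exp (L ω / 2) := fun ω => by
    have h3 := Real.add_one_le_exp (L ω / 2 - c)
    calc _ ≤ Real.exp c * Real.exp (L ω / 2 - c) := by gcongr; linarith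
      _ = _ := by rw [← Real.exp_add]; congr 1; ring
  -- AM–GM for exp(L/2), with weights adapted to the side that is rare: exp L has small mass on `S`,
  -- and `P` has small mass off `S`. With q = √δ the integral is at most 2q, and squaring gives 4δ.
  set F : Ω → ℝ := fun ω => S.indicator (fun ω => 1 / 2 * (Real.exp (L ω) / q + q)) ω
    + Sᶜ.indicator (fun ω => 1 / 2 * (Real.exp (L ω) * q + 1 / q)) ω with hF
  have hup : ∀ ω, Real.exp (L ω / 2) ≤ F ω := fun ω => by
    have h3 : Real.exp (L ω) = Real.exp (L ω / 2) ^ 2 := by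
      rw [← Real.exp_nat_mul]; congr 1; push_cast; ring
    simp only [hF]
    by_cases hω : ω ∈ S
    · rw [Set.indicator_of_mem hω, Set.indicator_of_notMem (by simpa using hω), add_zero, h3]
      have h4 : 0 ≤ (Real.exp (L ω / 2) - q) ^ 2 / q := by positivity
      have h5 : (Real.exp (L ω / 2) - q) ^ 2 / q
          = Real.exp (L ω / 2) ^ 2 / q + q - 2 * Real.exp (L ω / 2) := by field_simp; ring
      linarith
    · rw [Set.indicator_of_notMem hω, Set.indicator_of_mem (by simpa using hω), zero_add, h3]
      have h4 : 0 ≤ (Real.exp (L ω / 2) * q - 1) ^ 2 / q := by positivity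
      have h5 : (Real.exp (L ω / 2) * q - 1) ^ 2 / q
          = Real.exp (L ω / 2) ^ 2 * q + 1 / q - 2 * Real.exp (L ω / 2) := by field_simp; ring
      linarith
  have hi1 : Integrable (fun ω => 1 / 2 * (Real.exp (L ω) / q + q)) P := by fun_prop
  have hi2 : Integrable (fun ω => 1 / 2 * (Real.exp (L ω) * q + 1 / q)) P := by fun_prop
  have hchain : ∫ ω, Real.exp c * (1 + L ω / 2 - c) ∂P ≤ ∫ ω, F ω ∂P :=
    integral_mono (by fun_prop) ((hi1.indicator hS).add (hi2.indicator hS.compl))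
      fun ω => (hlow ω).trans (hup ω)
  have hl : ∫ ω, Real.exp c * (1 + L ω / 2 - c) ∂P = Real.exp c := by
    rw [integral_const_mul, integral_sub (by fun_prop) (by fun_prop),
      integral_add (by fun_prop) (by fun_prop), integral_div, integral_const, integral_const]
    simp [← hc]
  have hr : ∫ ω, F ω ∂P = 1 / 2 * ((∫ ω in S, Real.exp (L ω) ∂P) / q + P.real S * q)
      + 1 / 2 * ((∫ ω in Sᶜ, Real.exp (L ω) ∂P) * q + P.real Sᶜ * (1 / q)) := by
    simp only [hF]
    rw [integral_add (hi1.indicator hS) (hi2.indicator hS.compl), integral_indicator hS,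
      integral_indicator hS.compl, integral_const_mul, integral_const_mul,
      integral_add (hexp.integrableOn.div_const q) (integrable_const _),
      integral_add (hexp.integrableOn.mul_const q) (integrable_const _), integral_div,
      integral_mul_const, integral_const, integral_const]
    simp
  have h3 : ∫ ω in Sᶜ, Real.exp (L ω) ∂P ≤ 1 := by
    rw [← hexp1]
    exact setIntegral_le_integral hexp (ae_of_all _ fun ω => (Real.exp_pos _).le)
  have h4 : P.real S ≤ 1 := measureReal_le_one
  have h5 : Real.exp c ≤ 2 * q := by
    rw [hl, hr] at hchain
    refine hchain.trans ?_
    calc _ ≤ 1 / 2 * (δ / q + 1 * q) + 1 / 2 * (1 * q + δ * (1 / q)) := by gcongr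
      _ = 2 * q := by rw [← hqδ]; field_simp; ring
  have h6 : Real.exp (∫ ω, L ω ∂P) ≤ 4 * δ := by
    have : Real.exp (∫ ω, L ω ∂P) = Real.exp c ^ 2 := by
      rw [← Real.exp_nat_mul, hc]; congr 1; push_cast; ring
    rw [this]
    calc _ ≤ (2 * q) ^ 2 := by gcongr
      _ = 4 * δ := by rw [← hqδ]; ring
  rw [one_div, Real.log_inv]
  have h7 := (Real.le_log_iff_exp_le (by positivity)).2 h6
  linarith

end ChangeOfMeasure

/-! ### Independence of the current noise from the past. -/

section Truncation

open scoped ENNReal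

variable {S E : Type*} [MeasurableSpace S] [MeasurableSpace E]

/-- The sample with the noise from time `t` on replaced by zero. -/
noncomputable def truncate [Zero E] (t : ℕ) (ω : S × (ℕ → E)) : S × (ℕ → E) :=
  (ω.1, fun i => if i < t then ω.2 i else 0)

theorem measurable_truncate [Zero E] (t : ℕ) : Measurable (truncate t : S × (ℕ → E) → S × (ℕ → E)) := by
  refine measurable_fst.prodMk (measurable_pi_lambda _ fun i => ?_)
  by_cases h : i < t
  · simp only [h, if_true]; fun_prop
  · simp only [h, if_false]; fun_prop

/-- Disjoint sets of noise coordinates are independent; the seed is then adjoined by associativity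
of product measures. Truncation serves in place of a filtration: a quantity depends only on the past
when truncation leaves it unchanged. -/
theorem indepFun_truncate [Zero E] (μ : Measure S) [IsProbabilityMeasure μ] (ν : Measure E)
    [IsProbabilityMeasure ν] (t : ℕ) :
    IndepFun (truncate t) (fun ω : S × (ℕ → E) => ω.2 t)
      (μ.prod (Measure.infinitePi fun _ : ℕ => ν)) := by
  set π := Measure.infinitePi fun _ : ℕ => ν with hπ
  set g : (ℕ → E) → (ℕ → E) := fun e i => if i < t then e i else 0 with hg
  have hgm : Measurable g := by
    refine measurable_pi_lambda _ fun i => ?_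
    by_cases h : i < t
    · simp only [hg, h, if_true]; fun_prop
    · simp only [hg, h, if_false]; fun_prop
  have h1 : IndepFun g (fun e : ℕ → E => e t) π := by
    have h2 : iIndepFun (fun i (e : ℕ → E) => e i) π :=
      iIndepFun_infinitePi (X := fun _ e => e) fun _ => measurable_id
    have h3 := h2.indepFun_finset (Finset.range t) {t} (by simp) fun i => measurable_pi_apply i
    refine h3.comp (φ := fun x : Finset.range t → E => fun i : ℕ =>
      if h : i < t then x ⟨i, Finset.mem_range.2 h⟩ else 0)
      (ψ := fun x : ({t} : Finset ℕ) → E => x ⟨t, by simp⟩) ?_ (by fun_prop) |>.congr ?_ ?_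
    · refine measurable_pi_lambda _ fun i => ?_
      by_cases h : i < t
      · simp only [h, dif_pos]; fun_prop
      · simp only [h, dif_neg, not_false_eq_true]; fun_prop
    · exact ae_of_all _ fun e => by funext i; simp [hg]
    · exact ae_of_all _ fun e => rfl
  rw [indepFun_iff_map_prod_eq_prod_map_map hgm.aemeasurable
    (measurable_pi_apply t).aemeasurable] at h1
  rw [indepFun_iff_map_prod_eq_prod_map_map (measurable_truncate t).aemeasurable (by fun_prop)]
  have hev : Measurable fun e : ℕ → E => e t := measurable_pi_apply t
  have h2 : (μ.prod π).map (fun ω => (truncate t ω, ω.2 t))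
      = ((μ.prod π).map (Prod.map id fun e => (g e, e t))).map MeasurableEquiv.prodAssoc.symm := by
    rw [Measure.map_map (by fun_prop) (by fun_prop)]
    rfl
  have h3 : (μ.prod π).map (truncate t) = μ.prod (π.map g) := by
    rw [← Measure.map_id (μ := μ), Measure.map_prod_map _ _ measurable_id hgm]
    simp only [Measure.map_id]
    rfl
  have h4 : (μ.prod π).map (fun ω : S × (ℕ → E) => ω.2 t) = π.map fun e => e t := by
    rw [← (measurePreserving_snd (μ := μ) (ν := π)).map_eq, Measure.map_map hev measurable_snd]
    rw [(measurePreserving_snd (μ := μ) (ν := π)).map_eq]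
    rfl
  have : IsProbabilityMeasure (π.map g) := Measure.isProbabilityMeasure_map hgm.aemeasurable
  have : IsProbabilityMeasure (π.map fun e => e t) :=
    Measure.isProbabilityMeasure_map hev.aemeasurable
  rw [h2, ← Measure.map_prod_map _ _ measurable_id (by fun_prop), Measure.map_id, h1, h3, h4]
  rw [← (measurePreserving_prodAssoc μ (π.map g) (π.map fun e => e t)).map_eq,
    Measure.map_map (by fun_prop) (by fun_prop)]
  simp

theorem map_noise_eval (μ : Measure S) [IsProbabilityMeasure μ] (ν : Measure E)
    [IsProbabilityMeasure ν] (t : ℕ) :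
    (μ.prod (Measure.infinitePi fun _ : ℕ => ν)).map (fun ω : S × (ℕ → E) => ω.2 t) = ν := by
  have h1 : (fun ω : S × (ℕ → E) => ω.2 t) = (fun e : ℕ → E => e t) ∘ Prod.snd := rfl
  rw [h1, ← Measure.map_map (measurable_pi_apply t) measurable_snd,
    (measurePreserving_snd (μ := μ)).map_eq, Measure.infinitePi_map_eval]

/-- The noise at time `t` may be integrated separately when the rest depends on the past. -/
theorem lintegral_noise_eq [Zero E] (μ : Measure S) [IsProbabilityMeasure μ] (ν : Measure E)
    [IsProbabilityMeasure ν] (t : ℕ) {F : S × (ℕ → E) → E → ℝ≥0∞}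
    (hF : Measurable (Function.uncurry F)) (hFt : ∀ ω e, F (truncate t ω) e = F ω e) :
    ∫⁻ ω, F ω (ω.2 t) ∂(μ.prod (Measure.infinitePi fun _ : ℕ => ν))
      = ∫⁻ ω, ∫⁻ e, F ω e ∂ν ∂(μ.prod (Measure.infinitePi fun _ : ℕ => ν)) := by
  set P := μ.prod (Measure.infinitePi fun _ : ℕ => ν)
  have hev : Measurable fun ω : S × (ℕ → E) => ω.2 t := by fun_prop
  have h1 := (indepFun_iff_map_prod_eq_prod_map_map (measurable_truncate t).aemeasurable
    hev.aemeasurable).1 (indepFun_truncate μ ν t)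
  have : IsProbabilityMeasure (P.map (truncate t)) :=
    Measure.isProbabilityMeasure_map (measurable_truncate t).aemeasurable
  calc ∫⁻ ω, F ω (ω.2 t) ∂P = ∫⁻ ω, Function.uncurry F (truncate t ω, ω.2 t) ∂P :=
        lintegral_congr fun ω => (hFt ω _).symm
    _ = ∫⁻ z, Function.uncurry F z ∂(P.map fun ω => (truncate t ω, ω.2 t)) :=
        (lintegral_map hF ((measurable_truncate t).prodMk hev)).symm
    _ = ∫⁻ ω, ∫⁻ e, F ω e ∂ν ∂(P.map (truncate t)) := by
        rw [h1, map_noise_eval, lintegral_prod _ hF.aemeasurable]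
        rfl
    _ = ∫⁻ ω, ∫⁻ e, F (truncate t ω) e ∂ν ∂P :=
        lintegral_map hF.lintegral_prod_right' (measurable_truncate t)
    _ = _ := by simp only [hFt]

end Truncation

/-! ### The closed loop and its likelihood ratio. -/

section ClosedLoop

open scoped ENNReal

variable {d p : ℕ} (alg : Algorithm.{w} d p) (A : Matrix (Fin d) (Fin d) ℝ)
  (B : Matrix (Fin d) (Fin p) ℝ) (x₀ : EuclideanSpace ℝ (Fin d))

instance (σ : ℝ) : IsProbabilityMeasure (alg.law σ) := by unfold Algorithm.law; infer_instance

/-- The state `x_t` of the closed loop. -/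
noncomputable def Algorithm.state (t : ℕ) (ω : alg.Sample) : EuclideanSpace ℝ (Fin d) :=
  alg.history A B x₀ ω t (Fin.last t)

theorem Algorithm.history_congr {ω ω' : alg.Sample} {t : ℕ} (h1 : ω.1 = ω'.1)
    (h2 : ∀ s < t, ω.2 s = ω'.2 s) : alg.history A B x₀ ω t = alg.history A B x₀ ω' t := by
  induction t with
  | zero => rfl
  | succ t ih =>
    simp only [Algorithm.history]
    rw [ih fun s hs => h2 s (by omega), h1, h2 t (by omega)]

theorem Algorithm.history_truncate {s t : ℕ} (hst : s ≤ t) (ω : alg.Sample) :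
    alg.history A B x₀ (truncate t ω) s = alg.history A B x₀ ω s :=
  alg.history_congr A B x₀ rfl fun r hr => if_pos (by omega)

theorem Algorithm.state_truncate {s t : ℕ} (hst : s ≤ t) (ω : alg.Sample) :
    alg.state A B x₀ s (truncate t ω) = alg.state A B x₀ s ω := by
  rw [Algorithm.state, Algorithm.state, Algorithm.history_truncate _ _ _ _ hst]

theorem measurable_finSnoc {X Y : Type*} [MeasurableSpace X] [MeasurableSpace Y] {t : ℕ}
    {f : X → Fin t → Y} {g : X → Y} (hf : Measurable f) (hg : Measurable g) :
    Measurable fun x => (Fin.snoc (α := fun _ => Y) (f x) (g x) : Fin (t + 1) → Y) := by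
  refine measurable_pi_lambda _ fun i => ?_
  refine Fin.lastCases ?_ (fun j => ?_) i
  · simpa using hg
  · simpa using measurable_pi_iff.1 hf j

/-- One step of the closed loop, as a function of the seed, the history and the new noise. -/
noncomputable def Algorithm.step (t : ℕ)
    (z : (alg.Seed × (Fin (t + 1) → EuclideanSpace ℝ (Fin d))) × EuclideanSpace ℝ (Fin d)) :
    alg.Seed × (Fin (t + 2) → EuclideanSpace ℝ (Fin d)) :=
  (z.1.1, Fin.snoc (α := fun _ => EuclideanSpace ℝ (Fin d)) z.1.2
    (Matrix.toEuclideanLin A (z.1.2 (Fin.last t)) + Matrix.toEuclideanLin B (alg.input t z.1) + z.2))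

theorem Algorithm.measurable_step (t : ℕ) : Measurable (alg.step A B t) := by
  refine (by fun_prop : Measurable fun z : (alg.Seed × (Fin (t + 1) → EuclideanSpace ℝ (Fin d)))
    × EuclideanSpace ℝ (Fin d) => z.1.1).prodMk (measurable_finSnoc (by fun_prop) ?_)
  refine Measurable.add (Measurable.add ?_ ?_) measurable_snd
  · exact (stateMap A).continuous.measurable.comp
      ((measurable_pi_apply (Fin.last t)).comp (measurable_snd.comp measurable_fst))
  · exact (inputMap B).continuous.measurable.comp ((alg.measurable_input t).comp measurable_fst)

theorem Algorithm.measurable_history (t : ℕ) :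
    Measurable fun ω : alg.Sample => alg.history A B x₀ ω t := by
  induction t with
  | zero => exact measurable_const
  | succ t ih =>
    have h1 : Measurable fun ω : alg.Sample => ((ω.1, alg.history A B x₀ ω t), ω.2 t) :=
      (measurable_fst.prodMk ih).prodMk ((measurable_pi_apply t).comp measurable_snd)
    exact measurable_snd.comp ((alg.measurable_step A B t).comp h1)

theorem Algorithm.measurable_state (t : ℕ) : Measurable (alg.state A B x₀ t) :=
  (measurable_pi_apply (Fin.last t)).comp (alg.measurable_history A B x₀ t)

/-- Superposition. The inputs may still react to past noise, so the two summands need not be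
independent. -/
theorem Algorithm.state_eq_resp (t : ℕ) (ω : alg.Sample) : alg.state A B x₀ t ω
    = resp (stateMap A) (fun s => inputMap B (alg.playedInput A B x₀ s ω)) x₀ t
      + resp (stateMap A) ω.2 0 t := by
  induction t with
  | zero => simp [Algorithm.state, Algorithm.history, resp]
  | succ t ih =>
    have h1 : alg.state A B x₀ (t + 1) ω = stateMap A (alg.state A B x₀ t ω)
        + inputMap B (alg.playedInput A B x₀ t ω) + ω.2 t := by
      rw [Algorithm.state, Algorithm.history, Fin.snoc_last]
      rfl
    rw [h1, ih, map_add]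
    simp only [resp]
    abel

/-- The log-likelihood ratio of the closed loops with true matrices `A'` and `A`. -/
noncomputable def Algorithm.logRatio (A' : Matrix (Fin d) (Fin d) ℝ) (σ : ℝ) (t : ℕ)
    (ω : alg.Sample) : ℝ :=
  ∑ s ∈ Finset.range t, (inner ℝ (stateMap (A' - A) (alg.state A B x₀ s ω)) (ω.2 s) / σ ^ 2
    - ‖stateMap (A' - A) (alg.state A B x₀ s ω)‖ ^ 2 / (2 * σ ^ 2))

theorem Algorithm.measurable_logRatio (A' : Matrix (Fin d) (Fin d) ℝ) (σ : ℝ) (t : ℕ) :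
    Measurable (alg.logRatio A B x₀ A' σ t) := by
  refine Finset.measurable_sum _ fun s _ => ?_
  have h1 : Measurable fun ω : alg.Sample => stateMap (A' - A) (alg.state A B x₀ s ω) :=
    (stateMap (A' - A)).continuous.measurable.comp (alg.measurable_state A B x₀ s)
  have h2 : Measurable fun ω : alg.Sample => ω.2 s := by fun_prop
  exact ((h1.inner h2).div_const _).sub ((h1.norm.pow_const 2).div_const _)

theorem Algorithm.logRatio_truncate (A' : Matrix (Fin d) (Fin d) ℝ) (σ : ℝ) (t : ℕ)
    (ω : alg.Sample) :
    alg.logRatio A B x₀ A' σ t (truncate t ω) = alg.logRatio A B x₀ A' σ t ω := by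
  refine Finset.sum_congr rfl fun s hs => ?_
  have hst := Finset.mem_range.1 hs
  rw [alg.state_truncate A B x₀ hst.le]
  have h1 : (truncate t ω).2 s = ω.2 s := if_pos hst
  rw [h1]

/-- The law of the history under `A'` has the density `exp (logRatio)` with respect to its law
under `A`. -/
theorem Algorithm.lintegral_history {σ : ℝ} (hσ : 0 < σ) (A' : Matrix (Fin d) (Fin d) ℝ) (t : ℕ)
    {f : alg.Seed × (Fin (t + 1) → EuclideanSpace ℝ (Fin d)) → ℝ≥0∞} (hf : Measurable f) :
    ∫⁻ ω, f (ω.1, alg.history A' B x₀ ω t) ∂(alg.law σ)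
      = ∫⁻ ω, ENNReal.ofReal (Real.exp (alg.logRatio A B x₀ A' σ t ω))
        * f (ω.1, alg.history A B x₀ ω t) ∂(alg.law σ) := by
  induction t with
  | zero => simp [Algorithm.logRatio, Algorithm.history]
  | succ t ih =>
    have hH : ∀ A : Matrix (Fin d) (Fin d) ℝ,
        Measurable fun ω : alg.Sample => (ω.1, alg.history A B x₀ ω t) := fun A =>
      measurable_fst.prodMk (alg.measurable_history A B x₀ t)
    set G : alg.Seed × (Fin (t + 1) → EuclideanSpace ℝ (Fin d)) → ℝ≥0∞ := fun z =>
      ∫⁻ e, f (alg.step A' B t (z, e)) ∂(noiseLaw d σ) with hG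
    have hGm : Measurable G := (hf.comp (alg.measurable_step A' B t)).lintegral_prod_right'
    have hD : Measurable fun z : alg.Seed × (Fin (t + 1) → EuclideanSpace ℝ (Fin d)) =>
        stateMap (A' - A) (z.2 (Fin.last t)) :=
      (stateMap (A' - A)).continuous.measurable.comp
        ((measurable_pi_apply (Fin.last t)).comp measurable_snd)
    -- Given the history, the input is the same for both matrices, so a step with `A'` is a step
    -- with `A` whose noise is shifted by (A' - A)x_t.
    have hshift : ∀ z, G z = ∫⁻ e, ENNReal.ofReal (Real.exp
        (inner ℝ (stateMap (A' - A) (z.2 (Fin.last t))) e / σ ^ 2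
          - ‖stateMap (A' - A) (z.2 (Fin.last t))‖ ^ 2 / (2 * σ ^ 2)))
        * f (alg.step A B t (z, e)) ∂(noiseLaw d σ) := fun z => by
      rw [← lintegral_noiseLaw_add hσ (stateMap (A' - A) (z.2 (Fin.last t)))
        (g := fun e => f (alg.step A B t (z, e)))
        (hf.comp ((alg.measurable_step A B t).comp measurable_prodMk_left))]
      refine lintegral_congr fun e => ?_
      congr 1
      simp only [Algorithm.step]
      congr 2
      simp only [LinearMap.coe_toContinuousLinearMap', map_sub, LinearMap.sub_apply]
      abel
    calc ∫⁻ ω, f (ω.1, alg.history A' B x₀ ω (t + 1)) ∂(alg.law σ)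
        = ∫⁻ ω, G (ω.1, alg.history A' B x₀ ω t) ∂(alg.law σ) := by
          refine lintegral_noise_eq alg.seedLaw (noiseLaw d σ) t
            (F := fun ω e => f (alg.step A' B t ((ω.1, alg.history A' B x₀ ω t), e))) ?_ ?_
          · exact hf.comp ((alg.measurable_step A' B t).comp
              (((hH A').comp measurable_fst).prodMk measurable_snd))
          · intro ω e
            rw [alg.history_truncate A' B x₀ le_rfl]
            rfl
      _ = ∫⁻ ω, ENNReal.ofReal (Real.exp (alg.logRatio A B x₀ A' σ t ω))
            * G (ω.1, alg.history A B x₀ ω t) ∂(alg.law σ) := ih hGm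
      _ = ∫⁻ ω, ∫⁻ e, ENNReal.ofReal (Real.exp (alg.logRatio A B x₀ A' σ t ω))
            * (ENNReal.ofReal (Real.exp
              (inner ℝ (stateMap (A' - A) (alg.state A B x₀ t ω)) e / σ ^ 2
                - ‖stateMap (A' - A) (alg.state A B x₀ t ω)‖ ^ 2 / (2 * σ ^ 2)))
              * f (alg.step A B t ((ω.1, alg.history A B x₀ ω t), e)))
            ∂(noiseLaw d σ) ∂(alg.law σ) := by
          refine lintegral_congr fun ω => ?_
          rw [lintegral_const_mul' _ _ ENNReal.ofReal_ne_top, hshift]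
          rfl
      _ = ∫⁻ ω, ENNReal.ofReal (Real.exp (alg.logRatio A B x₀ A' σ t ω))
            * (ENNReal.ofReal (Real.exp
              (inner ℝ (stateMap (A' - A) (alg.state A B x₀ t ω)) (ω.2 t) / σ ^ 2
                - ‖stateMap (A' - A) (alg.state A B x₀ t ω)‖ ^ 2 / (2 * σ ^ 2)))
              * f (alg.step A B t ((ω.1, alg.history A B x₀ ω t), ω.2 t))) ∂(alg.law σ) := by
          refine (lintegral_noise_eq alg.seedLaw (noiseLaw d σ) t (F := fun ω e =>
            ENNReal.ofReal (Real.exp (alg.logRatio A B x₀ A' σ t ω))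
            * (ENNReal.ofReal (Real.exp
              (inner ℝ (stateMap (A' - A) (alg.state A B x₀ t ω)) e / σ ^ 2
                - ‖stateMap (A' - A) (alg.state A B x₀ t ω)‖ ^ 2 / (2 * σ ^ 2)))
              * f (alg.step A B t ((ω.1, alg.history A B x₀ ω t), e)))) ?_ ?_).symm
          · have h1 : Measurable fun z : alg.Sample × EuclideanSpace ℝ (Fin d) =>
                stateMap (A' - A) (alg.state A B x₀ t z.1) :=
              ((stateMap (A' - A)).continuous.measurable.comp
                (alg.measurable_state A B x₀ t)).comp measurable_fst
            refine Measurable.mul ?_ (Measurable.mul ?_ ?_)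
            · exact ((Real.measurable_exp.comp
                (alg.measurable_logRatio A B x₀ A' σ t)).ennreal_ofReal).comp measurable_fst
            · exact (Real.measurable_exp.comp (((h1.inner measurable_snd).div_const _).sub
                ((h1.norm.pow_const 2).div_const _))).ennreal_ofReal
            · exact hf.comp ((alg.measurable_step A B t).comp
                (((hH A).comp measurable_fst).prodMk measurable_snd))
          · intro ω e
            simp only [alg.logRatio_truncate, alg.state_truncate A B x₀ le_rfl,
              alg.history_truncate A B x₀ le_rfl]
            rfl
      _ = _ := by
          refine lintegral_congr fun ω => ?_
          rw [← mul_assoc, ← ENNReal.ofReal_mul (Real.exp_pos _).le, ← Real.exp_add]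
          have h1 : alg.logRatio A B x₀ A' σ (t + 1) ω = alg.logRatio A B x₀ A' σ t ω
              + (inner ℝ (stateMap (A' - A) (alg.state A B x₀ t ω)) (ω.2 t) / σ ^ 2
                - ‖stateMap (A' - A) (alg.state A B x₀ t ω)‖ ^ 2 / (2 * σ ^ 2)) :=
            Finset.sum_range_succ _ _
          rw [h1]
          rfl

end ClosedLoop

/-! ### Second moments of the state and the relative entropy. -/

section Moments

open scoped ENNReal

variable {d p : ℕ} (alg : Algorithm.{w} d p) (A : Matrix (Fin d) (Fin d) ℝ)
  (B : Matrix (Fin d) (Fin p) ℝ) (x₀ : EuclideanSpace ℝ (Fin d))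

theorem Algorithm.map_noise (σ : ℝ) (t : ℕ) :
    (alg.law σ).map (fun ω : alg.Sample => ω.2 t) = noiseLaw d σ :=
  map_noise_eval alg.seedLaw (noiseLaw d σ) t

theorem Algorithm.memLp_noise (σ : ℝ) (t : ℕ) :
    MemLp (fun ω : alg.Sample => ω.2 t) 2 (alg.law σ) := by
  have h1 := memLp_noiseLaw (d := d) σ
  rw [← alg.map_noise σ t] at h1
  exact h1.comp_of_map (by fun_prop)

/-- A vector that depends only on the past is independent of the centred noise at time `t`. -/
theorem Algorithm.integral_inner_noise {σ : ℝ} {t : ℕ}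
    {X : alg.Sample → EuclideanSpace ℝ (Fin d)} (hX : Integrable X (alg.law σ))
    (hXm : Measurable X) (hXt : ∀ ω, X (truncate t ω) = X ω) :
    Integrable (fun ω => inner ℝ (X ω) (ω.2 t)) (alg.law σ) ∧
      ∫ ω, inner ℝ (X ω) (ω.2 t) ∂(alg.law σ) = 0 := by
  have hN : Integrable (fun ω : alg.Sample => ω.2 t) (alg.law σ) :=
    (alg.memLp_noise σ t).integrable (by norm_num)
  have hind : IndepFun X (fun ω : alg.Sample => ω.2 t) (alg.law σ) := by
    have h1 := (indepFun_truncate alg.seedLaw (noiseLaw d σ) t).comp hXm measurable_id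
    have h2 : X ∘ truncate t = X := funext hXt
    rw [h2] at h1
    exact h1
  refine ⟨hind.integrable_bilin hX hN (innerSL ℝ), ?_⟩
  have h3 : ∫ ω : alg.Sample, ω.2 t ∂(alg.law σ) = 0 := by
    have h4 := integral_map (μ := alg.law σ) (φ := fun ω : alg.Sample => ω.2 t) (by fun_prop)
      (f := fun e => e) (by fun_prop)
    rw [← h4, alg.map_noise, integral_id_multivariateGaussian]
  have h5 := hind.integral_bilin hX hN (innerSL ℝ)
  rw [h3, map_zero] at h5
  exact h5

theorem measurable_resp_noise (t : ℕ) :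
    Measurable fun ω : alg.Sample => resp (stateMap A) ω.2 0 t := by
  induction t with
  | zero => exact measurable_const
  | succ t ih =>
    simp only [resp]
    exact ((stateMap A).continuous.measurable.comp ih).add (by fun_prop)

theorem memLp_resp_noise (σ : ℝ) (t : ℕ) :
    MemLp (fun ω : alg.Sample => resp (stateMap A) ω.2 0 t) 2 (alg.law σ) := by
  induction t with
  | zero => exact MemLp.zero
  | succ t ih =>
    simp only [resp]
    exact ((stateMap A).comp_memLp' ih).add (alg.memLp_noise σ t)

theorem noiseForm_succ (t : ℕ) (w : EuclideanSpace ℝ (Fin d)) :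
    noiseForm A (t + 1) w = noiseForm A t (Matrix.toEuclideanLin A.transpose w) + ‖w‖ ^ 2 := by
  rw [noiseForm, Finset.sum_range_succ', noiseForm]
  congr 1
  · refine Finset.sum_congr rfl fun s _ => ?_
    rw [pow_succ' A, Matrix.transpose_mul]
    simp [Matrix.toLpLin_apply]
  · simp

theorem integral_inner_resp_noise_sq (σ : ℝ) (t : ℕ) (w : EuclideanSpace ℝ (Fin d)) :
    ∫ ω : alg.Sample, (inner ℝ w (resp (stateMap A) ω.2 0 t)) ^ 2 ∂(alg.law σ)
      = σ ^ 2 * noiseForm A t w := by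
  induction t generalizing w with
  | zero => simp [resp, noiseForm]
  | succ t ih =>
    set w' := Matrix.toEuclideanLin A.transpose w with hw'
    have hn := memLp_resp_noise alg A σ t
    have hi := hn.const_inner (𝕜 := ℝ) w'
    have hη := (alg.memLp_noise σ t).const_inner (𝕜 := ℝ) w
    have hX := alg.integral_inner_noise (σ := σ) (t := t)
      (X := fun ω => (inner ℝ w' (resp (stateMap A) ω.2 0 t)) • w)
      ((hi.integrable (by norm_num)).smul_const w)
      ((measurable_const.inner (measurable_resp_noise alg A t)).smul_const w)
      (fun ω => by rw [resp_congr 0 (b := (truncate t ω).2) (b' := ω.2) fun s hs => if_pos hs])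
    have h1 : ∀ ω : alg.Sample, (inner ℝ w (resp (stateMap A) ω.2 0 (t + 1))) ^ 2
        = (inner ℝ w' (resp (stateMap A) ω.2 0 t)) ^ 2
          + 2 * inner ℝ ((inner ℝ w' (resp (stateMap A) ω.2 0 t)) • w) (ω.2 t)
          + (inner ℝ w (ω.2 t)) ^ 2 := fun ω => by
      simp only [resp]
      rw [inner_add_right, real_inner_smul_left, hw', LinearMap.coe_toContinuousLinearMap',
        inner_toEuclideanLin]
      ring
    simp only [h1]
    have hadd : Integrable (fun ω : alg.Sample => (inner ℝ w' (resp (stateMap A) ω.2 0 t)) ^ 2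
          + 2 * inner ℝ ((inner ℝ w' (resp (stateMap A) ω.2 0 t)) • w) (ω.2 t)) (alg.law σ) :=
      hi.integrable_sq.add (hX.1.const_mul 2)
    rw [integral_add hadd hη.integrable_sq, integral_add hi.integrable_sq (hX.1.const_mul 2), integral_const_mul, hX.2, ih,
      noiseForm_succ]
    have h2 : ∫ ω : alg.Sample, (inner ℝ w (ω.2 t)) ^ 2 ∂(alg.law σ) = σ ^ 2 * ‖w‖ ^ 2 := by
      have h4 := integral_map (μ := alg.law σ) (φ := fun ω : alg.Sample => ω.2 t) (by fun_prop)
        (f := fun e => (inner ℝ w e) ^ 2) (by fun_prop)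
      rw [← h4, alg.map_noise, integral_inner_sq_noiseLaw]
    rw [h2]; ring

/-- Consecutive windows cover the horizon with an overshoot of at most one window. -/
theorem sum_le_of_window_le {f : ℕ → ℝ} (hf : ∀ t, 0 ≤ f t) {k : ℕ} (hk : 1 ≤ k) {c : ℝ}
    (h : ∀ s, 1 / (k : ℝ) * ∑ t ∈ Finset.range k, f (s + t) ≤ c) (m : ℕ) :
    ∑ t ∈ Finset.range m, f t ≤ c * (m + k) := by
  have hk0 : (0 : ℝ) < k := by exact_mod_cast hk
  have hc : 0 ≤ c := le_trans (mul_nonneg (by positivity) (Finset.sum_nonneg fun t _ => hf _)) (h 0)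
  have h1 : ∀ q : ℕ, ∑ t ∈ Finset.range (k * q), f t ≤ c * (k * q) := by
    intro q
    induction q with
    | zero => simp
    | succ q ih =>
      rw [mul_add, mul_one, Finset.sum_range_add]
      have h2 := h (k * q)
      rw [one_div, inv_mul_le_iff₀ hk0] at h2
      push_cast
      linarith
  have h2 : m ≤ k * (m / k + 1) := by
    have := Nat.div_add_mod m k; have := Nat.mod_lt m hk; rw [mul_add]; omega
  have h3 : k * (m / k) ≤ m := Nat.mul_div_le m k
  have h4 : (k : ℝ) * (m / k : ℕ) ≤ m := by exact_mod_cast h3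
  calc _ ≤ ∑ t ∈ Finset.range (k * (m / k + 1)), f t :=
        Finset.sum_le_sum_of_subset_of_nonneg (Finset.range_mono h2) fun _ _ _ => hf _
    _ ≤ c * (k * (m / k + 1 : ℕ)) := h1 _
    _ ≤ c * (m + k) := by gcongr; push_cast; linarith

/-- The part of the state that is driven by the inputs and the initial state. -/
noncomputable def Algorithm.drift (t : ℕ) (ω : alg.Sample) : EuclideanSpace ℝ (Fin d) :=
  resp (stateMap A) (fun s => inputMap B (alg.playedInput A B x₀ s ω)) x₀ t

theorem Algorithm.state_eq_drift_add (t : ℕ) (ω : alg.Sample) :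
    alg.state A B x₀ t ω = alg.drift A B x₀ t ω + resp (stateMap A) ω.2 0 t :=
  alg.state_eq_resp A B x₀ t ω

theorem Algorithm.measurable_drift (t : ℕ) : Measurable (alg.drift A B x₀ t) := by
  have h1 : alg.drift A B x₀ t = fun ω => alg.state A B x₀ t ω - resp (stateMap A) ω.2 0 t :=
    funext fun ω => by rw [alg.state_eq_drift_add, add_sub_cancel_right]
  rw [h1]
  exact (alg.measurable_state A B x₀ t).sub (measurable_resp_noise alg A t)

variable {alg A B x₀} {σ γ : ℝ} {k : ℕ}

theorem Algorithm.BoundedWindowPower.ae_energy_le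
    (h : alg.BoundedWindowPower A B x₀ σ γ k) (hk : 1 ≤ k) :
    ∀ᵐ ω ∂(alg.law σ), ∀ m : ℕ,
      ∑ t ∈ Finset.range m, ‖alg.playedInput A B x₀ t ω‖ ^ 2 ≤ γ ^ 2 * (m + k) := by
  filter_upwards [h] with ω hω m
  exact sum_le_of_window_le (fun _ => sq_nonneg _) hk hω m

theorem Algorithm.BoundedWindowPower.ae_norm_drift_le
    (h : alg.BoundedWindowPower A B x₀ σ γ k) (hk : 1 ≤ k)
    {N : EuclideanSpace ℝ (Fin d) → ℝ} {ρ K : ℝ} (hN : IsLyapunov (stateMap A) N ρ K) :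
    ∀ᵐ ω ∂(alg.law σ), ∀ m : ℕ, ‖alg.drift A B x₀ m ω‖ ^ 2
      ≤ N x₀ ^ 2 + K ^ 2 / (1 - ρ) * (‖inputMap B‖ ^ 2 * (γ ^ 2 * (m + k))) := by
  have h1ρ : 0 < 1 - ρ := sub_pos.2 hN.lt_one
  filter_upwards [h.ae_energy_le hk] with ω hω m
  have h1 := hN.sq_resp_le (fun s => inputMap B (alg.playedInput A B x₀ s ω)) x₀ m
  calc ‖alg.drift A B x₀ m ω‖ ^ 2 ≤ N (alg.drift A B x₀ m ω) ^ 2 := by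
        gcongr; exact hN.norm_le _
    _ ≤ _ := h1
    _ ≤ N x₀ ^ 2 + K ^ 2 / (1 - ρ) * ∑ s ∈ Finset.range m, ‖inputMap B‖ ^ 2
          * ‖alg.playedInput A B x₀ s ω‖ ^ 2 := by
        gcongr with s _
        rw [← mul_pow]; gcongr; exact (inputMap B).le_opNorm _
    _ ≤ _ := by rw [← Finset.mul_sum]; gcongr; exact hω m

theorem Algorithm.BoundedWindowPower.memLp_drift
    (h : alg.BoundedWindowPower A B x₀ σ γ k) (hk : 1 ≤ k)
    (hA : spectralRadius ℂ (toComplex A) < 1) (t : ℕ) :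
    MemLp (alg.drift A B x₀ t) 2 (alg.law σ) := by
  obtain ⟨N, ρ, K, hN⟩ := exists_isLyapunov_stateMap hA
  refine MemLp.of_bound (alg.measurable_drift A B x₀ t).aestronglyMeasurable
    (√(N x₀ ^ 2 + K ^ 2 / (1 - ρ) * (‖inputMap B‖ ^ 2 * (γ ^ 2 * (t + k))))) ?_
  filter_upwards [h.ae_norm_drift_le hk hN] with ω hω
  exact Real.le_sqrt_of_sq_le (hω t)

theorem Algorithm.BoundedWindowPower.memLp_state
    (h : alg.BoundedWindowPower A B x₀ σ γ k) (hk : 1 ≤ k)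
    (hA : spectralRadius ℂ (toComplex A) < 1) (t : ℕ) :
    MemLp (alg.state A B x₀ t) 2 (alg.law σ) := by
  have h1 : alg.state A B x₀ t
      = fun ω => alg.drift A B x₀ t ω + resp (stateMap A) ω.2 0 t :=
    funext fun ω => alg.state_eq_drift_add A B x₀ t ω
  rw [h1]
  exact (h.memLp_drift hk hA t).add (memLp_resp_noise alg A σ t)

/-- The correlation of drift and noise is not controlled, hence (a + b)² ≤ 2a² + 2b² and the loss of
a factor 2. -/
theorem Algorithm.BoundedWindowPower.integral_inner_state_sq_le
    (h : alg.BoundedWindowPower A B x₀ σ γ k) (hk : 1 ≤ k)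
    (hA : spectralRadius ℂ (toComplex A) < 1) (t : ℕ) (w : EuclideanSpace ℝ (Fin d)) :
    ∫ ω, (inner ℝ w (alg.state A B x₀ t ω)) ^ 2 ∂(alg.law σ) ≤ 2 * (σ ^ 2 * noiseForm A t w)
      + 2 * ∫ ω, (inner ℝ w (alg.drift A B x₀ t ω)) ^ 2 ∂(alg.law σ) := by
  have h1 := ((h.memLp_drift hk hA t).const_inner (𝕜 := ℝ) w).integrable_sq
  have h2 := ((memLp_resp_noise alg A σ t).const_inner (𝕜 := ℝ) w).integrable_sq
  have h3 := ((h.memLp_state hk hA t).const_inner (𝕜 := ℝ) w).integrable_sq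
  rw [← integral_inner_resp_noise_sq alg A σ t w, ← integral_const_mul, ← integral_const_mul,
    ← integral_add (h2.const_mul 2) (h1.const_mul 2)]
  refine integral_mono h3 ((h2.const_mul 2).add (h1.const_mul 2)) fun ω => ?_
  simp only
  rw [alg.state_eq_drift_add, inner_add_right]
  nlinarith [sq_nonneg (inner ℝ w (alg.drift A B x₀ t ω)
    - inner ℝ w (resp (stateMap A) ω.2 0 t))]

/-- The terms linear in the noise have mean zero, so minus the mean, the relative entropy, consists
of the quadratic terms. -/
theorem Algorithm.BoundedWindowPower.integral_logRatio
    (h : alg.BoundedWindowPower A B x₀ σ γ k) (hk : 1 ≤ k)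
    (hA : spectralRadius ℂ (toComplex A) < 1) (A' : Matrix (Fin d) (Fin d) ℝ) (t : ℕ) :
    Integrable (alg.logRatio A B x₀ A' σ t) (alg.law σ) ∧
    ∫ ω, alg.logRatio A B x₀ A' σ t ω ∂(alg.law σ) = -(1 / (2 * σ ^ 2) * ∑ s ∈ Finset.range t,
      ∫ ω, ‖stateMap (A' - A) (alg.state A B x₀ s ω)‖ ^ 2 ∂(alg.law σ)) := by
  have hm : ∀ s, MemLp (fun ω => stateMap (A' - A) (alg.state A B x₀ s ω)) 2 (alg.law σ) :=
    fun s => (stateMap (A' - A)).comp_memLp' (h.memLp_state hk hA s)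
  have h1 : ∀ s, Integrable (fun ω => ‖stateMap (A' - A) (alg.state A B x₀ s ω)‖ ^ 2)
      (alg.law σ) := fun s => (hm s).norm.integrable_sq
  have h2 := fun s => alg.integral_inner_noise (σ := σ) (t := s)
    (X := fun ω => stateMap (A' - A) (alg.state A B x₀ s ω)) ((hm s).integrable (by norm_num))
    ((stateMap (A' - A)).continuous.measurable.comp (alg.measurable_state A B x₀ s))
    (fun ω => by rw [alg.state_truncate A B x₀ le_rfl])
  have h3 : ∀ s ∈ Finset.range t, Integrable (fun ω =>
      inner ℝ (stateMap (A' - A) (alg.state A B x₀ s ω)) (ω.2 s) / σ ^ 2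
      - ‖stateMap (A' - A) (alg.state A B x₀ s ω)‖ ^ 2 / (2 * σ ^ 2)) (alg.law σ) := fun s _ =>
    ((h2 s).1.div_const _).sub ((h1 s).div_const _)
  refine ⟨integrable_finsetSum _ h3, ?_⟩
  simp only [Algorithm.logRatio]
  rw [integral_finsetSum _ h3, Finset.mul_sum, ← Finset.sum_neg_distrib]
  refine Finset.sum_congr rfl fun s _ => ?_
  rw [integral_sub ((h2 s).1.div_const _) ((h1 s).div_const _), integral_div, integral_div,
    (h2 s).2]
  ring

end Moments

/-! ### The two-point argument and the direction of small excitation. -/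

section LowerBound

open scoped ENNReal

variable {d p : ℕ} {alg : Algorithm.{w} d p} {A : Matrix (Fin d) (Fin d) ℝ}
  {B : Matrix (Fin d) (Fin p) ℝ} {x₀ : EuclideanSpace ℝ (Fin d)} {σ γ : ℝ} {k : ℕ}

theorem norm_stateMap_smul_vecMulVec (r : ℝ) {w : EuclideanSpace ℝ (Fin d)} (hw : ‖w‖ = 1)
    (x : EuclideanSpace ℝ (Fin d)) :
    ‖stateMap (r • Matrix.vecMulVec w.ofLp w.ofLp) x‖ = |r| * |inner ℝ w x| := by
  have h1 : stateMap (r • Matrix.vecMulVec w.ofLp w.ofLp) x = (r * inner ℝ w x) • w := by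
    ext i
    simp only [LinearMap.coe_toContinuousLinearMap', Matrix.toLpLin_apply, Matrix.mulVec,
      dotProduct, Matrix.vecMulVec_apply, Matrix.smul_apply, PiLp.smul_apply, smul_eq_mul,
      PiLp.inner_apply, RCLike.inner_apply, conj_trivial, Finset.mul_sum, Finset.sum_mul]
    exact Finset.sum_congr rfl fun j _ => by ring
  rw [h1, norm_smul, hw, mul_one, Real.norm_eq_abs, abs_mul]

theorem norm_smul_vecMulVec {r : ℝ} (hr : 0 ≤ r) {w : EuclideanSpace ℝ (Fin d)} (hw : ‖w‖ = 1) :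
    ‖r • Matrix.vecMulVec w.ofLp w.ofLp‖ = r := by
  have h1 : ‖r • Matrix.vecMulVec w.ofLp w.ofLp‖
      = ‖stateMap (r • Matrix.vecMulVec w.ofLp w.ofLp)‖ := rfl
  rw [h1]
  refine le_antisymm (ContinuousLinearMap.opNorm_le_bound _ hr fun x => ?_) ?_
  · rw [norm_stateMap_smul_vecMulVec r hw, abs_of_nonneg hr]
    gcongr
    simpa [hw] using abs_real_inner_le_norm w x
  · have h2 := (stateMap (r • Matrix.vecMulVec w.ofLp w.ofLp)).le_opNorm w
    rw [norm_stateMap_smul_vecMulVec r hw, hw, real_inner_self_eq_norm_sq, hw, abs_of_nonneg hr]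
      at h2
    simpa using h2

theorem Algorithm.measurable_norm_estimate_sub (alg : Algorithm.{w} d p)
    (A : Matrix (Fin d) (Fin d) ℝ) (t : ℕ) : Measurable fun z => ‖alg.estimate t z - A‖ := by
  have h1 : Continuous fun M : Matrix (Fin d) (Fin d) ℝ => ‖M - A‖ := by fun_prop
  have h2 : Measurable fun z => (fun i j => alg.estimate t z i j : Fin d → Fin d → ℝ) :=
    measurable_pi_lambda _ fun i => measurable_pi_lambda _ fun j => alg.measurable_estimate t i j
  have h3 : Measurable fun M : Fin d → Fin d → ℝ => ‖(Matrix.of M) - A‖ :=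
    Continuous.measurable (show Continuous fun M : Fin d → Fin d → ℝ => ‖(Matrix.of M) - A‖ from h1)
  exact h3.comp h2

/-- To separate `A` from a perturbation of `A` in the direction `w`, the states have to be excited
in this direction. -/
theorem Algorithm.BoundedWindowPower.log_le_sum_inner_sq
    (h : alg.BoundedWindowPower A B x₀ σ γ k) (hk : 1 ≤ k)
    (hA : spectralRadius ℂ (toComplex A) < 1) (hσ : 0 < σ) {ε δ : ℝ} (hε : 0 < ε) (hδ : 0 < δ)
    {τ : ℕ} (hτ : alg.StableFrom A B x₀ σ ε δ τ) {w : EuclideanSpace ℝ (Fin d)} (hw : ‖w‖ = 1) :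
    Real.log (1 / (4 * δ)) ≤ (21 / 10 * ε) ^ 2 / (2 * σ ^ 2) * ∑ t ∈ Finset.range τ,
      ∫ ω, (inner ℝ w (alg.state A B x₀ t ω)) ^ 2 ∂(alg.law σ) := by
  -- Above 2ε, so that no estimate is ε-close to both matrices, and below 3ε, so that stability
  -- applies to `A'`.
  set r := 21 / 10 * ε with hr
  have hr0 : 0 ≤ r := by positivity
  set Δ := r • Matrix.vecMulVec w.ofLp w.ofLp with hΔ
  have hΔn : ‖Δ‖ = r := norm_smul_vecMulVec hr0 hw
  set A' := A + Δ with hA'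
  have hA'A : A' - A = Δ := add_sub_cancel_left A Δ
  have hAA' : ‖A - A'‖ = r := by rw [← norm_neg, neg_sub, hA'A, hΔn]
  have s1 := hτ τ le_rfl A (by simp; positivity)
  have s2 := hτ τ le_rfl A' (by rw [hAA', hr]; linarith)
  set G : Set (alg.Seed × (Fin (τ + 1) → EuclideanSpace ℝ (Fin d))) :=
    {z | ‖alg.estimate τ z - A‖ ≤ ε} with hG
  have hGm : MeasurableSet G := measurableSet_le (alg.measurable_norm_estimate_sub A τ)
    measurable_const
  have hH : ∀ A : Matrix (Fin d) (Fin d) ℝ,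
      Measurable fun ω : alg.Sample => (ω.1, alg.history A B x₀ ω τ) := fun A =>
    measurable_fst.prodMk (alg.measurable_history A B x₀ τ)
  set S : Set alg.Sample := (fun ω => (ω.1, alg.history A B x₀ ω τ)) ⁻¹' G with hS
  have hSm : MeasurableSet S := hH A hGm
  set S' : Set alg.Sample := (fun ω => (ω.1, alg.history A' B x₀ ω τ)) ⁻¹' G with hS'
  have hSm' : MeasurableSet S' := hH A' hGm
  have hP : (alg.law σ).real Sᶜ ≤ δ := by
    rw [probReal_compl_eq_one_sub hSm]
    have : (alg.law σ).real S = (alg.law σ).real {ω | ‖alg.estimator A B x₀ τ ω - A‖ ≤ ε} := rfl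
    linarith
  have hP' : (alg.law σ).real S' ≤ δ := by
    have h1 : S' ⊆ {ω | ‖alg.estimator A' B x₀ τ ω - A'‖ ≤ ε}ᶜ := by
      intro ω hω hω'
      have h2 : ‖alg.estimator A' B x₀ τ ω - A‖ ≤ ε := hω
      have h3 : ‖alg.estimator A' B x₀ τ ω - A'‖ ≤ ε := hω'
      have h4 : ‖A - A'‖ ≤ ε + ε := by
        have h5 : A - A' = (alg.estimator A' B x₀ τ ω - A') - (alg.estimator A' B x₀ τ ω - A) := by
          abel
        rw [h5]
        exact (norm_sub_le _ _).trans (add_le_add h3 h2)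
      rw [hAA', hr] at h4
      linarith
    have hm : MeasurableSet {ω | ‖alg.estimator A' B x₀ τ ω - A'‖ ≤ ε} :=
      measurableSet_le ((alg.measurable_norm_estimate_sub A' τ).comp (hH A')) measurable_const
    refine (measureReal_mono h1).trans ?_
    rw [probReal_compl_eq_one_sub hm]
    linarith
  obtain ⟨hLi, hLe⟩ := h.integral_logRatio hk hA A' τ
  set L := alg.logRatio A B x₀ A' σ τ with hL
  have hexpm : Measurable fun ω => Real.exp (L ω) :=
    Real.measurable_exp.comp (alg.measurable_logRatio A B x₀ A' σ τ)
  have htot : ∫⁻ ω, ENNReal.ofReal (Real.exp (L ω)) ∂(alg.law σ) = 1 := by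
    have h1 := alg.lintegral_history A B x₀ hσ A' τ (f := fun _ => 1) measurable_const
    simpa using h1.symm
  have hexp : Integrable (fun ω => Real.exp (L ω)) (alg.law σ) := by
    refine ⟨hexpm.aestronglyMeasurable, ?_⟩
    rw [hasFiniteIntegral_iff_ofReal (ae_of_all _ fun ω => (Real.exp_pos _).le), htot]
    exact ENNReal.one_lt_top
  have hexp1 : ∫ ω, Real.exp (L ω) ∂(alg.law σ) = 1 := by
    rw [integral_eq_lintegral_of_nonneg_ae (ae_of_all _ fun ω => (Real.exp_pos _).le)
      hexpm.aestronglyMeasurable, htot, ENNReal.toReal_one]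
  -- By the change of measure this integral is the probability, under `A'`, that the estimate is
  -- ε-close to `A`.
  have hexpS : ∫ ω in S, Real.exp (L ω) ∂(alg.law σ) ≤ δ := by
    refine le_trans (le_of_eq ?_) hP'
    rw [integral_eq_lintegral_of_nonneg_ae (ae_of_all _ fun ω => (Real.exp_pos _).le)
      hexpm.aestronglyMeasurable, measureReal_def]
    congr 1
    have h1 := alg.lintegral_history A B x₀ hσ A' τ (f := G.indicator 1)
      (measurable_one.indicator hGm)
    have h2 : ∫⁻ ω, G.indicator 1 (ω.1, alg.history A' B x₀ ω τ) ∂(alg.law σ) = alg.law σ S' := by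
      rw [← lintegral_indicator_one hSm']
      rfl
    rw [← h2, h1, ← lintegral_indicator hSm]
    refine lintegral_congr fun ω => ?_
    by_cases hω : ω ∈ S
    · have hω' : (ω.1, alg.history A B x₀ ω τ) ∈ G := hω
      rw [Set.indicator_of_mem hω, Set.indicator_of_mem hω', Pi.one_apply, mul_one]
    · have hω' : (ω.1, alg.history A B x₀ ω τ) ∉ G := hω
      rw [Set.indicator_of_notMem hω, Set.indicator_of_notMem hω', mul_zero]
  refine (log_le_neg_integral hLi hexp hexp1 hSm hδ hexpS hP).trans (le_of_eq ?_)
  rw [hLe, neg_neg, Finset.mul_sum, Finset.mul_sum]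
  refine Finset.sum_congr rfl fun t _ => ?_
  rw [hA'A, ← integral_const_mul, ← integral_const_mul]
  refine integral_congr_ae (ae_of_all _ fun ω => ?_)
  simp only
  rw [hΔ, norm_stateMap_smul_vecMulVec r hw, mul_pow, sq_abs, sq_abs]
  ring

/-- The mean is taken in the space of operators because membership of integrals in closed convex
sets is applied there. -/
theorem integral_rankOne_form {Ω : Type*} [MeasurableSpace Ω] {P : Measure Ω}
    [IsProbabilityMeasure P] {E : Type*} [NormedAddCommGroup E] [InnerProductSpace ℝ E]
    [FiniteDimensional ℝ E] {v : ℕ → Ω → E} (hv : ∀ t, MemLp (v t) 2 P) (c κ : ℝ) (m : ℕ) :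
    Integrable (fun ω => c • ∑ t ∈ Finset.range m, InnerProductSpace.rankOne ℝ (v t ω) (v t ω)
      - κ • (1 : E →L[ℝ] E)) P ∧
    ∀ w, inner ℝ ((∫ ω, (c • ∑ t ∈ Finset.range m, InnerProductSpace.rankOne ℝ (v t ω) (v t ω)
      - κ • (1 : E →L[ℝ] E)) ∂P) w) w
      = c * ∑ t ∈ Finset.range m, ∫ ω, (inner ℝ w (v t ω)) ^ 2 ∂P - κ * ‖w‖ ^ 2 := by
  have hrank : ∀ t, Integrable (fun ω => InnerProductSpace.rankOne ℝ (v t ω) (v t ω)) P :=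
    fun t => by
      have hc : Continuous fun v : E => InnerProductSpace.rankOne ℝ v v :=
        (InnerProductSpace.rankOne ℝ).continuous.clm_apply continuous_id
      refine Integrable.mono' (hv t).norm.integrable_sq
        (hc.comp_aestronglyMeasurable (hv t).aestronglyMeasurable) (ae_of_all _ fun ω => ?_)
      rw [InnerProductSpace.norm_rankOne]
      exact (sq _).ge
  have hQi : Integrable (fun ω => c • ∑ t ∈ Finset.range m,
      InnerProductSpace.rankOne ℝ (v t ω) (v t ω) - κ • (1 : E →L[ℝ] E)) P :=
    ((integrable_finsetSum _ fun t _ => hrank t).smul c).sub (integrable_const _)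
  refine ⟨hQi, fun w => ?_⟩
  have hsq : ∀ t, Integrable (fun ω => (inner ℝ w (v t ω)) ^ 2) P :=
    fun t => ((hv t).const_inner (𝕜 := ℝ) w).integrable_sq
  have h1 : ∀ ω, inner ℝ w ((c • ∑ t ∈ Finset.range m,
      InnerProductSpace.rankOne ℝ (v t ω) (v t ω) - κ • (1 : E →L[ℝ] E)) w)
      = c * ∑ t ∈ Finset.range m, (inner ℝ w (v t ω)) ^ 2 - κ * ‖w‖ ^ 2 := fun ω => by
    have e1 : (c • ∑ t ∈ Finset.range m,
        InnerProductSpace.rankOne ℝ (v t ω) (v t ω) - κ • (1 : E →L[ℝ] E)) w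
        = c • ∑ t ∈ Finset.range m, inner ℝ (v t ω) w • v t ω - κ • w := by
      simp
    rw [e1, inner_sub_right, real_inner_smul_right, real_inner_smul_right, inner_sum,
      real_inner_self_eq_norm_sq]
    have e2 : ∀ t ∈ Finset.range m, inner ℝ w (inner ℝ (v t ω) w • v t ω)
        = (inner ℝ w (v t ω)) ^ 2 := fun t _ => by
      rw [real_inner_smul_right, real_inner_comm]; ring
    rw [Finset.sum_congr rfl e2]
  rw [ContinuousLinearMap.integral_apply hQi, real_inner_comm,
    ← integral_inner (hQi.apply_continuousLinearMap w)]
  simp only [h1]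
  rw [integral_sub ((integrable_finsetSum _ fun t _ => hsq t).const_mul _) (integrable_const _),
    integral_const_mul, integral_finsetSum _ fun t _ => hsq t]
  simp

/-- With m ≥ 8G the weight (9/10)/(m + G) is at least (4/5)/m. The two errors s/10 raise Λ to at
most (6/5)Λ, and (5/4)(6/5) = 3/2. -/
theorem excitation_le_of_average_le {s F V Λ : ℝ} {m G : ℕ} (hm : 1 ≤ m) (hG : 8 * G ≤ m)
    (hF : 0 ≤ F) (hV : 0 ≤ V) (hs : s ≤ Λ)
    (h : F + (9 / 10 / (m + G : ℝ) * V - s / 10) ≤ Λ + s / 10) :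
    m * F + V ≤ 3 / 2 * m * Λ := by
  have hm0 : (0 : ℝ) < m := by exact_mod_cast hm
  have hGm : 8 * (G : ℝ) ≤ m := by exact_mod_cast hG
  have h1 : 4 / 5 / m * V ≤ 9 / 10 / (m + G : ℝ) * V := by
    refine mul_le_mul_of_nonneg_right ?_ hV
    rw [div_le_div_iff₀ hm0 (by positivity)]
    linarith
  have h2 : F + 4 / 5 / m * V ≤ 6 / 5 * Λ := by linarith
  have h3 : 5 / 4 * m * (F + 4 / 5 / m * V) ≤ 5 / 4 * m * (6 / 5 * Λ) := by
    gcongr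
  have h4 : 5 / 4 * m * (F + 4 / 5 / m * V) = 5 / 4 * (m * F) + V := by field_simp
  have h5 : 0 ≤ m * F := by positivity
  linarith

/-- Over long horizons, the inputs of the algorithm do not excite all directions more than the best
periodic inputs do. -/
theorem exists_drift_excitation_le (hd : 1 ≤ d) (hA : spectralRadius ℂ (toComplex A) < 1)
    (B : Matrix (Fin d) (Fin p) ℝ) (x₀ : EuclideanSpace ℝ (Fin d)) (hσ : 0 < σ) (hγ : 0 < γ)
    (hk : 1 ≤ k) : ∃ m₀ : ℕ, ∀ m ≥ m₀, ∀ alg : Algorithm.{w} d p,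
      alg.BoundedWindowPower A B x₀ σ γ k → ∃ w : EuclideanSpace ℝ (Fin d), ‖w‖ = 1 ∧
        m * (σ ^ 2 * noiseForm A m w) + ∑ t ∈ Finset.range m,
          ∫ ω, (inner ℝ w (alg.drift A B x₀ t ω)) ^ 2 ∂(alg.law σ)
          ≤ 3 / 2 * m * maxExcitationLimit A B σ γ := by
  obtain ⟨N, ρ, K, hN⟩ := exists_isLyapunov_stateMap hA
  have hκ : 0 < σ ^ 2 / 10 := by positivity
  obtain ⟨G, m₀, hG, hm₀, H⟩ := hN.block_mem_achievable (inputMap B) γ k x₀ hκ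
  refine ⟨m₀, fun m hm alg h => ?_⟩
  obtain ⟨hQi, hQ⟩ := integral_rankOne_form (h.memLp_drift hk hA) (9 / 10 / (m + G : ℝ))
    (σ ^ 2 / 10) m
  -- Almost every path yields an achievable form, and a closed convex set contains the mean. The
  -- threshold `m₀` is uniform in the algorithm.
  have hmem := (hN.convex_achievable (inputMap B) γ).integral_mem (isClosed_achievable _ _ _) (by
    filter_upwards [h.ae_energy_le hk] with ω hω
    exact H m hm _ (hω m)) hQi
  obtain ⟨w, hw, hle⟩ := exists_noiseForm_add_le_of_achievable hd hA B σ hγ hmem m hκ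
  rw [hQ, hw, one_pow, mul_one] at hle
  exact ⟨w, hw, excitation_le_of_average_le (hm₀.trans hm) (hG.trans hm)
    (mul_nonneg (sq_nonneg _) (Finset.sum_nonneg fun _ _ => sq_nonneg _))
    (Finset.sum_nonneg fun t _ => integral_nonneg fun ω => sq_nonneg _)
    (sq_le_maxExcitationLimit hd hA B σ hγ) hle⟩

theorem Algorithm.BoundedWindowPower.sum_inner_sq_le
    (h : alg.BoundedWindowPower A B x₀ σ γ k) (hk : 1 ≤ k)
    (hA : spectralRadius ℂ (toComplex A) < 1) (m : ℕ) (w : EuclideanSpace ℝ (Fin d)) :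
    ∑ t ∈ Finset.range m, ∫ ω, (inner ℝ w (alg.state A B x₀ t ω)) ^ 2 ∂(alg.law σ)
      ≤ 2 * (m * (σ ^ 2 * noiseForm A m w) + ∑ t ∈ Finset.range m,
          ∫ ω, (inner ℝ w (alg.drift A B x₀ t ω)) ^ 2 ∂(alg.law σ)) := by
  calc _ ≤ ∑ t ∈ Finset.range m, (2 * (σ ^ 2 * noiseForm A m w)
        + 2 * ∫ ω, (inner ℝ w (alg.drift A B x₀ t ω)) ^ 2 ∂(alg.law σ)) := by
        refine Finset.sum_le_sum fun t ht => ?_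
        refine (h.integral_inner_state_sq_le hk hA t w).trans ?_
        gcongr
        exact noiseForm_mono A w (Finset.mem_range.1 ht).le
    _ = _ := by
        rw [Finset.sum_add_distrib, ← Finset.mul_sum (f := fun t =>
          ∫ ω, (inner ℝ w (alg.drift A B x₀ t ω)) ^ 2 ∂(alg.law σ)), Finset.sum_const, Finset.card_range,
          nsmul_eq_mul]
        ring

/-- For bounded horizons the excitation is bounded, uniformly in the algorithm. -/
theorem exists_sum_inner_sq_le (hA : spectralRadius ℂ (toComplex A) < 1)
    (B : Matrix (Fin d) (Fin p) ℝ) (x₀ : EuclideanSpace ℝ (Fin d)) (σ γ : ℝ) (hk : 1 ≤ k)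
    (m₀ : ℕ) : ∃ C ≥ (0 : ℝ), ∀ m ≤ m₀, ∀ alg : Algorithm.{w} d p,
      alg.BoundedWindowPower A B x₀ σ γ k → ∀ w : EuclideanSpace ℝ (Fin d), ‖w‖ = 1 →
        ∑ t ∈ Finset.range m, ∫ ω, (inner ℝ w (alg.state A B x₀ t ω)) ^ 2 ∂(alg.law σ) ≤ C := by
  obtain ⟨N, ρ, K, hN⟩ := exists_isLyapunov_stateMap hA
  have h1ρ : 0 < 1 - ρ := sub_pos.2 hN.lt_one
  set D := N x₀ ^ 2 + K ^ 2 / (1 - ρ) * (‖inputMap B‖ ^ 2 * (γ ^ 2 * (m₀ + k))) with hD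
  have hD0 : 0 ≤ D := by positivity
  refine ⟨2 * (m₀ * (σ ^ 2 * (K ^ 2 / (1 - ρ))) + m₀ * D), by positivity, fun m hm alg h w hw => ?_⟩
  refine (h.sum_inner_sq_le hk hA m w).trans ?_
  have hmr : (m : ℝ) ≤ m₀ := by exact_mod_cast hm
  have h1 : noiseForm A m w ≤ K ^ 2 / (1 - ρ) := by
    have := noiseForm_le hN m w
    rwa [hw, one_pow, mul_one] at this
  have h2 : ∑ t ∈ Finset.range m, ∫ ω, (inner ℝ w (alg.drift A B x₀ t ω)) ^ 2 ∂(alg.law σ)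
      ≤ m * D := by
    have h3 : ∀ t ∈ Finset.range m,
        ∫ ω, (inner ℝ w (alg.drift A B x₀ t ω)) ^ 2 ∂(alg.law σ) ≤ D := fun t ht => by
      have h4 : ∫ ω, (inner ℝ w (alg.drift A B x₀ t ω)) ^ 2 ∂(alg.law σ)
          ≤ ∫ _, D ∂(alg.law σ) := by
        refine integral_mono_ae ((h.memLp_drift hk hA t).const_inner (𝕜 := ℝ) w).integrable_sq
          (integrable_const _) ?_
        filter_upwards [h.ae_norm_drift_le hk hN] with ω hω
        have h5 : |inner ℝ w (alg.drift A B x₀ t ω)| ≤ ‖alg.drift A B x₀ t ω‖ := by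
          simpa [hw] using abs_real_inner_le_norm w (alg.drift A B x₀ t ω)
        have h6 : (t : ℝ) ≤ m₀ := by
          exact_mod_cast (Finset.mem_range.1 ht).le.trans hm
        calc (inner ℝ w (alg.drift A B x₀ t ω)) ^ 2 ≤ ‖alg.drift A B x₀ t ω‖ ^ 2 := by
              rw [← sq_abs]; gcongr
          _ ≤ _ := hω t
          _ ≤ D := by rw [hD]; gcongr
      simpa using h4
    refine (Finset.sum_le_sum h3).trans ?_
    simp
  have h7 : 0 ≤ K ^ 2 / (1 - ρ) := by positivity
  have h8 : m * (σ ^ 2 * noiseForm A m w) ≤ m₀ * (σ ^ 2 * (K ^ 2 / (1 - ρ))) :=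
    mul_le_mul hmr (mul_le_mul_of_nonneg_left h1 (sq_nonneg σ))
      (mul_nonneg (sq_nonneg _) (Finset.sum_nonneg fun _ _ => sq_nonneg _)) (Nat.cast_nonneg _)
  have h9 : m * D ≤ m₀ * D := mul_le_mul_of_nonneg_right hmr hD0
  linarith

/-- The logarithms differ by log(5/3) ≤ 2/3, and the larger one is at least 4, so the relative loss
is below 1 - 6615/8000. This ratio is 6.615/8, the final constant of the entropy bound over the one
claimed. -/
theorem log_bounds {δ : ℝ} (hδ : 0 < δ) (hδ' : δ < 1 / 1000) :
    1 ≤ Real.log (1 / (4 * δ)) ∧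
      6615 / 8000 * Real.log (1 / (2.4 * δ)) ≤ Real.log (1 / (4 * δ)) := by
  have h1 : Real.log (1 / (4 * δ)) = Real.log (1 / (2.4 * δ)) - Real.log (5 / 3) := by
    rw [← Real.log_div (by positivity) (by norm_num)]
    congr 1
    field_simp
    norm_num
  have h2 : Real.log (5 / 3) ≤ 5 / 3 - 1 := Real.log_le_sub_one_of_pos (by norm_num)
  have h3 : (4 : ℝ) ≤ Real.log (1 / (2.4 * δ)) := by
    rw [Real.le_log_iff_exp_le (by positivity)]
    have h4 : Real.exp 4 = Real.exp 1 ^ 4 := by rw [← Real.exp_nat_mul]; norm_num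
    have h5 := Real.exp_one_lt_d9.le
    have h6 : Real.exp 1 ^ 4 ≤ 3 ^ 4 := by
      gcongr; linarith
    have h7 : (3 : ℝ) ^ 4 ≤ 1 / (2.4 * δ) := by
      rw [le_div_iff₀ (by positivity)]; linarith
    linarith
  rw [h1]
  constructor <;> linarith

end LowerBound

end ActiveLDS

/-! ### Assembly of the lower bound. -/

theorem mainTheorem2 (d p : ℕ) (hd : 1 ≤ d)
    (A : Matrix (Fin d) (Fin d) ℝ) (B : Matrix (Fin d) (Fin p) ℝ)
    (x₀ : EuclideanSpace ℝ (Fin d)) (σ γ : ℝ) (hσ : 0 < σ) (hγ : 0 < γ)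
    (hA : spectralRadius ℂ (ActiveLDS.toComplex A) < 1) (k : ℕ) (hk : 1 ≤ k) :
    (∀ i : ℕ, IsGreatest (ActiveLDS.excitationValues A B σ γ (2 ^ i))
      (ActiveLDS.maxExcitation A B σ γ (2 ^ i))) ∧
    Tendsto (fun i : ℕ => ActiveLDS.maxExcitation A B σ γ (2 ^ i)) atTop
      (𝓝 (ActiveLDS.maxExcitationLimit A B σ γ)) ∧
    0 < ActiveLDS.maxExcitationLimit A B σ γ ∧
    ∃ ε₀ > (0 : ℝ), ∃ δ₀ > (0 : ℝ), ∀ ε δ : ℝ, 0 < ε → ε < ε₀ → 0 < δ → δ < δ₀ →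
      ∀ alg : ActiveLDS.Algorithm.{w} d p,
        alg.BoundedWindowPower A B x₀ σ γ k →
        alg.LocallyStable A B x₀ σ ε δ →
        σ ^ 2 * (ε ^ 2)⁻¹ / 8 / ActiveLDS.maxExcitationLimit A B σ γ * Real.log (1 / (2.4 * δ))
          ≤ (alg.sampleComplexity A B x₀ σ ε δ : ℝ) := by
  obtain ⟨htend, -⟩ := ActiveLDS.tendsto_maxExcitation hd hA B σ hγ
  have hΛσ := ActiveLDS.sq_le_maxExcitationLimit hd hA B σ hγ
  have hΛ : 0 < ActiveLDS.maxExcitationLimit A B σ γ := lt_of_lt_of_le (by positivity) hΛσ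
  refine ⟨fun i => ActiveLDS.isGreatest_maxExcitation hd A B σ γ Nat.one_le_two_pow, htend, hΛ, ?_⟩
  obtain ⟨m₀, H⟩ := ActiveLDS.exists_drift_excitation_le.{w} hd hA B x₀ hσ hγ hk
  obtain ⟨C, hC, HC⟩ := ActiveLDS.exists_sum_inner_sq_le.{w} hA B x₀ σ γ hk m₀
  -- Chosen so that on horizons up to `m₀` the entropy is at most 441/600 < 1, while log(1/(4δ)) ≥
  -- 1.
  refine ⟨min 1 (σ ^ 2 / (3 * (C + 1))), by positivity, 1 / 1000, by norm_num, ?_⟩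
  intro ε δ hε hε₀ hδ hδ₀ alg hpow hstab
  -- Local stability makes the set of times nonempty, so the infimum is attained and is not the
  -- default value 0 of an empty infimum.
  have hτ : alg.StableFrom A B x₀ σ ε δ (alg.sampleComplexity A B x₀ σ ε δ) := Nat.sInf_mem hstab
  generalize alg.sampleComplexity A B x₀ σ ε δ = τ at hτ
  obtain ⟨hlog1, hlog2⟩ := ActiveLDS.log_bounds hδ hδ₀
  rcases le_total m₀ τ with hm | hm
  · obtain ⟨w, hw, hle⟩ := H τ hm alg hpow
    have h1 := hpow.log_le_sum_inner_sq hk hA hσ hε hδ hτ hw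
    have h2 := hpow.sum_inner_sq_le hk hA τ w
    generalize ActiveLDS.maxExcitationLimit A B σ γ = Λ at *
    have h3 : Real.log (1 / (4 * δ)) ≤ (21 / 10 * ε) ^ 2 / (2 * σ ^ 2) * (3 * τ * Λ) := by
      refine h1.trans ?_
      gcongr
      linarith
    -- 2.1² · 3/2 = 6.615 = 8 · 6615/8000.
    have h4 : (21 / 10 * ε) ^ 2 / (2 * σ ^ 2) * (3 * τ * Λ)
        = 6615 / 8000 * (8 * ε ^ 2 * τ * Λ / σ ^ 2) := by field_simp; ring
    have h5 : Real.log (1 / (2.4 * δ)) ≤ 8 * ε ^ 2 * τ * Λ / σ ^ 2 := by linarith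
    calc σ ^ 2 * (ε ^ 2)⁻¹ / 8 / Λ * Real.log (1 / (2.4 * δ))
        ≤ σ ^ 2 * (ε ^ 2)⁻¹ / 8 / Λ * (8 * ε ^ 2 * τ * Λ / σ ^ 2) := by gcongr
      _ = (τ : ℝ) := by field_simp
  -- A horizon of at most `m₀` is impossible: any direction serves, since the excitation is bounded
  -- by `C` for every algorithm.
  · exfalso
    obtain ⟨w, hw⟩ := ActiveLDS.exists_unit_vector hd
    have h1 := hpow.log_le_sum_inner_sq hk hA hσ hε hδ hτ hw
    have h2 := HC τ hm alg hpow w hw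
    have h3 : ε ^ 2 ≤ σ ^ 2 / (3 * (C + 1)) := by
      have h4 := hε₀.le.trans (min_le_left _ _)
      have h5 := hε₀.le.trans (min_le_right _ _)
      calc ε ^ 2 = ε * ε := sq ε
        _ ≤ 1 * (σ ^ 2 / (3 * (C + 1))) := by gcongr
        _ = _ := one_mul _
    have h4 : (21 / 10 * ε) ^ 2 / (2 * σ ^ 2) * C ≤ 441 / 600 := by
      calc (21 / 10 * ε) ^ 2 / (2 * σ ^ 2) * C = 441 / 200 * ε ^ 2 / σ ^ 2 * C := by
            field_simp; ring
        _ ≤ 441 / 200 * (σ ^ 2 / (3 * (C + 1))) / σ ^ 2 * (C + 1) := by gcongr; linarith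
        _ = 441 / 600 := by field_simp; ring
    have h5 : (21 / 10 * ε) ^ 2 / (2 * σ ^ 2) * ∑ t ∈ Finset.range τ,
        ∫ ω, (inner ℝ w (alg.state A B x₀ t ω)) ^ 2 ∂(alg.law σ)
        ≤ (21 / 10 * ε) ^ 2 / (2 * σ ^ 2) * C := by gcongr
    linarith
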